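/- Let $K$ be a nonarchimedean local field of mixed characteristic (i.e. of characteristic $0$), with algebraic closure $\overline K$, and let $E : F(X,Y,Z)=0$ be an elliptic curve over $K$ given by a Weierstrass equation in $\mathbb{P}^2$. Let $H=\mathrm{Hess}(E)$ be its Hessian curve, i.e. the plane cubic defined by the vanishing of the determinant of the $3\times 3$ matrix of second partial derivatives of $F$; it passes through $O=(0:1:0)$, has a flex there, and when it is smooth it is regarded as an elliptic curve over $K$ with origin $O$. For an elliptic curve $A/K$ with potentially multiplicative reduction, let $q\in K^\times$, $|q|<1$, be its Tate parameter and $\tau_{A/K}:\overline K^\times/q^{\mathbb Z}\to A(\overline K)$ the Tate uniformization, i.e. the map $$w\mapsto\Big(\sum_{n\in\mathbb Z}\tfrac{q^nw}{(1-q^nw)^2}-2s_1(q),\ \sum_{n\in\mathbb Z}\tfrac{(q^nw)^2}{(1-q^nw)^3}+s_1(q)\Big),\qquad s_k(q)=\sum_{n\ge1}\tfrac{n^kq^n}{1-q^n},$$ onto the Tate curve $E_q: y^2+xy=x^3-5s_3(q)x-\tfrac{5s_3(q)+7s_5(q)}{12}$ (with $q^{\mathbb Z}$ sent to the origin), followed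 by an isomorphism $E_q\cong A$ over $\overline K$ (unique up to sign). For a positive integer $m$ the canonical subgroup of $A[m]$ is $\mathcal C_{A/K}[m]=\tau_{A/K}(\mu_m)$. Suppose that $E$ and $H$ are elliptic curves which both have potentially multiplicative reduction. Then the identity map on points of $\mathbb{P}^2(\overline K)$ restricts to a group isomorphism $\alpha:E[3]\to H[3]$ (the points of either group are the common inflection points of $E$ and $H$), and $$\alpha(\mathcal C_{E/K}[3])=\mathcal C_{H/K}[3].$$ -/

import Mathlib

open scoped Matrix

noncomputable section

namespace HessianCanonical

open WeierstrassCurve MvPolynomial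

/-! ### Potentially multiplicative reduction -/

/-- The ring of integers `{x | ‖x‖ ≤ 1}` of a nonarchimedean normed field. -/
abbrev RingOfIntegers (K : Type*) [NontriviallyNormedField K] [IsUltrametricDist K] : Subring K :=
  (NormedField.valuation (K := K)).integer

/-- A curve over a local field `K` has potentially multiplicative reduction if it acquires
multiplicative reduction over some finite extension `L` of `K`: some Weierstrass model over `L` is
minimal with multiplicative reduction over the ring of integers of `L` (which is the integral
closure in `L` of the ring of integers of `K`, and is a discrete valuation ring). -/
def HasPotentiallyMultiplicativeReduction {K : Type*} [NontriviallyNormedField K]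
    [IsUltrametricDist K] (E : WeierstrassCurve K) : Prop :=
  ∃ (L : IntermediateField K (AlgebraicClosure K)) (_ : FiniteDimensional K L)
    (_ : IsDiscreteValuationRing (integralClosure (RingOfIntegers K) L))
    (_ : IsFractionRing (integralClosure (RingOfIntegers K) L) L)
    (C : VariableChange L),
    (C • E.baseChange L).HasMultiplicativeReduction (integralClosure (RingOfIntegers K) L)

/-! ### Geometric points and torsion -/

/-- The group `E(K̄)` of geometric points. -/
abbrev GeomPoint {K : Type*} [Field K] (E : WeierstrassCurve K) : Type _ :=
  (E.baseChange (AlgebraicClosure K)).toAffine.Point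

open scoped Classical in
/-- The group `E[m]` of geometric `m`-torsion points. -/
abbrev Tors {K : Type*} [Field K] (E : WeierstrassCurve K) (m : ℕ) : AddSubgroup (GeomPoint E) :=
  AddSubgroup.torsionBy (GeomPoint E) (m : ℤ)

/-- Homogeneous coordinates of a point of a Weierstrass curve in the projective plane. -/
def coords {F : Type*} [Field F] {W : WeierstrassCurve.Affine F} : W.Point → Fin 3 → F
  | .zero => ![0, 1, 0]
  | .some x y _ => ![x, y, 1]

/-! ### The Tate curve and the canonical subgroup -/

/-- The series `s_k(q) = ∑_{n ≥ 1} n^k q^n / (1 - q^n)`. -/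
def tateS {F : Type*} [Field F] [TopologicalSpace F] (k : ℕ) (q : F) : F :=
  ∑' n : ℕ+, ((n : ℕ) : F) ^ k * q ^ (n : ℕ) / (1 - q ^ (n : ℕ))

/-- The Tate curve `E_q : y² + xy = x³ + a₄(q) x + a₆(q)`, where `a₄(q) = -5 s₃(q)` and
`a₆(q) = -(5 s₃(q) + 7 s₅(q)) / 12`. -/
def tateCurve {F : Type*} [Field F] [TopologicalSpace F] (q : F) : WeierstrassCurve F :=
  ⟨1, 0, 0, -5 * tateS 3 q, -(5 * tateS 3 q + 7 * tateS 5 q) / 12⟩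

/-- `X(w, q) = ∑_{n ∈ ℤ} q^n w / (1 - q^n w)² - 2 s₁(q)`. -/
def tateX {F : Type*} [Field F] [TopologicalSpace F] (q w : F) : F :=
  (∑' n : ℤ, q ^ n * w / (1 - q ^ n * w) ^ 2) - 2 * tateS 1 q

/-- `Y(w, q) = ∑_{n ∈ ℤ} (q^n w)² / (1 - q^n w)³ + s₁(q)`. -/
def tateY {F : Type*} [Field F] [TopologicalSpace F] (q w : F) : F :=
  (∑' n : ℤ, (q ^ n * w) ^ 2 / (1 - q ^ n * w) ^ 3) + tateS 1 q

/-- The topology on `K̄` given by the unique extension of the absolute value of `K`. -/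
abbrev algClosureTopology (K : Type*) [NontriviallyNormedField K] [IsUltrametricDist K]
    [CompleteSpace K] : TopologicalSpace (AlgebraicClosure K) :=
  (spectralNorm.uniformSpace K (AlgebraicClosure K)).toTopologicalSpace

/-- A Tate parametrization of `E/K`: a Tate parameter `q ∈ K` with `0 < |q| < 1`, and an
isomorphism over `K̄` between `E` and the Tate curve `E_q`. -/
structure TateParametrization {K : Type*} [NontriviallyNormedField K] (E : WeierstrassCurve K) where
  q : K
  q_ne_zero : q ≠ 0
  norm_q_lt_one : ‖q‖ < 1
  iso : VariableChange (AlgebraicClosure K)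
  iso_smul : iso • E.baseChange (AlgebraicClosure K) =
    (tateCurve q).baseChange (AlgebraicClosure K)

open scoped Classical in
/-- The map `τ : K̄ˣ → E(K̄) ⊆ ℙ²(K̄)` with kernel `q^ℤ`: the Tate map `w ↦ (X(w, q), Y(w, q))`
onto `E_q`, followed by the isomorphism
`(x, y) ↦ (u² x + r, u³ y + u² s x + t)` from `E_q` to `E`. -/
def TateParametrization.tau {K : Type*} [NontriviallyNormedField K] [IsUltrametricDist K]
    [CompleteSpace K] {E : WeierstrassCurve K} (T : TateParametrization E)
    (w : (AlgebraicClosure K)ˣ) : Fin 3 → AlgebraicClosure K :=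
  letI := algClosureTopology K
  let q := algebraMap K (AlgebraicClosure K) T.q
  let x := tateX q (w : AlgebraicClosure K)
  let y := tateY q (w : AlgebraicClosure K)
  if ∃ n : ℤ, (w : AlgebraicClosure K) = q ^ n then ![0, 1, 0]
  else ![(T.iso.u : AlgebraicClosure K) ^ 2 * x + T.iso.r,
    (T.iso.u : AlgebraicClosure K) ^ 3 * y + (T.iso.u : AlgebraicClosure K) ^ 2 * T.iso.s * x
      + T.iso.t, 1]

/-- The canonical subgroup `C_{E/K}[m] = τ(μ_m) ⊆ E[m]`. The parameter `q` is unique and the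
isomorphism `E ≅ E_q` is unique up to sign, so that this does not depend on the choice of
parametrization. -/
def canonicalSubgroup {K : Type*} [NontriviallyNormedField K] [IsUltrametricDist K]
    [CompleteSpace K] (E : WeierstrassCurve K) (m : ℕ) : Set (Tors E m) :=
  {P | ∃ (T : TateParametrization E) (ζ : (AlgebraicClosure K)ˣ),
    ζ ^ m = 1 ∧ coords (P : GeomPoint E) = T.tau ζ}

/-! ### The Hessian curve -/

/-- The Hessian form of a ternary form: the determinant of the matrix of second derivatives. -/
def hessianForm {K : Type*} [Field K] (F : MvPolynomial (Fin 3) K) : MvPolynomial (Fin 3) K :=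
  Matrix.det (Matrix.of fun i j : Fin 3 => pderiv i (pderiv j F))

/-- The equation of the Hessian curve of a plane Weierstrass curve. -/
def hess {K : Type*} [Field K] (E : WeierstrassCurve K) : MvPolynomial (Fin 3) K :=
  hessianForm (WeierstrassCurve.Projective.polynomial E)

/-- A Weierstrass model of the pointed plane cubic `(G = 0, (0 : 1 : 0))` over `K`: a Weierstrass
curve together with an invertible linear change of homogeneous coordinates which carries it
onto the cubic and carries the point at infinity `(0 : 1 : 0)` to `(0 : 1 : 0)`. -/
structure WeierstrassModel {K : Type*} [Field K] (G : MvPolynomial (Fin 3) K) where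
  curve : WeierstrassCurve K
  change : GL (Fin 3) K
  scale : Kˣ
  subst_eq : bind₁ (fun i => ∑ j, C ((change : Matrix (Fin 3) (Fin 3) K) i j) * X j) G =
    C (scale : K) * WeierstrassCurve.Projective.polynomial curve
  base : ∃ c : Kˣ, (change : Matrix (Fin 3) (Fin 3) K) *ᵥ ![0, 1, 0] = (c : K) • ![0, 1, 0]

/-- The point of the plane cubic `G = 0` (in homogeneous coordinates) which corresponds to a
geometric point of its Weierstrass model. -/
def WeierstrassModel.toPlane {K : Type*} [Field K] {G : MvPolynomial (Fin 3) K}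
    (H : WeierstrassModel G) (Q : GeomPoint H.curve) : Fin 3 → AlgebraicClosure K :=
  (H.change : Matrix (Fin 3) (Fin 3) K).map (algebraMap K (AlgebraicClosure K)) *ᵥ coords Q

end HessianCanonical

end

/-!
The three-torsion points of a Weierstrass curve are its flexes, and they are also the flexes of its
Hessian. In the coordinates `u = 12 x + b₂`, `η = 2 y + a₁ x + a₃` both curves are explicit
(`equation_iff_short`, `eval_hess`), the change of coordinates to a Weierstrass model of the Hessian
is determined by comparing coefficients (`WeierstrassModel.exists_isHessianChange`), and the
resulting bijection of three-torsion points is additive because for distinct points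
`P₁ + P₂ + P₃ = 0` says that they are collinear (`IsHessianChange.add_add_eq_zero`).

The canonical subgroup is recognized by an absolute value. The coordinate
`s = (1 + u c₄ / c₆) / 12` (`normCoord`) is independent of the Weierstrass model, and at
three-torsion points it is a root of a quartic which is congruent to `s³ (3 s - 1)` when `|j| > 1`
(`normCoord_quartic`). Exactly one root satisfies `|s| ≥ 1` (`eq_of_quartic`), and it belongs to the
canonical subgroup: at a primitive cube root of unity `ζ` the Tate series satisfies
`|X(ζ) + 1 / 3| < 1` (`norm_tateX_add_third_lt_one`), and `s` is close to `-X`. So a point of `E[3]`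
is canonical if and only if it is zero or `|s| ≥ 1` (`mem_canonicalSubgroup_iff`). The coordinate of
the same point on the Hessian is an explicit rational function of `s`
(`IsHessianChange.normCoord_eq`), from which `|s| ≥ 1` is seen to be inherited
(`one_le_norm_of_hessian`).

The criterion rests on two facts about the Tate curve. First, `(X(ζ), Y(ζ))` is a flex of the Tate
curve (`tate_equation`, `tate_flex`). This is proved by multiplying Eisenstein series: products of
the kernels `φᵢ = (u d/du)ⁱ φ₀`, `φ₀ = (1 + u) / (2 (1 - u))`, are expressed through the addition
formula `φ₀(u) φ₀(v) = φ₀(uv) (φ₀(u) + φ₀(v)) - 1/4`, and the double series over `ℤ²` is summed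
along its antidiagonals; the terms with `u = qʲ w`, which converge only after regularization,
contribute the linear terms. Second, every curve with `|j| > 1` is a Tate curve over `K̄`
(`nonempty_tateParametrization`), because `q ↦ Δ(q) / c₄(q)³` is inverted by a contraction
(`exists_tate_parameter`), and potentially multiplicative reduction implies `|j| > 1`
(`HasPotentiallyMultiplicativeReduction.norm_Δ_lt`).
-/

namespace HessianCanonical

open Filter Topology

/-! ### Sums over `ℤ` and `ℤ × ℤ` in a complete ultrametric field -/

section Sums

variable {L : Type*} [NormedField L]

instance [IsUltrametricDist L] : NonarchimedeanRing L where
  is_nonarchimedean := NonarchimedeanAddGroup.is_nonarchimedean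

lemma norm_sub_le_max_norm [IsUltrametricDist L] (x y : L) : ‖x - y‖ ≤ max ‖x‖ ‖y‖ := by
  simpa [sub_eq_add_neg] using IsUltrametricDist.norm_add_le_max x (-y)

lemma norm_one_add_of_norm_lt_one [IsUltrametricDist L] {u : L} (hu : ‖u‖ < 1) : ‖1 + u‖ = 1 := by
  rw [IsUltrametricDist.norm_add_eq_max_of_norm_ne_norm (by rw [norm_one]; exact hu.ne'), norm_one,
    max_eq_left hu.le]

lemma norm_one_sub_of_norm_lt_one [IsUltrametricDist L] {u : L} (hu : ‖u‖ < 1) : ‖1 - u‖ = 1 := by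
  rw [sub_eq_add_neg, norm_one_add_of_norm_lt_one (by rwa [norm_neg])]

lemma summable_of_tendsto_zero [IsUltrametricDist L] [CompleteSpace L] {ι : Type*} {f : ι → L}
    (hf : Tendsto f cofinite (𝓝 0)) :
    Summable f :=
  NonarchimedeanAddGroup.summable_of_tendsto_cofinite_zero hf

lemma tendsto_cofinite_prod {ι κ : Type*} {F : ι × κ → L} {B : ι → ℝ}
    (hB : Tendsto B cofinite (𝓝 0)) (hFB : ∀ p, ‖F p‖ ≤ B p.1)
    (hF : ∀ i, Tendsto (fun k => F (i, k)) cofinite (𝓝 0)) : Tendsto F cofinite (𝓝 0) := by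
  rw [Metric.tendsto_nhds]
  intro ε hε
  have h1 : {i | ¬ B i < ε}.Finite := hB.eventually_lt_const hε
  have h2 : ∀ i, {k | ¬ ‖F (i, k)‖ < ε}.Finite := by
    intro i
    have := Metric.tendsto_nhds.mp (hF i) ε hε
    simpa [Filter.eventually_cofinite] using this
  rw [Filter.eventually_cofinite]
  refine (Set.Finite.biUnion h1 fun i _ => (h2 i).image fun k => (i, k)).subset ?_
  rintro ⟨i, k⟩ h
  simp only [dist_zero_right, Set.mem_ofPred_eq] at h
  simp only [Set.mem_iUnion, Set.mem_image]
  refine ⟨i, fun hi => h ((hFB _).trans_lt hi), k, h, rfl⟩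

lemma tendsto_cofinite_int {X : Type*} {f : ℤ → X} {l : Filter X} :
    Tendsto f cofinite l ↔ Tendsto f atBot l ∧ Tendsto f atTop l := by
  rw [Int.cofinite_eq, tendsto_sup]

/-- A telescoping sum over `ℤ`. -/
lemma hasSum_int_telescope [IsUltrametricDist L] [CompleteSpace L] {b : ℤ → L} {β β' : L}
    (hb : Tendsto b atTop (𝓝 β)) (hb' : Tendsto b atBot (𝓝 β')) :
    HasSum (fun j => b (j + 1) - b j) (β - β') := by
  have hs : Summable fun j => b (j + 1) - b j := by
    refine summable_of_tendsto_zero (tendsto_cofinite_int.mpr ⟨?_, ?_⟩)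
    · have := (hb'.comp (tendsto_atBot_add_const_right _ (1 : ℤ) tendsto_id)).sub hb'
      rwa [sub_self] at this
    · have := (hb.comp (tendsto_atTop_add_const_right _ (1 : ℤ) tendsto_id)).sub hb
      rwa [sub_self] at this
  have h1 : HasSum (fun n : ℕ => b ((n : ℤ) + 1) - b n) (β - b 0) := by
    have hs1 : Summable fun n : ℕ => b ((n : ℤ) + 1) - b n :=
      hs.comp_injective Nat.cast_injective
    rw [hs1.hasSum_iff_tendsto_nat]
    have := Finset.sum_range_sub (fun n : ℕ => b n)
    push_cast at this
    simp only [this]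
    exact (hb.comp tendsto_natCast_atTop_atTop).sub_const _
  have h2 : HasSum (fun n : ℕ => b (-((n : ℤ) + 1) + 1) - b (-((n : ℤ) + 1))) (b 0 - β') := by
    have hs1 : Summable fun n : ℕ => b (-((n : ℤ) + 1) + 1) - b (-((n : ℤ) + 1)) :=
      hs.comp_injective (i := fun n : ℕ => -((n : ℤ) + 1)) (fun m n h => by simpa using h)
    rw [hs1.hasSum_iff_tendsto_nat]
    have e : ∀ N, ∑ n ∈ Finset.range N, (b (-((n : ℤ) + 1) + 1) - b (-((n : ℤ) + 1)))
        = b 0 - b (-(N : ℤ)) := by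
      intro N
      induction N with
      | zero => simp
      | succ N ih =>
        rw [Finset.sum_range_succ, ih, show -((N : ℤ) + 1) + 1 = -(N : ℤ) by ring]
        push_cast
        ring
    simp only [e]
    have h3 : Tendsto (fun n : ℕ => -(n : ℤ)) atTop atBot :=
      tendsto_neg_atTop_atBot.comp tendsto_natCast_atTop_atTop
    exact (hb'.comp h3).const_sub (b 0)
  have h3 := HasSum.of_nat_of_neg_add_one (f := fun j => b (j + 1) - b j) h1 h2
  rwa [sub_add_sub_cancel] at h3

lemma tendsto_int_sub_atTop_atBot (m : ℤ) : Tendsto (fun j : ℤ => m - j) atTop atBot := by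
  simpa [sub_eq_add_neg] using
    tendsto_atBot_add_const_left _ m (tendsto_neg_atTop_atBot (G := ℤ))

lemma tendsto_int_sub_atBot_atTop (m : ℤ) : Tendsto (fun j : ℤ => m - j) atBot atTop := by
  simpa [sub_eq_add_neg] using
    tendsto_atTop_add_const_left _ m (tendsto_neg_atBot_atTop (G := ℤ))

/-- A sequence on `ℤ` with limits `1/2` at `+∞` and `-1/2` at `-∞`. -/
structure HalfLimits (a : ℤ → L) : Prop where
  top : Tendsto a atTop (𝓝 (1 / 2))
  bot : Tendsto a atBot (𝓝 (-(1 / 2)))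

lemma HalfLimits.tendsto_add {a b : ℤ → L} (ha : HalfLimits a) (hb : HalfLimits b) (m : ℤ) :
    Tendsto (fun j => a j + b (m - j)) cofinite (𝓝 0) := by
  refine tendsto_cofinite_int.mpr ⟨?_, ?_⟩
  · simpa using ha.bot.add (hb.top.comp (tendsto_int_sub_atBot_atTop m))
  · simpa using ha.top.add (hb.bot.comp (tendsto_int_sub_atTop_atBot m))

lemma HalfLimits.hasSum_add [CharZero L] [IsUltrametricDist L] [CompleteSpace L]
    {a b : ℤ → L} (ha : HalfLimits a) (hb : HalfLimits b) (m : ℤ) :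
    HasSum (fun j => a j + b (m - j)) ((∑' j, (a j + b (-j))) + m) := by
  have hs : ∀ m, Summable fun j => a j + b (m - j) := fun m =>
    summable_of_tendsto_zero (ha.tendsto_add hb m)
  have hstep : ∀ m : ℤ, HasSum (fun j => (a j + b (m + 1 - j)) - (a j + b (m - j))) 1 := by
    intro m
    have h := hasSum_int_telescope hb.top hb.bot
    have h' := (Equiv.subLeft m).hasSum_iff.mpr h
    have e : (1 / 2 - -(1 / 2) : L) = 1 := by norm_num
    rw [e] at h'
    refine h'.congr_fun ?_ |> fun h => h
    intro j
    simp only [Function.comp, Equiv.subLeft_apply]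
    rw [show m - j + 1 = m + 1 - j by ring]; ring
  have hrec : ∀ m : ℤ, ∑' j, (a j + b (m + 1 - j)) = ∑' j, (a j + b (m - j)) + 1 := by
    intro m
    have := (hs (m + 1)).tsum_sub (hs m)
    rw [(hstep m).tsum_eq] at this
    rw [this]; ring
  have hval : ∑' j, (a j + b (m - j)) = ∑' j, (a j + b (-j)) + m := by
    induction m using Int.induction_on with
    | zero => simp
    | succ n ih => rw [hrec, ih]; push_cast; ring
    | pred n ih =>
      have := hrec (-(n : ℤ) - 1)
      rw [sub_add_cancel, ih] at this
      push_cast at this ⊢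
      linear_combination -this
  rw [← hval]
  exact (hs m).hasSum

lemma HalfLimits.bounded {a : ℤ → L} (ha : HalfLimits a) : ∃ C : ℝ, 0 < C ∧ ∀ j, ‖a j‖ ≤ C := by
  have h : ∀ᶠ j in (cofinite : Filter ℤ), ‖a j‖ ≤ ‖(1 / 2 : L)‖ + 1 := by
    rw [Int.cofinite_eq, eventually_sup]
    constructor
    · have := ha.bot.norm
      rw [norm_neg] at this
      exact this.eventually_le_const (by linarith)
    · exact ha.top.norm.eventually_le_const (by linarith)
  rw [eventually_cofinite] at h
  obtain ⟨C, hC⟩ := (h.image fun j => ‖a j‖).bddAbove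
  refine ⟨max C (‖(1 / 2 : L)‖ + 1), lt_max_of_lt_right (by positivity), fun j => ?_⟩
  by_cases hj : ‖a j‖ ≤ ‖(1 / 2 : L)‖ + 1
  · exact hj.trans (le_max_right _ _)
  · exact (hC ⟨j, hj, rfl⟩).trans (le_max_left _ _)

/-- The substitution `(m, j) ↦ (j, m - j)` of `ℤ²`. -/
def shear : ℤ × ℤ ≃ ℤ × ℤ where
  toFun p := (p.2, p.1 - p.2)
  invFun p := (p.1 + p.2, p.1)
  left_inv p := by simp
  right_inv p := by simp

lemma summable_intCast_mul [IsUltrametricDist L] [CompleteSpace L] {g : ℤ → L}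
    (hg : Summable g) : Summable fun m : ℤ => (m : L) * g m := by
  refine summable_of_tendsto_zero (squeeze_zero_norm (a := fun m => ‖g m‖) (fun m => ?_) ?_)
  · rw [norm_mul]
    exact mul_le_of_le_one_left (norm_nonneg _) (IsUltrametricDist.norm_intCast_le_one L m)
  · simpa using hg.tendsto_cofinite_zero.norm

/-- The sum over `ℤ²` of `g(j + k) (a(j) + b(k))`: along each line `j + k = m` the inner sum is
`W + m`, where `W` is its value for `m = 0`. -/
lemma hasSum_mul_halfLimits [CharZero L] [IsUltrametricDist L] [CompleteSpace L]
    {g a b : ℤ → L} (hg : Summable g) (ha : HalfLimits a) (hb : HalfLimits b) :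
    HasSum (fun p : ℤ × ℤ => g (p.1 + p.2) * (a p.1 + b p.2))
      ((∑' m, g m) * (∑' j, (a j + b (-j))) + ∑' m : ℤ, (m : L) * g m) := by
  rw [← shear.hasSum_iff]
  obtain ⟨C, hC0, hC⟩ := ha.bounded
  obtain ⟨D, hD0, hD⟩ := hb.bounded
  have hs : Summable ((fun p : ℤ × ℤ => g (p.1 + p.2) * (a p.1 + b p.2)) ∘ shear) := by
    refine summable_of_tendsto_zero
      (tendsto_cofinite_prod (B := fun m => ‖g m‖ * (C + D)) ?_ ?_ ?_)
    · simpa using hg.tendsto_cofinite_zero.norm.mul_const (C + D)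
    · rintro ⟨m, j⟩
      simp only [shear, Equiv.coe_fn_mk, Function.comp, add_sub_cancel, norm_mul]
      gcongr
      exact (norm_add_le _ _).trans (add_le_add (hC _) (hD _))
    · intro m
      simpa [shear] using (ha.tendsto_add hb m).const_mul (g m)
  have h1 := hs.hasSum.prod_fiberwise (g := fun m => g m * ((∑' j, (a j + b (-j))) + m)) (by
    intro m
    simpa [shear] using (ha.hasSum_add hb m).mul_left (g m))
  have h2 := (hg.hasSum.mul_right (∑' j, (a j + b (-j)))).add (summable_intCast_mul hg).hasSum
  have h3 := h1.unique (h2.congr_fun fun m => by ring)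
  rw [← h3]
  exact hs.hasSum

lemma hasSum_mul_fst_snd [IsUltrametricDist L] [CompleteSpace L] {f h : ℤ → L}
    (hf : Summable f) (hh : Summable h) :
    HasSum (fun p : ℤ × ℤ => f p.1 * h p.2) ((∑' j, f j) * ∑' k, h k) :=
  hf.hasSum.mul_of_nonarchimedean hh.hasSum

lemma hasSum_mul_add_fst [IsUltrametricDist L] [CompleteSpace L] {g f : ℤ → L}
    (hg : Summable g) (hf : Summable f) :
    HasSum (fun p : ℤ × ℤ => g (p.1 + p.2) * f p.1) ((∑' m, g m) * ∑' j, f j) := by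
  rw [← shear.hasSum_iff]
  simpa [shear, Function.comp_def] using hasSum_mul_fst_snd hg hf

lemma hasSum_mul_add_snd [IsUltrametricDist L] [CompleteSpace L] {g h : ℤ → L}
    (hg : Summable g) (hh : Summable h) :
    HasSum (fun p : ℤ × ℤ => g (p.1 + p.2) * h p.2) ((∑' m, g m) * ∑' k, h k) := by
  rw [← (Equiv.prodComm ℤ ℤ).hasSum_iff]
  simpa [Function.comp_def, add_comm] using hasSum_mul_add_fst hg hh

lemma hasSum_ite_fst [IsUltrametricDist L] [CompleteSpace L] {h : ℤ → L} (hh : Summable h) :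
    HasSum (fun p : ℤ × ℤ => if p.1 = 0 then h p.2 else 0) (∑' k, h k) := by
  have := ((hasSum_ite_eq (0 : ℤ) (1 : L))).mul_of_nonarchimedean hh.hasSum
  simpa using this

lemma hasSum_ite_snd [IsUltrametricDist L] [CompleteSpace L] {f : ℤ → L} (hf : Summable f) :
    HasSum (fun p : ℤ × ℤ => if p.2 = 0 then f p.1 else 0) (∑' j, f j) := by
  rw [← (Equiv.prodComm ℤ ℤ).hasSum_iff]
  simpa [Function.comp_def] using hasSum_ite_fst hf

lemma hasSum_ite_add [IsUltrametricDist L] [CompleteSpace L] {f : ℤ → L} (hf : Summable f) :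
    HasSum (fun p : ℤ × ℤ => if p.1 + p.2 = 0 then f p.1 else 0) (∑' j, f j) := by
  rw [← shear.hasSum_iff]
  simpa [shear, Function.comp_def] using hasSum_ite_fst hf

end Sums

end HessianCanonical

namespace HessianCanonical

open Filter Topology

/-! ### The kernels of the Eisenstein sums -/

section Kernels

variable {L : Type*} [Field L]

/-- `φ₀(u) = (1 + u) / (2 (1 - u))`, the multiplicative cotangent. Like all the kernels below it
takes the junk value `0` at its pole `u = 1`, so that sums over all powers of `q` leave out the
pole by themselves. -/
def phi0 (u : L) : L := (1 + u) / (2 * (1 - u))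

/-- `φ₁ = D φ₀ = u / (1 - u)²`, where `D = u d/du`. -/
def phi1 (u : L) : L := u / (1 - u) ^ 2

/-- `φ₂ = D² φ₀`, written as a polynomial in `φ₀` and `φ₁`. -/
def phi2 (u : L) : L := 2 * phi0 u * phi1 u

/-- `φ₃ = D³ φ₀`, written as a polynomial in `φ₁`. -/
def phi3 (u : L) : L := 6 * phi1 u ^ 2 + phi1 u

/-- `φ₄ = D⁴ φ₀`, written as a polynomial in `φ₁` and `φ₂`. -/
def phi4 (u : L) : L := (12 * phi1 u + 1) * phi2 u

/-- `φ₅ = D⁵ φ₀`, written as a polynomial in `φ₁` and `φ₂`. -/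
def phi5 (u : L) : L := 30 * phi2 u ^ 2 + phi1 u

@[simp] lemma phi0_one : phi0 (1 : L) = 0 := by simp [phi0]
@[simp] lemma phi1_one : phi1 (1 : L) = 0 := by simp [phi1]
@[simp] lemma phi2_one : phi2 (1 : L) = 0 := by simp [phi2]
@[simp] lemma phi3_one : phi3 (1 : L) = 0 := by simp [phi3]
@[simp] lemma phi4_one : phi4 (1 : L) = 0 := by simp [phi4]
@[simp] lemma phi5_one : phi5 (1 : L) = 0 := by simp [phi5]

lemma phi0_inv {u : L} (hu : u ≠ 0) : phi0 u⁻¹ = -phi0 u := by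
  by_cases h : u = 1
  · simp [h]
  have h1 : 1 - u ≠ 0 := sub_ne_zero.mpr (Ne.symm h)
  have h2 : u - 1 ≠ 0 := sub_ne_zero.mpr h
  have h3 : (1 + u⁻¹) = (1 + u) / u := by field_simp; ring
  have h4 : (2 * (1 - u⁻¹)) = -(2 * (1 - u)) / u := by field_simp; ring
  rw [phi0, phi0, h3, h4, div_div_div_cancel_right₀ hu, div_neg]

lemma phi1_inv {u : L} (hu : u ≠ 0) : phi1 u⁻¹ = phi1 u := by
  by_cases h : u = 1
  · simp [h]
  have h1 : 1 - u ≠ 0 := sub_ne_zero.mpr (Ne.symm h)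
  have h2 : u - 1 ≠ 0 := sub_ne_zero.mpr h
  have h3 : (1 - u⁻¹) = -(1 - u) / u := by field_simp; ring
  rw [phi1, phi1, h3]
  field_simp

lemma phi2_inv {u : L} (hu : u ≠ 0) : phi2 u⁻¹ = -phi2 u := by
  simp only [phi2, phi0_inv hu, phi1_inv hu]; ring

lemma phi3_inv {u : L} (hu : u ≠ 0) : phi3 u⁻¹ = phi3 u := by
  simp only [phi3, phi1_inv hu]

lemma phi4_inv {u : L} (hu : u ≠ 0) : phi4 u⁻¹ = -phi4 u := by
  simp only [phi4, phi1_inv hu, phi2_inv hu]; ring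

lemma phi5_inv {u : L} (hu : u ≠ 0) : phi5 u⁻¹ = phi5 u := by
  simp only [phi5, phi1_inv hu, phi2_inv hu]; ring

variable [CharZero L]

lemma phi1_eq {u : L} (h : u ≠ 1) : phi1 u = phi0 u ^ 2 - 1 / 4 := by
  have h1 : 1 - u ≠ 0 := sub_ne_zero.mpr (Ne.symm h)
  simp only [phi0, phi1]
  field_simp
  ring

lemma phi2_sq (u : L) : phi2 u ^ 2 = 4 * phi1 u ^ 3 + phi1 u ^ 2 := by
  by_cases h : u = 1
  · simp [h]
  · rw [phi2, phi1_eq h]; ring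

lemma phi0_mul_phi2 (u : L) : phi0 u * phi2 u = 2 * phi1 u ^ 2 + phi1 u / 2 := by
  by_cases h : u = 1
  · simp [h]
  · rw [phi2, phi1_eq h]; ring

/-- The addition theorem of the cotangent. -/
lemma phi0_add {u v : L} (hu : u ≠ 1) (hv : v ≠ 1) (huv : u * v ≠ 1) :
    phi0 u + phi0 v ≠ 0 ∧
      phi0 (u * v) = (phi0 u * phi0 v + 1 / 4) / (phi0 u + phi0 v) := by
  have h1 : 1 - u ≠ 0 := sub_ne_zero.mpr (Ne.symm hu)
  have h2 : 1 - v ≠ 0 := sub_ne_zero.mpr (Ne.symm hv)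
  have h3 : 1 - u * v ≠ 0 := sub_ne_zero.mpr (Ne.symm huv)
  have h : phi0 u + phi0 v = (1 - u * v) / ((1 - u) * (1 - v)) := by
    simp only [phi0]; field_simp; ring
  have h0 : phi0 u + phi0 v ≠ 0 := by
    rw [h]; exact div_ne_zero h3 (mul_ne_zero h1 h2)
  refine ⟨h0, ?_⟩
  rw [eq_div_iff h0, h]
  simp only [phi0]
  field_simp
  ring

section Products

variable {u v : L} (hu : u ≠ 1) (hv : v ≠ 1) (huv : u * v ≠ 1)
include hu hv huv

/-- The addition theorem of the cotangent, differentiated once in each variable. -/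
lemma phi1_mul_phi1 : phi1 u * phi1 v =
    phi2 (u * v) * (phi0 u + phi0 v) + phi1 (u * v) * (phi1 u + phi1 v) := by
  obtain ⟨h0, hg⟩ := phi0_add hu hv huv
  simp only [phi2, phi1_eq hu, phi1_eq hv, phi1_eq huv, hg]
  field_simp
  ring

lemma phi1_mul_phi2 : phi1 u * phi2 v =
    phi3 (u * v) * (phi0 u + phi0 v) + phi2 (u * v) * (phi1 u + 2 * phi1 v)
      + phi1 (u * v) * phi2 v := by
  obtain ⟨h0, hg⟩ := phi0_add hu hv huv
  simp only [phi3, phi2, phi1_eq hu, phi1_eq hv, phi1_eq huv, hg]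
  field_simp
  ring

lemma phi1_mul_phi3 : phi1 u * phi3 v =
    phi4 (u * v) * (phi0 u + phi0 v) + phi3 (u * v) * (phi1 u + 3 * phi1 v)
      + 3 * (phi2 (u * v) * phi2 v) + phi1 (u * v) * phi3 v := by
  obtain ⟨h0, hg⟩ := phi0_add hu hv huv
  simp only [phi4, phi3, phi2, phi1_eq hu, phi1_eq hv, phi1_eq huv, hg]
  field_simp
  ring

lemma phi2_mul_phi2 : phi2 u * phi2 v =
    phi4 (u * v) * (phi0 u + phi0 v) + 2 * (phi3 (u * v) * (phi1 u + phi1 v))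
      + phi2 (u * v) * (phi2 u + phi2 v) := by
  obtain ⟨h0, hg⟩ := phi0_add hu hv huv
  simp only [phi4, phi3, phi2, phi1_eq hu, phi1_eq hv, phi1_eq huv, hg]
  field_simp
  ring

end Products

end Kernels

end HessianCanonical

namespace HessianCanonical

open Filter Topology

/-! ### Eisenstein sums -/

section EisensteinSums

variable {L : Type*} [NormedField L]

/-- The properties of the kernels `φ₁, …, φ₅` which make the sums `∑ f(qʲ w)` over `j ∈ ℤ` converge
and be even or odd (according to the sign `ε`) under `w ↦ w⁻¹`. -/
structure IsKernel (f : L → L) (ε : L) : Prop where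
  continuousAt : ContinuousAt f 0
  map_zero : f 0 = 0
  map_inv : ∀ u, u ≠ 0 → f u⁻¹ = ε * f u
  sign : ε = 1 ∨ ε = -1

lemma IsKernel.mul {f g : L → L} {ε δ : L} (hf : IsKernel f ε) (hg : IsKernel g δ) :
    IsKernel (fun u => f u * g u) (ε * δ) where
  continuousAt := hf.continuousAt.mul hg.continuousAt
  map_zero := by simp [hf.map_zero]
  map_inv u hu := by rw [hf.map_inv u hu, hg.map_inv u hu]; ring
  sign := by rcases hf.sign with h | h <;> rcases hg.sign with h' | h' <;> simp [h, h']

lemma continuousAt_phi1 : ContinuousAt (phi1 : L → L) 0 := by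
  unfold phi1
  exact continuousAt_id.div ((continuousAt_const.sub continuousAt_id).pow 2) (by simp)

lemma isKernel_phi1 : IsKernel (phi1 : L → L) 1 where
  continuousAt := continuousAt_phi1
  map_zero := by simp [phi1]
  map_inv u hu := by rw [phi1_inv hu, one_mul]
  sign := Or.inl rfl

lemma isKernel_phi3 : IsKernel (phi3 : L → L) 1 where
  continuousAt := by
    unfold phi3
    exact (continuousAt_const.mul (continuousAt_phi1.pow 2)).add continuousAt_phi1
  map_zero := by simp [phi3, phi1]
  map_inv u hu := by rw [phi3_inv hu, one_mul]
  sign := Or.inl rfl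

variable [CharZero L]

lemma continuousAt_phi0 : ContinuousAt (phi0 : L → L) 0 := by
  unfold phi0
  exact (continuousAt_const.add continuousAt_id).div
    (continuousAt_const.mul (continuousAt_const.sub continuousAt_id)) (by simp)

lemma isKernel_phi2 : IsKernel (phi2 : L → L) (-1) where
  continuousAt := by
    unfold phi2
    exact (continuousAt_const.mul continuousAt_phi0).mul continuousAt_phi1
  map_zero := by simp [phi2, phi1]
  map_inv u hu := by rw [phi2_inv hu, neg_one_mul]
  sign := Or.inr rfl

lemma isKernel_phi4 : IsKernel (phi4 : L → L) (-1) where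
  continuousAt := by
    unfold phi4
    exact ((continuousAt_const.mul continuousAt_phi1).add continuousAt_const).mul
      isKernel_phi2.continuousAt
  map_zero := by simp [phi4, phi2, phi1]
  map_inv u hu := by rw [phi4_inv hu, neg_one_mul]
  sign := Or.inr rfl

lemma isKernel_phi5 : IsKernel (phi5 : L → L) 1 where
  continuousAt := by
    unfold phi5
    exact (continuousAt_const.mul (isKernel_phi2.continuousAt.pow 2)).add continuousAt_phi1
  map_zero := by simp [phi5, phi2, phi1]
  map_inv u hu := by rw [phi5_inv hu, one_mul]
  sign := Or.inl rfl

/-- The sum `∑ f(qʲ w)` over `j ∈ ℤ`. -/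
noncomputable def eisSum (q : L) (f : L → L) (w : L) : L := ∑' j : ℤ, f (q ^ j * w)

omit [CharZero L] in
lemma eisSum_def (q : L) (f : L → L) (w : L) : eisSum q f w = ∑' j : ℤ, f (q ^ j * w) := rfl

/-- The weighted sum `∑ m f(qᵐ w)` over `m ∈ ℤ`. -/
noncomputable def eisMoment (q : L) (f : L → L) (w : L) : L := ∑' m : ℤ, (m : L) * f (q ^ m * w)

/-- The regularized sum of `φ₀(qʲ x) + φ₀(q⁻ʲ y)` over `j ∈ ℤ`. -/
noncomputable def eisZeta (q x y : L) : L := ∑' j : ℤ, (phi0 (q ^ j * x) + phi0 (q ^ (-j) * y))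

variable {q : L} (hq0 : q ≠ 0) (hq1 : ‖q‖ < 1)

omit [CharZero L] in
include hq1 in
lemma tendsto_zpow_mul (w : L) : Tendsto (fun j : ℤ => q ^ j * w) atTop (𝓝 0) := by
  rw [← Nat.map_cast_int_atTop, tendsto_map'_iff]
  simpa [Function.comp_def] using (tendsto_pow_atTop_nhds_zero_of_norm_lt_one hq1).mul_const w

omit [CharZero L] in
include hq0 in
lemma zpow_mul_ne_zero {w : L} (hw : w ≠ 0) (j : ℤ) : q ^ j * w ≠ 0 :=
  mul_ne_zero (zpow_ne_zero _ hq0) hw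

omit [CharZero L] in
lemma zpow_neg_mul_inv (w : L) (j : ℤ) : q ^ (-j) * w⁻¹ = (q ^ j * w)⁻¹ := by
  rw [zpow_neg, mul_inv]

omit [CharZero L] in
include hq1 in
lemma zpow_eq_one_iff_of_norm_lt_one {m : ℤ} : q ^ m = 1 ↔ m = 0 := by
  refine ⟨fun h => ?_, fun h => by simp [h]⟩
  have h1 : ‖q‖ ^ m = 1 := by rw [← norm_zpow, h, norm_one]
  rcases zpow_eq_one_iff_cases₀.mp h1 with h2 | h2 | h2
  · exact h2
  · exact absurd h2 hq1.ne
  · linarith [norm_nonneg q, h2.1]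

section Limits

include hq0 hq1

omit [CharZero L] in
lemma IsKernel.tendsto_cofinite {f : L → L} {ε : L} (hf : IsKernel f ε) {w : L} (hw : w ≠ 0) :
    Tendsto (fun j : ℤ => f (q ^ j * w)) cofinite (𝓝 0) := by
  have htop : ∀ w : L, Tendsto (fun j : ℤ => f (q ^ j * w)) atTop (𝓝 0) := by
    intro w
    have := hf.continuousAt.tendsto.comp (tendsto_zpow_mul hq1 w)
    rwa [hf.map_zero] at this
  refine tendsto_cofinite_int.mpr ⟨?_, htop w⟩
  have h := ((htop w⁻¹).comp tendsto_neg_atBot_atTop).const_mul ε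
  rw [mul_zero] at h
  refine h.congr fun j => ?_
  have h1 := hf.map_inv _ (zpow_mul_ne_zero hq0 hw j)
  simp only [Function.comp]
  rw [zpow_neg_mul_inv, h1]
  rcases hf.sign with h | h <;> simp [h]

lemma halfLimits_phi0 {w : L} (hw : w ≠ 0) : HalfLimits fun j : ℤ => phi0 (q ^ j * w) := by
  have htop : ∀ w : L, Tendsto (fun j : ℤ => phi0 (q ^ j * w)) atTop (𝓝 (1 / 2)) := by
    intro w
    have := continuousAt_phi0.tendsto.comp (tendsto_zpow_mul hq1 w)
    have e : phi0 (0 : L) = 1 / 2 := by simp [phi0]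
    rwa [e] at this
  refine ⟨htop w, ?_⟩
  refine ((htop w⁻¹).comp tendsto_neg_atBot_atTop).neg.congr fun j => ?_
  simp only [Function.comp]
  rw [zpow_neg_mul_inv, phi0_inv (zpow_mul_ne_zero hq0 hw j), neg_neg]

omit [CharZero L] in
lemma IsKernel.summable [IsUltrametricDist L] [CompleteSpace L] {f : L → L} {ε : L}
    (hf : IsKernel f ε) {w : L} (hw : w ≠ 0) : Summable fun j : ℤ => f (q ^ j * w) :=
  summable_of_tendsto_zero (hf.tendsto_cofinite hq0 hq1 hw)

end Limits

omit [CharZero L] in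
include hq0 in
lemma IsKernel.eisSum_inv {f : L → L} {ε : L} (hf : IsKernel f ε) {w : L} (hw : w ≠ 0) :
    eisSum q f w⁻¹ = ε * eisSum q f w := by
  rw [eisSum, eisSum, ← tsum_mul_left, ← (Equiv.neg ℤ).tsum_eq]
  congr 1; ext j
  rw [Equiv.neg_apply, zpow_neg_mul_inv, hf.map_inv _ (zpow_mul_ne_zero hq0 hw j)]

include hq0 in
lemma IsKernel.eisSum_one {f : L → L} (hf : IsKernel f (-1)) : eisSum q f 1 = 0 := by
  have h := hf.eisSum_inv hq0 (one_ne_zero (α := L))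
  rw [inv_one] at h
  have : (2 : L) * eisSum q f 1 = 0 := by linear_combination h
  simpa using this

include hq0 in
/-- The first moment of an even kernel at `1` vanishes. -/
lemma IsKernel.eisMoment_one {f : L → L} (hf : IsKernel f 1) : eisMoment q f 1 = 0 := by
  have h : eisMoment q f 1 = -eisMoment q f 1 := by
    conv_lhs => rw [eisMoment, ← (Equiv.neg ℤ).tsum_eq]
    rw [eisMoment, ← tsum_neg]
    congr 1; ext j
    have := hf.map_inv _ (zpow_mul_ne_zero hq0 (one_ne_zero (α := L)) j)
    rw [← zpow_neg_mul_inv, inv_one] at this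
    rw [Equiv.neg_apply, this]; push_cast; ring
  have : (2 : L) * eisMoment q f 1 = 0 := by linear_combination h
  simpa using this

omit [CharZero L] in
include hq0 in
lemma eisZeta_inv_self {w : L} (hw : w ≠ 0) : eisZeta q w w⁻¹ = 0 := by
  rw [eisZeta]
  simp only [zpow_neg_mul_inv, phi0_inv (zpow_mul_ne_zero hq0 hw _), add_neg_cancel, tsum_zero]

section Master

variable [IsUltrametricDist L] [CompleteSpace L] {x y : L} (hx : x ≠ 0) (hy : y ≠ 0)
include hq0 hq1 hx hy

variable {c : ℤ × ℤ → L} {s : L} (hc : HasSum c s)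
include hc

/-- Summation of the identity `phi1_mul_phi1` over `u = qʲ x`, `v = qᵏ y`; the function `c` is the
correction at the poles. -/
lemma eisSum_phi1_mul_phi1
    (h : ∀ j k, phi1 (q ^ j * x) * phi1 (q ^ k * y) =
      phi2 (q ^ (j + k) * (x * y)) * (phi0 (q ^ j * x) + phi0 (q ^ k * y))
      + phi1 (q ^ (j + k) * (x * y)) * (phi1 (q ^ j * x) + phi1 (q ^ k * y)) + c (j, k)) :
    eisSum q phi1 x * eisSum q phi1 y =
      eisSum q phi2 (x * y) * eisZeta q x y + eisMoment q phi2 (x * y)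
      + eisSum q phi1 (x * y) * (eisSum q phi1 x + eisSum q phi1 y) + s := by
  have hxy := mul_ne_zero hx hy
  have S1 := fun {w : L} (hw : w ≠ 0) => isKernel_phi1.summable hq0 hq1 hw
  have S2 := fun {w : L} (hw : w ≠ 0) => isKernel_phi2.summable hq0 hq1 hw
  have h1 := hasSum_mul_fst_snd (S1 hx) (S1 hy)
  have h2 := ((hasSum_mul_halfLimits (S2 hxy) (halfLimits_phi0 hq0 hq1 hx)
    (halfLimits_phi0 hq0 hq1 hy)).add ((hasSum_mul_add_fst (S1 hxy) (S1 hx)).add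
      (hasSum_mul_add_snd (S1 hxy) (S1 hy)))).add hc
  have h3 := h1.unique (h2.congr_fun fun p => by rw [h p.1 p.2]; ring)
  simp only [eisSum, eisMoment, eisZeta]
  rw [h3]; ring

lemma eisSum_phi1_mul_phi2
    (h : ∀ j k, phi1 (q ^ j * x) * phi2 (q ^ k * y) =
      phi3 (q ^ (j + k) * (x * y)) * (phi0 (q ^ j * x) + phi0 (q ^ k * y))
      + phi2 (q ^ (j + k) * (x * y)) * (phi1 (q ^ j * x) + 2 * phi1 (q ^ k * y))
      + phi1 (q ^ (j + k) * (x * y)) * phi2 (q ^ k * y) + c (j, k)) :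
    eisSum q phi1 x * eisSum q phi2 y =
      eisSum q phi3 (x * y) * eisZeta q x y + eisMoment q phi3 (x * y)
      + eisSum q phi2 (x * y) * (eisSum q phi1 x + 2 * eisSum q phi1 y)
      + eisSum q phi1 (x * y) * eisSum q phi2 y + s := by
  have hxy := mul_ne_zero hx hy
  have S1 := fun {w : L} (hw : w ≠ 0) => isKernel_phi1.summable hq0 hq1 hw
  have S2 := fun {w : L} (hw : w ≠ 0) => isKernel_phi2.summable hq0 hq1 hw
  have S3 := fun {w : L} (hw : w ≠ 0) => isKernel_phi3.summable hq0 hq1 hw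
  have h1 := hasSum_mul_fst_snd (S1 hx) (S2 hy)
  have h2 := (((hasSum_mul_halfLimits (S3 hxy) (halfLimits_phi0 hq0 hq1 hx)
    (halfLimits_phi0 hq0 hq1 hy)).add ((hasSum_mul_add_fst (S2 hxy) (S1 hx)).add
      ((hasSum_mul_add_snd (S2 hxy) (S1 hy)).mul_left 2))).add
      (hasSum_mul_add_snd (S1 hxy) (S2 hy))).add hc
  have h3 := h1.unique (h2.congr_fun fun p => by rw [h p.1 p.2]; ring)
  simp only [eisSum, eisMoment, eisZeta]
  rw [h3]; ring

lemma eisSum_phi1_mul_phi3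
    (h : ∀ j k, phi1 (q ^ j * x) * phi3 (q ^ k * y) =
      phi4 (q ^ (j + k) * (x * y)) * (phi0 (q ^ j * x) + phi0 (q ^ k * y))
      + phi3 (q ^ (j + k) * (x * y)) * (phi1 (q ^ j * x) + 3 * phi1 (q ^ k * y))
      + 3 * (phi2 (q ^ (j + k) * (x * y)) * phi2 (q ^ k * y))
      + phi1 (q ^ (j + k) * (x * y)) * phi3 (q ^ k * y) + c (j, k)) :
    eisSum q phi1 x * eisSum q phi3 y =
      eisSum q phi4 (x * y) * eisZeta q x y + eisMoment q phi4 (x * y)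
      + eisSum q phi3 (x * y) * (eisSum q phi1 x + 3 * eisSum q phi1 y)
      + 3 * (eisSum q phi2 (x * y) * eisSum q phi2 y)
      + eisSum q phi1 (x * y) * eisSum q phi3 y + s := by
  have hxy := mul_ne_zero hx hy
  have S1 := fun {w : L} (hw : w ≠ 0) => isKernel_phi1.summable hq0 hq1 hw
  have S2 := fun {w : L} (hw : w ≠ 0) => isKernel_phi2.summable hq0 hq1 hw
  have S3 := fun {w : L} (hw : w ≠ 0) => isKernel_phi3.summable hq0 hq1 hw
  have S4 := fun {w : L} (hw : w ≠ 0) => isKernel_phi4.summable hq0 hq1 hw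
  have h1 := hasSum_mul_fst_snd (S1 hx) (S3 hy)
  have h2 := ((((hasSum_mul_halfLimits (S4 hxy) (halfLimits_phi0 hq0 hq1 hx)
    (halfLimits_phi0 hq0 hq1 hy)).add ((hasSum_mul_add_fst (S3 hxy) (S1 hx)).add
      ((hasSum_mul_add_snd (S3 hxy) (S1 hy)).mul_left 3))).add
      ((hasSum_mul_add_snd (S2 hxy) (S2 hy)).mul_left 3)).add
      (hasSum_mul_add_snd (S1 hxy) (S3 hy))).add hc
  have h3 := h1.unique (h2.congr_fun fun p => by rw [h p.1 p.2]; ring)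
  simp only [eisSum, eisMoment, eisZeta]
  rw [h3]; ring

lemma eisSum_phi2_mul_phi2
    (h : ∀ j k, phi2 (q ^ j * x) * phi2 (q ^ k * y) =
      phi4 (q ^ (j + k) * (x * y)) * (phi0 (q ^ j * x) + phi0 (q ^ k * y))
      + 2 * (phi3 (q ^ (j + k) * (x * y)) * (phi1 (q ^ j * x) + phi1 (q ^ k * y)))
      + phi2 (q ^ (j + k) * (x * y)) * (phi2 (q ^ j * x) + phi2 (q ^ k * y)) + c (j, k)) :
    eisSum q phi2 x * eisSum q phi2 y =
      eisSum q phi4 (x * y) * eisZeta q x y + eisMoment q phi4 (x * y)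
      + 2 * (eisSum q phi3 (x * y) * (eisSum q phi1 x + eisSum q phi1 y))
      + eisSum q phi2 (x * y) * (eisSum q phi2 x + eisSum q phi2 y) + s := by
  have hxy := mul_ne_zero hx hy
  have S1 := fun {w : L} (hw : w ≠ 0) => isKernel_phi1.summable hq0 hq1 hw
  have S2 := fun {w : L} (hw : w ≠ 0) => isKernel_phi2.summable hq0 hq1 hw
  have S3 := fun {w : L} (hw : w ≠ 0) => isKernel_phi3.summable hq0 hq1 hw
  have S4 := fun {w : L} (hw : w ≠ 0) => isKernel_phi4.summable hq0 hq1 hw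
  have h1 := hasSum_mul_fst_snd (S2 hx) (S2 hy)
  have h2 := (((hasSum_mul_halfLimits (S4 hxy) (halfLimits_phi0 hq0 hq1 hx)
    (halfLimits_phi0 hq0 hq1 hy)).add (((hasSum_mul_add_fst (S3 hxy) (S1 hx)).add
      (hasSum_mul_add_snd (S3 hxy) (S1 hy))).mul_left 2)).add
      ((hasSum_mul_add_fst (S2 hxy) (S2 hx)).add (hasSum_mul_add_snd (S2 hxy) (S2 hy)))).add hc
  have h3 := h1.unique (h2.congr_fun fun p => by rw [h p.1 p.2]; ring)
  simp only [eisSum, eisMoment, eisZeta]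
  rw [h3]; ring

end Master

end EisensteinSums

end HessianCanonical

namespace HessianCanonical

open Filter Topology

/-! ### The differential equations of the Eisenstein sums -/

section CubeRoot

variable {F : Type*} [Field F] {ζ : F} (hζ : ζ ^ 2 + ζ + 1 = 0)
include hζ

lemma cube_eq_one : ζ ^ 3 = 1 := by linear_combination (ζ - 1) * hζ

lemma cubeRoot_ne_zero : ζ ≠ 0 := by
  rintro rfl; simp at hζ

lemma cubeRoot_inv : ζ⁻¹ = ζ * ζ := by
  have h0 := cubeRoot_ne_zero hζ
  rw [inv_eq_iff_eq_inv, ← mul_right_inj' (mul_ne_zero h0 h0), mul_inv_cancel₀ (mul_ne_zero h0 h0)]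
  linear_combination cube_eq_one hζ

end CubeRoot

section DifferentialEquations

variable {L : Type*} [NormedField L] [CharZero L] [IsUltrametricDist L] [CompleteSpace L]
variable {q : L} (hq0 : q ≠ 0) (hq1 : ‖q‖ < 1)
include hq0 hq1

omit hq1 [CharZero L] [IsUltrametricDist L] [CompleteSpace L] in
lemma zpow_mul_zpow (x y : L) (j k : ℤ) :
    q ^ (j + k) * (x * y) = q ^ j * x * (q ^ k * y) := by
  rw [zpow_add₀ hq0]; ring

section Opposite

variable {y : L} (hy : y ≠ 0) (hy1 : ∀ j : ℤ, q ^ j * y ≠ 1)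
include hy hy1

omit [CharZero L] [IsUltrametricDist L] [CompleteSpace L] in
/-- The pointwise identities at `u = qʲ y`, `v = qᵏ y⁻¹`: they need a correction only for
`j + k = 0`, where `u v = 1`. -/
lemma opposite_cases (P : L → L → L → Prop)
    (hgen : ∀ u v, u ≠ 1 → v ≠ 1 → u * v ≠ 1 → P u v 0)
    (f : L → L) (hdeg : ∀ u, u ≠ 0 → u ≠ 1 → P u u⁻¹ (f u)) (j k : ℤ) :
    P (q ^ j * y) (q ^ k * y⁻¹) (if j + k = 0 then f (q ^ j * y) else 0) := by
  have hv1 : q ^ k * y⁻¹ ≠ 1 := by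
    intro h
    have := zpow_neg_mul_inv (q := q) y (-k)
    rw [neg_neg, h] at this
    exact hy1 (-k) (inv_eq_one.mp this.symm)
  split_ifs with hm
  · obtain rfl : k = -j := by omega
    rw [zpow_neg_mul_inv]
    exact hdeg _ (zpow_mul_ne_zero hq0 hy j) (hy1 j)
  · refine hgen _ _ (hy1 j) hv1 ?_
    have e : q ^ j * y * (q ^ k * y⁻¹) = q ^ (j + k) := by
      rw [zpow_add₀ hq0]; field_simp
    rw [e]
    exact fun h => hm ((zpow_eq_one_iff_of_norm_lt_one hq1).mp h)

lemma eisSum_phi1_sq : eisSum q phi1 y ^ 2 =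
    eisMoment q phi2 1 + 2 * eisSum q phi1 1 * eisSum q phi1 y
      + (eisSum q phi3 y - eisSum q phi1 y) / 6 := by
  have hc := hasSum_ite_add ((isKernel_phi1.mul isKernel_phi1).summable hq0 hq1 hy)
  have h := eisSum_phi1_mul_phi1 hq0 hq1 hy (inv_ne_zero hy) hc (fun j k => by
    simp only [zpow_mul_zpow hq0]
    refine opposite_cases hq0 hq1 hy hy1 (fun u v c => phi1 u * phi1 v = phi2 (u * v) *
      (phi0 u + phi0 v) + phi1 (u * v) * (phi1 u + phi1 v) + c) ?_ (fun u => phi1 u * phi1 u) ?_ j k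
    · intro u v hu hv huv
      rw [add_zero, ← phi1_mul_phi1 hu hv huv]
    · intro u hu0 hu
      simp [mul_inv_cancel₀ hu0, phi1_inv hu0])
  have hd : ∑' j : ℤ, phi1 (q ^ j * y) * phi1 (q ^ j * y)
      = (eisSum q phi3 y - eisSum q phi1 y) / 6 := by
    rw [eisSum, eisSum, ← (isKernel_phi3.summable hq0 hq1 hy).tsum_sub
      (isKernel_phi1.summable hq0 hq1 hy), ← tsum_div_const]
    congr 1; ext j; rw [phi3]; ring
  rw [hd, mul_inv_cancel₀ hy, isKernel_phi1.eisSum_inv hq0 hy, eisZeta_inv_self hq0 hy] at h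
  linear_combination h

lemma eisSum_phi1_mul_eisSum_phi2 : eisSum q phi1 y * eisSum q phi2 y =
    eisSum q phi1 1 * eisSum q phi2 y + (eisSum q phi4 y - eisSum q phi2 y) / 12 := by
  have hc := hasSum_ite_add ((isKernel_phi1.mul isKernel_phi2).summable hq0 hq1 hy).neg
  have h := eisSum_phi1_mul_phi2 hq0 hq1 hy (inv_ne_zero hy) hc (fun j k => by
    simp only [zpow_mul_zpow hq0]
    refine opposite_cases hq0 hq1 hy hy1 (fun u v c => phi1 u * phi2 v = phi3 (u * v) *
      (phi0 u + phi0 v) + phi2 (u * v) * (phi1 u + 2 * phi1 v) + phi1 (u * v) * phi2 v + c) ?_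
      (fun u => -(phi1 u * phi2 u)) ?_ j k
    · intro u v hu hv huv
      rw [add_zero, ← phi1_mul_phi2 hu hv huv]
    · intro u hu0 hu
      simp [mul_inv_cancel₀ hu0, phi2_inv hu0])
  have hd : ∑' j : ℤ, -(phi1 (q ^ j * y) * phi2 (q ^ j * y))
      = -((eisSum q phi4 y - eisSum q phi2 y) / 12) := by
    rw [eisSum, eisSum, ← (isKernel_phi4.summable hq0 hq1 hy).tsum_sub
      (isKernel_phi2.summable hq0 hq1 hy), ← tsum_div_const, tsum_neg]
    congr 2; ext j; rw [phi4]; ring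
  rw [hd, mul_inv_cancel₀ hy, isKernel_phi2.eisSum_inv hq0 hy, eisZeta_inv_self hq0 hy,
    isKernel_phi2.eisSum_one hq0, isKernel_phi3.eisMoment_one hq0] at h
  linear_combination -h

lemma eisSum_phi1_mul_eisSum_phi3 : eisSum q phi1 y * eisSum q phi3 y =
    eisMoment q phi4 1 + 4 * eisSum q phi3 1 * eisSum q phi1 y + eisSum q phi1 1 * eisSum q phi3 y
      + ∑' j : ℤ, phi1 (q ^ j * y) * phi3 (q ^ j * y) := by
  have hc := hasSum_ite_add ((isKernel_phi1.mul isKernel_phi3).summable hq0 hq1 hy)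
  have h := eisSum_phi1_mul_phi3 hq0 hq1 hy (inv_ne_zero hy) hc (fun j k => by
    simp only [zpow_mul_zpow hq0]
    refine opposite_cases hq0 hq1 hy hy1 (fun u v c => phi1 u * phi3 v = phi4 (u * v) *
      (phi0 u + phi0 v) + phi3 (u * v) * (phi1 u + 3 * phi1 v) + 3 * (phi2 (u * v) * phi2 v)
      + phi1 (u * v) * phi3 v + c) ?_ (fun u => phi1 u * phi3 u) ?_ j k
    · intro u v hu hv huv
      rw [add_zero, ← phi1_mul_phi3 hu hv huv]
    · intro u hu0 hu
      simp [mul_inv_cancel₀ hu0, phi3_inv hu0])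
  rw [mul_inv_cancel₀ hy, isKernel_phi1.eisSum_inv hq0 hy, isKernel_phi3.eisSum_inv hq0 hy,
    eisZeta_inv_self hq0 hy, isKernel_phi2.eisSum_one hq0] at h
  linear_combination h

lemma eisSum_phi2_sq : eisSum q phi2 y ^ 2 =
    -eisMoment q phi4 1 - 4 * eisSum q phi3 1 * eisSum q phi1 y
      + ∑' j : ℤ, phi2 (q ^ j * y) * phi2 (q ^ j * y) := by
  have hc := hasSum_ite_add ((isKernel_phi2.mul isKernel_phi2).summable hq0 hq1 hy).neg
  have h := eisSum_phi2_mul_phi2 hq0 hq1 hy (inv_ne_zero hy) hc (fun j k => by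
    simp only [zpow_mul_zpow hq0]
    refine opposite_cases hq0 hq1 hy hy1 (fun u v c => phi2 u * phi2 v = phi4 (u * v) *
      (phi0 u + phi0 v) + 2 * (phi3 (u * v) * (phi1 u + phi1 v)) + phi2 (u * v) *
      (phi2 u + phi2 v) + c) ?_ (fun u => -(phi2 u * phi2 u)) ?_ j k
    · intro u v hu hv huv
      rw [add_zero, ← phi2_mul_phi2 hu hv huv]
    · intro u hu0 hu
      simp [mul_inv_cancel₀ hu0, phi2_inv hu0])
  rw [tsum_neg, mul_inv_cancel₀ hy, isKernel_phi1.eisSum_inv hq0 hy,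
    isKernel_phi2.eisSum_inv hq0 hy, eisZeta_inv_self hq0 hy, isKernel_phi2.eisSum_one hq0] at h
  linear_combination -h

end Opposite

omit [CharZero L] hq0 [IsUltrametricDist L] [CompleteSpace L] in
lemma zpow_mul_one_eq_one_iff {j : ℤ} : q ^ j * 1 = 1 ↔ j = 0 := by
  rw [mul_one, zpow_eq_one_iff_of_norm_lt_one hq1]

omit hq0 hq1 [CharZero L] [IsUltrametricDist L] [CompleteSpace L] in
/-- Identities at `u`, `v` where one of `u`, `v`, `u v` may be the pole `1`. -/
lemma pole_cases (P : L → L → L → Prop) (f g h : L → L) (hf : f 1 = 0) (hg : g 1 = 0) (hh : h 1 = 0)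
    (hgen : ∀ u v, u ≠ 1 → v ≠ 1 → u * v ≠ 1 → P u v 0)
    (h1 : ∀ v, v ≠ 1 → P 1 v (f v)) (h2 : ∀ u, u ≠ 1 → P u 1 (g u))
    (h3 : ∀ u, u ≠ 0 → u ≠ 1 → P u u⁻¹ (h u)) (h4 : P 1 1 0) {u v : L} (hu0 : u ≠ 0)
    {a b c : Prop} [Decidable a] [Decidable b] [Decidable c] (ha : u = 1 ↔ a) (hb : v = 1 ↔ b)
    (hc : u * v = 1 ↔ c) :
    P u v ((if a then f v else 0) + (if b then g u else 0) + (if c then h u else 0)) := by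
  by_cases hu : u = 1
  · subst hu
    rw [if_pos (ha.mp rfl)]
    by_cases hv : v = 1
    · subst hv
      simpa [hf, hg, hh] using h4
    · rw [if_neg (mt hb.mpr hv), hh]
      simpa using h1 v hv
  · rw [if_neg (mt ha.mpr hu)]
    by_cases hv : v = 1
    · subst hv
      rw [if_pos (hb.mp rfl), if_neg (mt hc.mpr (by simpa using hu))]
      simpa using h2 u hu
    · rw [if_neg (mt hb.mpr hv)]
      by_cases huv : u * v = 1
      · rw [if_pos (hc.mp huv), eq_inv_of_mul_eq_one_right huv]
        simpa using h3 u hu0 hu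
      · rw [if_neg (mt hc.mpr huv)]
        simpa using hgen u v hu hv huv

omit [CharZero L] [IsUltrametricDist L] [CompleteSpace L] in
lemma pole_cases_zpow (P : L → L → L → Prop) (f g h : L → L) (hf : f 1 = 0) (hg : g 1 = 0)
    (hh : h 1 = 0) (hgen : ∀ u v, u ≠ 1 → v ≠ 1 → u * v ≠ 1 → P u v 0)
    (h1 : ∀ v, v ≠ 1 → P 1 v (f v)) (h2 : ∀ u, u ≠ 1 → P u 1 (g u))
    (h3 : ∀ u, u ≠ 0 → u ≠ 1 → P u u⁻¹ (h u)) (h4 : P 1 1 0) (j k : ℤ) :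
    P (q ^ j * 1) (q ^ k * 1) ((if j = 0 then f (q ^ k * 1) else 0)
      + (if k = 0 then g (q ^ j * 1) else 0) + (if j + k = 0 then h (q ^ j * 1) else 0)) := by
  refine pole_cases P f g h hf hg hh hgen h1 h2 h3 h4 (zpow_mul_ne_zero hq0 one_ne_zero j)
    (zpow_mul_one_eq_one_iff hq1) (zpow_mul_one_eq_one_iff hq1) ?_
  rw [mul_one, mul_one, ← zpow_add₀ hq0, zpow_eq_one_iff_of_norm_lt_one hq1]

/-- The formula for `∑ m φ₂(qᵐ)`; it is Ramanujan's differential equation for `E₂`. -/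
lemma eisMoment_phi2_one : eisMoment q phi2 1 =
    -eisSum q phi1 1 ^ 2 + 5 / 6 * eisSum q phi3 1 + eisSum q phi1 1 / 6 := by
  have h10 := one_ne_zero (α := L)
  have S1 := isKernel_phi1.summable hq0 hq1 h10
  have S3 := isKernel_phi3.summable hq0 hq1 h10
  have hc := ((hasSum_ite_fst (S3.mul_left (-(1 / 2)))).add
    (hasSum_ite_snd (S3.mul_left (-(1 / 2))))).add
    (hasSum_ite_add ((isKernel_phi1.mul isKernel_phi1).summable hq0 hq1 h10))
  have h := eisSum_phi1_mul_phi1 hq0 hq1 h10 h10 hc (fun j k => by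
    simp only [zpow_mul_zpow hq0]
    refine pole_cases_zpow hq0 hq1 (fun u v c => phi1 u * phi1 v = phi2 (u * v) *
      (phi0 u + phi0 v) + phi1 (u * v) * (phi1 u + phi1 v) + c) (fun v => -(1 / 2) * phi3 v)
      (fun v => -(1 / 2) * phi3 v) (fun u => phi1 u * phi1 u) (by simp) (by simp) (by simp)
      ?_ ?_ ?_ ?_ (by simp) j k
    · intro u v hu hv huv
      rw [add_zero, ← phi1_mul_phi1 hu hv huv]
    · intro v hv
      simp only [phi1_one, phi0_one, one_mul, phi3]
      linear_combination -phi0_mul_phi2 v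
    · intro v hv
      simp only [phi1_one, phi0_one, mul_one, phi3]
      linear_combination -phi0_mul_phi2 v
    · intro u hu0 hu
      simp [mul_inv_cancel₀ hu0, phi1_inv hu0])
  have hd : ∑' j : ℤ, phi1 (q ^ j * 1) * phi1 (q ^ j * 1)
      = (eisSum q phi3 1 - eisSum q phi1 1) / 6 := by
    rw [eisSum, eisSum, ← S3.tsum_sub S1, ← tsum_div_const]
    congr 1; ext j; rw [phi3]; ring
  have hz := eisZeta_inv_self hq0 h10
  rw [inv_one] at hz
  rw [hd, tsum_mul_left, mul_one, hz] at h
  simp only [← eisSum_def] at h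
  linear_combination -h

/-- The formula for `∑ m φ₄(qᵐ)`; it is Ramanujan's differential equation for `E₄`. -/
lemma eisMoment_phi4_one : eisMoment q phi4 1 =
    -4 * eisSum q phi3 1 * eisSum q phi1 1 + 7 / 10 * eisSum q phi5 1 + eisSum q phi3 1 / 3
      - eisSum q phi1 1 / 30 := by
  have h10 := one_ne_zero (α := L)
  have S1 := isKernel_phi1.summable hq0 hq1 h10
  have S3 := isKernel_phi3.summable hq0 hq1 h10
  have S5 := isKernel_phi5.summable hq0 hq1 h10
  -- the correction `φ₄ φ₀ + 2 φ₃ φ₁ + φ₂²` at the poles, in terms of `φ₁`, `φ₃`, `φ₅`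
  have hcor : ∀ v : L, phi4 v * phi0 v + 2 * (phi3 v * phi1 v) + phi2 v * phi2 v
      = phi5 v / 3 + phi3 v / 6 := by
    intro v
    simp only [phi4, phi3, phi5]
    linear_combination (12 * phi1 v + 1) * phi0_mul_phi2 v - 9 * phi2_sq v
  have hc := ((hasSum_ite_fst (((S5.div_const 3).add (S3.div_const 6)).neg)).add
    (hasSum_ite_snd (((S5.div_const 3).add (S3.div_const 6)).neg))).add
    (hasSum_ite_add ((isKernel_phi2.mul isKernel_phi2).summable hq0 hq1 h10).neg)
  have h := eisSum_phi2_mul_phi2 hq0 hq1 h10 h10 hc (fun j k => by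
    simp only [zpow_mul_zpow hq0]
    refine pole_cases_zpow hq0 hq1 (fun u v c => phi2 u * phi2 v = phi4 (u * v) *
      (phi0 u + phi0 v) + 2 * (phi3 (u * v) * (phi1 u + phi1 v)) + phi2 (u * v) *
      (phi2 u + phi2 v) + c) (fun v => -(phi5 v / 3 + phi3 v / 6))
      (fun v => -(phi5 v / 3 + phi3 v / 6)) (fun u => -(phi2 u * phi2 u))
      (by simp) (by simp) (by simp) ?_ ?_ ?_ ?_ (by simp) j k
    · intro u v hu hv huv
      rw [add_zero, ← phi2_mul_phi2 hu hv huv]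
    · intro v hv
      simp only [phi1_one, phi0_one, phi2_one, one_mul, zero_mul, zero_add, ← hcor]
      ring
    · intro v hv
      simp only [phi1_one, phi0_one, phi2_one, mul_one, mul_zero, add_zero, ← hcor]
      ring
    · intro u hu0 hu
      simp [mul_inv_cancel₀ hu0, phi2_inv hu0])
  have hd : ∑' j : ℤ, phi2 (q ^ j * 1) * phi2 (q ^ j * 1)
      = (eisSum q phi5 1 - eisSum q phi1 1) / 30 := by
    rw [eisSum, eisSum, ← S5.tsum_sub S1, ← tsum_div_const]
    congr 1; ext j; rw [phi5]; ring
  have hz := eisZeta_inv_self hq0 h10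
  rw [inv_one] at hz
  rw [tsum_neg, tsum_neg, hd, (S5.div_const 3).tsum_add (S3.div_const 6), tsum_div_const,
    tsum_div_const, mul_one, hz, isKernel_phi2.eisSum_one hq0] at h
  simp only [← eisSum_def] at h
  linear_combination -h

section WeierstrassEquation

variable {y : L} (hy : y ≠ 0) (hy1 : ∀ j : ℤ, q ^ j * y ≠ 1)
include hy hy1

/-- The second order differential equation of the Weierstrass function. -/
lemma eisSum_phi3_eq : eisSum q phi3 y =
    6 * (eisSum q phi1 y - eisSum q phi1 1) ^ 2 + (eisSum q phi1 y - eisSum q phi1 1)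
      - 5 * eisSum q phi3 1 := by
  linear_combination -6 * eisSum_phi1_sq hq0 hq1 hy hy1 - 6 * eisMoment_phi2_one hq0 hq1

lemma eisSum_phi4_eq : eisSum q phi4 y =
    (12 * (eisSum q phi1 y - eisSum q phi1 1) + 1) * eisSum q phi2 y := by
  linear_combination -12 * eisSum_phi1_mul_eisSum_phi2 hq0 hq1 hy hy1

/-- The first order differential equation of the Weierstrass function. -/
lemma eisSum_phi2_sq_eq : eisSum q phi2 y ^ 2 =
    4 * (eisSum q phi1 y - eisSum q phi1 1) ^ 3 + (eisSum q phi1 y - eisSum q phi1 1) ^ 2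
      - 10 * eisSum q phi3 1 * (eisSum q phi1 y - eisSum q phi1 1)
      - (7 * eisSum q phi5 1 + 5 * eisSum q phi3 1) / 6 := by
  have S1 := isKernel_phi1.summable hq0 hq1 hy
  have S3 := isKernel_phi3.summable hq0 hq1 hy
  have S5 := isKernel_phi5.summable hq0 hq1 hy
  have h22 : ∑' j : ℤ, phi2 (q ^ j * y) * phi2 (q ^ j * y)
      = (eisSum q phi5 y - eisSum q phi1 y) / 30 := by
    rw [eisSum, eisSum, ← S5.tsum_sub S1, ← tsum_div_const]
    congr 1; ext j; rw [phi5]; ring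
  have h13 : ∑' j : ℤ, phi1 (q ^ j * y) * phi3 (q ^ j * y)
      = (eisSum q phi5 y - eisSum q phi3 y) / 12 - (eisSum q phi5 y - eisSum q phi1 y) / 30 := by
    rw [eisSum, eisSum, eisSum, ← S5.tsum_sub S1, ← S5.tsum_sub S3, ← tsum_div_const,
      ← tsum_div_const, ← ((S5.sub S3).div_const 12).tsum_sub ((S5.sub S1).div_const 30)]
    congr 1; ext j
    simp only [phi5, phi3]
    linear_combination (-3 / 2 : L) * phi2_sq (q ^ j * y)
  have e13 := eisSum_phi1_mul_eisSum_phi3 hq0 hq1 hy hy1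
  have e22 := eisSum_phi2_sq hq0 hq1 hy hy1
  have e3 := eisSum_phi3_eq hq0 hq1 hy hy1
  have eM := eisMoment_phi4_one hq0 hq1
  rw [h13] at e13
  rw [h22] at e22
  -- this combination eliminates the sum of `φ₅(qʲ y)`
  linear_combination e22 - (2 / 3 : L) * e13 - 5 / 3 * eM
    + (2 / 3 * (eisSum q phi1 y - eisSum q phi1 1) + 1 / 18) * e3

end WeierstrassEquation

section CubeRoots

variable {ζ : L} (hζ : ζ ^ 2 + ζ + 1 = 0)
include hζ

omit [CharZero L] [IsUltrametricDist L] [CompleteSpace L] hq0 in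
lemma zpow_mul_cubeRoot_ne_one [CharZero L] (j : ℤ) : q ^ j * ζ ≠ 1 := by
  intro h
  have h3 := cube_eq_one hζ
  have hn : ‖ζ‖ = 1 := by
    have : ‖ζ‖ ^ 3 = 1 := by rw [← norm_pow, h3, norm_one]
    exact (pow_eq_one_iff_of_nonneg (norm_nonneg _) (by norm_num)).mp this
  have hq : ‖q‖ ^ j = 1 := by
    have := congrArg norm h
    rwa [norm_mul, hn, mul_one, norm_zpow, norm_one] at this
  rcases zpow_eq_one_iff_cases₀.mp hq with h2 | h2 | h2
  · rw [h2, zpow_zero, one_mul] at h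
    rw [h] at hζ
    norm_num at hζ
  · exact hq1.ne h2
  · linarith [norm_nonneg q, h2.1]

omit [IsUltrametricDist L] [CompleteSpace L] hq0 in
lemma zpow_mul_cubeRoot_sq_ne_one (j : ℤ) : q ^ j * (ζ * ζ) ≠ 1 := by
  refine zpow_mul_cubeRoot_ne_one hq1 (ζ := ζ * ζ) ?_ j
  linear_combination (ζ ^ 2 - ζ + 1) * hζ

/-- The regularized sums at `(1, ζ²)` and at `(ζ, ζ)` are proportional, because `ζ² = ζ⁻¹`. -/
lemma eisZeta_one_cubeRoot : 2 * eisZeta q 1 (ζ * ζ) = -eisZeta q ζ ζ := by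
  have hζ0 := cubeRoot_ne_zero hζ
  have h10 := one_ne_zero (α := L)
  have H := fun {w : L} (hw : w ≠ 0) => halfLimits_phi0 hq0 hq1 hw
  have s1 : Summable fun j : ℤ => phi0 (q ^ j * 1) + phi0 (q ^ (-j) * ζ⁻¹) := by
    simpa using summable_of_tendsto_zero ((H h10).tendsto_add (H (inv_ne_zero hζ0)) 0)
  have e1 : ∑' j : ℤ, (phi0 (q ^ j * 1) + phi0 (q ^ (-j) * ζ⁻¹)) =
      ∑' j : ℤ, (phi0 (q ^ (-j) * 1) + phi0 (q ^ j * ζ⁻¹)) := by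
    conv_lhs => rw [← (Equiv.neg ℤ).tsum_eq]
    simp only [Equiv.neg_apply, neg_neg]
  have s2 : Summable fun j : ℤ => phi0 (q ^ (-j) * 1) + phi0 (q ^ j * ζ⁻¹) := by
    simpa [Function.comp_def] using (Equiv.neg ℤ).summable_iff.mpr s1
  rw [← cubeRoot_inv hζ, two_mul]
  conv_lhs => rw [eisZeta]; rhs; rw [e1]
  rw [← s1.tsum_add s2, eisZeta, ← tsum_neg]
  congr 1; ext j
  have a1 := phi0_inv (zpow_mul_ne_zero hq0 h10 j)
  have a2 := phi0_inv (zpow_mul_ne_zero hq0 hζ0 j)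
  have a3 := phi0_inv (zpow_mul_ne_zero hq0 hζ0 (-j))
  rw [← zpow_neg_mul_inv, inv_one] at a1
  rw [← zpow_neg_mul_inv] at a2 a3
  rw [neg_neg] at a3
  rw [a1, a2, a3]; ring

omit [IsUltrametricDist L] [CompleteSpace L] in
/-- The correction at `u = 1` when only the first variable may meet the pole. -/
lemma first_pole_cases (P : L → L → L → Prop)
    (hgen : ∀ u v, u ≠ 1 → v ≠ 1 → u * v ≠ 1 → P u v 0) (f : L → L)
    (h1 : ∀ v, v ≠ 1 → P 1 v (f v)) (j k : ℤ) :
    P (q ^ j * 1) (q ^ k * (ζ * ζ)) (if j = 0 then f (q ^ k * (ζ * ζ)) else 0) := by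
  have hv := zpow_mul_cubeRoot_sq_ne_one hq1 hζ
  split_ifs with h
  · subst h
    simpa using h1 _ (hv k)
  · refine hgen _ _ ?_ (hv k) ?_
    · rwa [Ne, zpow_mul_one_eq_one_iff hq1]
    · rw [← zpow_mul_zpow hq0, one_mul]
      exact hv _

/-- The slope of the tangent at `ζ` is given by a sum of weight one: this is the first of two
relations which together express that `ζ` gives a flex. -/
lemma eisSum_phi3_cubeRoot : eisSum q phi3 ζ = 3 * eisZeta q ζ ζ * eisSum q phi2 ζ := by
  have hζ0 := cubeRoot_ne_zero hζ
  have h10 := one_ne_zero (α := L)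
  have hζζ := mul_ne_zero hζ0 hζ0
  have hu := zpow_mul_cubeRoot_ne_one hq1 hζ
  have hv := zpow_mul_cubeRoot_sq_ne_one hq1 hζ
  have hC := eisSum_phi1_mul_phi1 hq0 hq1 hζ0 hζ0 hasSum_zero (fun j k => by
    simp only [zpow_mul_zpow hq0]
    rw [add_zero, ← phi1_mul_phi1 (hu j) (hu k) (by rw [← zpow_mul_zpow hq0]; exact hv _)])
  have hc := hasSum_ite_fst ((isKernel_phi3.summable hq0 hq1 hζζ).mul_left (-(1 / 2)))
  have hD := eisSum_phi1_mul_phi1 hq0 hq1 h10 hζζ hc (fun j k => by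
    simp only [zpow_mul_zpow hq0]
    refine first_pole_cases hq0 hq1 hζ (fun u v c => phi1 u * phi1 v = phi2 (u * v) *
      (phi0 u + phi0 v) + phi1 (u * v) * (phi1 u + phi1 v) + c) ?_ (fun v => -(1 / 2) * phi3 v)
      ?_ j k
    · intro u v hu hv huv
      rw [add_zero, ← phi1_mul_phi1 hu hv huv]
    · intro v hv
      simp only [phi1_one, phi0_one, one_mul, phi3]
      linear_combination -phi0_mul_phi2 v)
  rw [tsum_mul_left, ← eisSum_def, one_mul] at hD
  have hW := eisZeta_one_cubeRoot hq0 hq1 hζ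
  rw [← cubeRoot_inv hζ, isKernel_phi1.eisSum_inv hq0 hζ0, isKernel_phi2.eisSum_inv hq0 hζ0] at hC
  rw [← cubeRoot_inv hζ] at hD hW
  rw [isKernel_phi1.eisSum_inv hq0 hζ0, isKernel_phi2.eisSum_inv hq0 hζ0,
    isKernel_phi3.eisSum_inv hq0 hζ0] at hD
  linear_combination 2 * hD - 2 * hC - eisSum q phi2 ζ * hW

/-- The second of two relations which together express that `ζ` gives a flex. -/
lemma eisSum_phi4_cubeRoot : eisSum q phi4 ζ = 3 * eisZeta q ζ ζ * eisSum q phi3 ζ := by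
  have hζ0 := cubeRoot_ne_zero hζ
  have h10 := one_ne_zero (α := L)
  have hζζ := mul_ne_zero hζ0 hζ0
  have hu := zpow_mul_cubeRoot_ne_one hq1 hζ
  have hv := zpow_mul_cubeRoot_sq_ne_one hq1 hζ
  have hC := eisSum_phi1_mul_phi2 hq0 hq1 hζ0 hζ0 hasSum_zero (fun j k => by
    simp only [zpow_mul_zpow hq0]
    rw [add_zero, ← phi1_mul_phi2 (hu j) (hu k) (by rw [← zpow_mul_zpow hq0]; exact hv _)])
  have hc := hasSum_ite_fst ((isKernel_phi4.summable hq0 hq1 hζζ).mul_left (-(1 / 2)))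
  have hD := eisSum_phi1_mul_phi2 hq0 hq1 h10 hζζ hc (fun j k => by
    simp only [zpow_mul_zpow hq0]
    refine first_pole_cases hq0 hq1 hζ (fun u v c => phi1 u * phi2 v = phi3 (u * v) *
      (phi0 u + phi0 v) + phi2 (u * v) * (phi1 u + 2 * phi1 v) + phi1 (u * v) * phi2 v + c) ?_
      (fun v => -(1 / 2) * phi4 v) ?_ j k
    · intro u v hu hv huv
      rw [add_zero, ← phi1_mul_phi2 hu hv huv]
    · intro v hv
      simp only [phi1_one, phi0_one, phi4, phi3, phi2, one_mul]
      ring)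
  rw [tsum_mul_left, ← eisSum_def, one_mul] at hD
  have hW := eisZeta_one_cubeRoot hq0 hq1 hζ
  rw [← cubeRoot_inv hζ, isKernel_phi1.eisSum_inv hq0 hζ0, isKernel_phi2.eisSum_inv hq0 hζ0,
    isKernel_phi3.eisSum_inv hq0 hζ0] at hC
  rw [← cubeRoot_inv hζ] at hD hW
  rw [isKernel_phi1.eisSum_inv hq0 hζ0, isKernel_phi2.eisSum_inv hq0 hζ0,
    isKernel_phi3.eisSum_inv hq0 hζ0, isKernel_phi4.eisSum_inv hq0 hζ0] at hD
  linear_combination 2 * hC - 2 * hD - eisSum q phi3 ζ * hW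

/-- A primitive cube root of unity gives a flex: the tangent at the point meets the curve there
with multiplicity three. -/
lemma eisSum_phi3_sq_cubeRoot : eisSum q phi3 ζ ^ 2 =
    (12 * (eisSum q phi1 ζ - eisSum q phi1 1) + 1) * eisSum q phi2 ζ ^ 2 := by
  have h3 := eisSum_phi3_cubeRoot hq0 hq1 hζ
  have h4 := eisSum_phi4_cubeRoot hq0 hq1 hζ
  have h := eisSum_phi4_eq hq0 hq1 (cubeRoot_ne_zero hζ) (zpow_mul_cubeRoot_ne_one hq1 hζ)
  linear_combination eisSum q phi3 ζ * h3 - eisSum q phi2 ζ * h4 + eisSum q phi2 ζ * h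

end CubeRoots

end DifferentialEquations

end HessianCanonical

namespace HessianCanonical

open Filter Topology

/-! ### The Tate series in terms of Eisenstein sums -/

section TateSeries

variable {L : Type*} [NormedField L] [CompleteSpace L]

omit [CompleteSpace L] in
lemma summable_natCast_pow_mul_pow {v : L} (hv : ‖v‖ < 1) (k : ℕ) :
    Summable fun n : ℕ => (n : L) ^ k * v ^ n :=
  summable_pow_mul_geometric_of_norm_lt_one k hv

omit [CompleteSpace L] in
lemma one_sub_ne_zero_of_norm_lt_one {v : L} (hv : ‖v‖ < 1) : 1 - v ≠ 0 := by
  intro h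
  rw [sub_eq_zero] at h
  rw [← h, norm_one] at hv
  exact lt_irrefl _ hv

omit [CompleteSpace L] in
/-- The recursion for the power series `∑ nᵏ vⁿ` given by the binomial theorem. -/
lemma tsum_natCast_pow_mul_pow_rec {v : L} (hv : ‖v‖ < 1) {k : ℕ} (hk : k ≠ 0) :
    ∑' n : ℕ, (n : L) ^ k * v ^ n =
      v * ∑ i ∈ Finset.range (k + 1), (k.choose i : L) * ∑' n : ℕ, (n : L) ^ i * v ^ n := by
  have hs := summable_natCast_pow_mul_pow hv
  rw [(hs k).tsum_eq_zero_add]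
  simp only [Nat.cast_zero, zero_pow hk, zero_mul, zero_add]
  simp only [← tsum_mul_left]
  rw [← Summable.tsum_finsetSum fun i _ => (hs i).mul_left _, ← tsum_mul_left]
  congr 1; ext n
  push_cast
  rw [add_pow, Finset.mul_sum, Finset.sum_mul]
  refine Finset.sum_congr rfl fun i _ => ?_
  ring

variable [CharZero L]

omit [CompleteSpace L] in
lemma tsum_natCast_pow_eq_phi {v : L} (hv : ‖v‖ < 1) :
    ∑' n : ℕ, (n : L) ^ 1 * v ^ n = phi1 v ∧ ∑' n : ℕ, (n : L) ^ 3 * v ^ n = phi3 v ∧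
      ∑' n : ℕ, (n : L) ^ 5 * v ^ n = phi5 v := by
  have h1 := one_sub_ne_zero_of_norm_lt_one hv
  have e0 : ∑' n : ℕ, (n : L) ^ 0 * v ^ n = 1 / (1 - v) := by
    simp [tsum_geometric_of_norm_lt_one hv]
  have r1 := tsum_natCast_pow_mul_pow_rec hv (k := 1) (by norm_num)
  have r2 := tsum_natCast_pow_mul_pow_rec hv (k := 2) (by norm_num)
  have r3 := tsum_natCast_pow_mul_pow_rec hv (k := 3) (by norm_num)
  have r4 := tsum_natCast_pow_mul_pow_rec hv (k := 4) (by norm_num)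
  have r5 := tsum_natCast_pow_mul_pow_rec hv (k := 5) (by norm_num)
  have c42 : Nat.choose 4 2 = 6 := rfl
  have c52 : Nat.choose 5 2 = 10 := rfl
  have c53 : Nat.choose 5 3 = 10 := rfl
  have c54 : Nat.choose 5 4 = 5 := rfl
  have c43 : Nat.choose 4 3 = 4 := rfl
  have c32 : Nat.choose 3 2 = 3 := rfl
  simp only [Finset.sum_range_succ, Finset.sum_range_zero, Nat.choose_self, Nat.choose_zero_right,
    Nat.choose_one_right, c42, c52, c53, c54, c43, c32] at r1 r2 r3 r4 r5
  push_cast at r1 r2 r3 r4 r5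
  generalize ∑' n : ℕ, (n : L) ^ 0 * v ^ n = T0 at *
  generalize ∑' n : ℕ, (n : L) ^ 1 * v ^ n = T1 at *
  generalize ∑' n : ℕ, (n : L) ^ 2 * v ^ n = T2 at *
  generalize ∑' n : ℕ, (n : L) ^ 3 * v ^ n = T3 at *
  generalize ∑' n : ℕ, (n : L) ^ 4 * v ^ n = T4 at *
  generalize ∑' n : ℕ, (n : L) ^ 5 * v ^ n = T5 at *
  have t1 : T1 = v * T0 / (1 - v) := by rw [eq_div_iff h1]; linear_combination r1
  have t2 : T2 = v * (T0 + 2 * T1) / (1 - v) := by rw [eq_div_iff h1]; linear_combination r2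
  have t3 : T3 = v * (T0 + 3 * T1 + 3 * T2) / (1 - v) := by
    rw [eq_div_iff h1]; linear_combination r3
  have t4 : T4 = v * (T0 + 4 * T1 + 6 * T2 + 4 * T3) / (1 - v) := by
    rw [eq_div_iff h1]; linear_combination r4
  have t5 : T5 = v * (T0 + 5 * T1 + 10 * T2 + 10 * T3 + 5 * T4) / (1 - v) := by
    rw [eq_div_iff h1]; linear_combination r5
  rw [e0] at t1
  refine ⟨?_, ?_, ?_⟩
  · rw [t1, phi1]; field_simp
  · rw [t3, t2, t1, e0]; simp only [phi3, phi1]; field_simp; ring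
  · rw [t5, t4, t3, t2, t1, e0]; simp only [phi5, phi2, phi1, phi0]; field_simp; ring

variable [IsUltrametricDist L] {q : L} (hq0 : q ≠ 0) (hq1 : ‖q‖ < 1)

omit [CharZero L] in
include hq1 in
/-- The Lambert series `s_k(q)`, with the order of summation exchanged. -/
lemma tateS_eq_tsum (k : ℕ) :
    tateS k q = ∑' m : ℕ+, ∑' n : ℕ+, ((n : ℕ) : L) ^ k * (q ^ (m : ℕ)) ^ (n : ℕ) := by
  have hqn : ∀ n : ℕ+, ‖q ^ (n : ℕ)‖ < 1 := fun n => by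
    rw [norm_pow]; exact pow_lt_one₀ (norm_nonneg _) hq1 n.ne_zero
  have hpow : Tendsto (fun n : ℕ+ => ‖q‖ ^ (n : ℕ)) cofinite (𝓝 0) := by
    have := (tendsto_pow_atTop_nhds_zero_of_lt_one (norm_nonneg q) hq1)
    rw [← Nat.cofinite_eq_atTop] at this
    exact this.comp PNat.coe_injective.tendsto_cofinite
  have hbound : ∀ n m : ℕ+, ‖((n : ℕ) : L) ^ k * (q ^ (n : ℕ)) ^ (m : ℕ)‖
      ≤ (‖q‖ ^ (n : ℕ)) ^ (m : ℕ) := by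
    intro n m
    rw [norm_mul, norm_pow, norm_pow, norm_pow]
    refine mul_le_of_le_one_left (by positivity) (pow_le_one₀ (norm_nonneg _) ?_)
    exact IsUltrametricDist.norm_natCast_le_one L n
  have hs : Summable fun p : ℕ+ × ℕ+ => ((p.1 : ℕ) : L) ^ k * (q ^ (p.1 : ℕ)) ^ (p.2 : ℕ) := by
    refine summable_of_tendsto_zero (tendsto_cofinite_prod hpow ?_ ?_)
    · rintro ⟨n, m⟩
      refine (hbound n m).trans (pow_le_of_le_one (by positivity) ?_ m.ne_zero)
      exact pow_le_one₀ (norm_nonneg _) hq1.le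
    · intro n
      refine squeeze_zero_norm (hbound n) ?_
      have := (tendsto_pow_atTop_nhds_zero_of_lt_one (r := ‖q‖ ^ (n : ℕ)) (by positivity)
        (by rw [← norm_pow]; exact hqn n))
      rw [← Nat.cofinite_eq_atTop] at this
      exact this.comp PNat.coe_injective.tendsto_cofinite
  have hinner : ∀ n : ℕ+, ((n : ℕ) : L) ^ k * q ^ (n : ℕ) / (1 - q ^ (n : ℕ)) =
      ∑' m : ℕ+, ((n : ℕ) : L) ^ k * (q ^ (n : ℕ)) ^ (m : ℕ) := by
    intro n
    rw [tsum_mul_left, tsum_pnat_eq_tsum_succ (f := fun m => (q ^ (n : ℕ)) ^ m)]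
    simp only [pow_succ]
    rw [tsum_mul_right, tsum_geometric_of_norm_lt_one (hqn n)]
    ring
  have e1 := hs.tsum_prod
  have e2 := ((Equiv.prodComm ℕ+ ℕ+).summable_iff.mpr hs).tsum_prod
  have e3 := (Equiv.prodComm ℕ+ ℕ+).tsum_eq
    fun p : ℕ+ × ℕ+ => ((p.1 : ℕ) : L) ^ k * (q ^ (p.1 : ℕ)) ^ (p.2 : ℕ)
  simp only [Function.comp] at e2
  rw [e3, e1] at e2
  rw [tateS]
  simp only [hinner]
  rw [e2]
  refine tsum_congr fun m => tsum_congr fun n => ?_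
  simp only [Equiv.prodComm_apply, Prod.swap]
  rw [← pow_mul, ← pow_mul, mul_comm (n : ℕ)]

omit [CharZero L] in
include hq0 hq1 in
lemma IsKernel.eisSum_one_eq {f : L → L} (hf : IsKernel f 1) (h1 : f 1 = 0) :
    eisSum q f 1 = 2 * ∑' m : ℕ+, f (q ^ (m : ℕ)) := by
  have hs := hf.summable hq0 hq1 (one_ne_zero (α := L))
  have hs1 : Summable fun n : ℕ => f (q ^ (n : ℤ) * 1) := hs.comp_injective Nat.cast_injective
  have hs2 : Summable fun n : ℕ => f (q ^ (-((n : ℤ) + 1)) * 1) :=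
    hs.comp_injective (i := fun n : ℕ => -((n : ℤ) + 1)) (fun m n h => by simpa using h)
  have h := tsum_of_nat_of_neg_add_one (f := fun j : ℤ => f (q ^ j * 1)) hs1 hs2
  have e : ∀ n : ℕ, f (q ^ (-((n : ℤ) + 1)) * 1) = f (q ^ (n + 1)) := by
    intro n
    have := hf.map_inv (q ^ (n + 1)) (pow_ne_zero _ hq0)
    rw [one_mul] at this
    rw [mul_one, zpow_neg, ← this]
    norm_cast
  have e' : ∀ n : ℕ, f (q ^ (n : ℤ) * 1) = f (q ^ n) := fun n => by rw [mul_one, zpow_natCast]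
  simp only [e, e'] at h hs1
  rw [eisSum, h, hs1.tsum_eq_zero_add, pow_zero, h1, zero_add,
    tsum_pnat_eq_tsum_succ (f := fun n => f (q ^ n)), two_mul]

omit [CompleteSpace L] in
lemma tsum_pnat_pow_mul_pow {v : L} {k : ℕ} (hk : k ≠ 0) (hv : ‖v‖ < 1) :
    ∑' n : ℕ+, ((n : ℕ) : L) ^ k * v ^ (n : ℕ) = ∑' n : ℕ, (n : L) ^ k * v ^ n := by
  rw [tsum_pnat_eq_tsum_succ (f := fun n : ℕ => (n : L) ^ k * v ^ n),
    (summable_natCast_pow_mul_pow hv k).tsum_eq_zero_add]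
  simp [hk]

include hq0 hq1 in
lemma eisSum_one_eq_tateS : eisSum q phi1 1 = 2 * tateS 1 q ∧ eisSum q phi3 1 = 2 * tateS 3 q ∧
    eisSum q phi5 1 = 2 * tateS 5 q := by
  have hqn : ∀ n : ℕ+, ‖q ^ (n : ℕ)‖ < 1 := fun n => by
    rw [norm_pow]; exact pow_lt_one₀ (norm_nonneg _) hq1 n.ne_zero
  simp only [tateS_eq_tsum hq1, isKernel_phi1.eisSum_one_eq hq0 hq1 phi1_one,
    isKernel_phi3.eisSum_one_eq hq0 hq1 phi3_one, isKernel_phi5.eisSum_one_eq hq0 hq1 phi5_one]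
  refine ⟨?_, ?_, ?_⟩
  · congr 2; ext m
    rw [tsum_pnat_pow_mul_pow one_ne_zero (hqn m), (tsum_natCast_pow_eq_phi (hqn m)).1]
  · congr 2; ext m
    rw [tsum_pnat_pow_mul_pow three_ne_zero (hqn m), (tsum_natCast_pow_eq_phi (hqn m)).2.1]
  · congr 2; ext m
    rw [tsum_pnat_pow_mul_pow (by norm_num) (hqn m), (tsum_natCast_pow_eq_phi (hqn m)).2.2]

include hq0 hq1 in
lemma tateX_eq (w : L) : tateX q w = eisSum q phi1 w - eisSum q phi1 1 := by
  rw [tateX, (eisSum_one_eq_tateS hq0 hq1).1]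
  rfl

include hq0 hq1 in
lemma two_mul_tateY_add_tateX {w : L} (hw : w ≠ 0) (hw1 : ∀ j : ℤ, q ^ j * w ≠ 1) :
    2 * tateY q w + tateX q w = eisSum q phi2 w := by
  have S1 := isKernel_phi1.summable hq0 hq1 hw
  have S2 := isKernel_phi2.summable hq0 hq1 hw
  have h : ∑' n : ℤ, (q ^ n * w) ^ 2 / (1 - q ^ n * w) ^ 3
      = (eisSum q phi2 w - eisSum q phi1 w) / 2 := by
    rw [eisSum, eisSum, ← S2.tsum_sub S1, ← tsum_div_const]
    refine tsum_congr fun n => ?_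
    have := sub_ne_zero.mpr (hw1 n).symm
    simp only [phi2, phi1, phi0]
    field_simp
    ring
  rw [tateX_eq hq0 hq1, tateY, h, (eisSum_one_eq_tateS hq0 hq1).1]
  ring

section CubeRoots

variable {ζ : L} (hζ : ζ ^ 2 + ζ + 1 = 0)
include hq0 hq1 hζ

/-- The point `(X(ζ, q), Y(ζ, q))` lies on the Tate curve. -/
lemma tate_equation : (2 * tateY q ζ + tateX q ζ) ^ 2 =
    4 * tateX q ζ ^ 3 + tateX q ζ ^ 2 + 4 * (tateCurve q).a₄ * tateX q ζ +
      4 * (tateCurve q).a₆ := by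
  have h0 := cubeRoot_ne_zero hζ
  have h1 := zpow_mul_cubeRoot_ne_one hq1 hζ
  rw [two_mul_tateY_add_tateX hq0 hq1 h0 h1, eisSum_phi2_sq_eq hq0 hq1 h0 h1, tateX_eq hq0 hq1,
    (eisSum_one_eq_tateS hq0 hq1).2.1, (eisSum_one_eq_tateS hq0 hq1).2.2]
  simp only [tateCurve]
  ring

/-- The point `(X(ζ, q), Y(ζ, q))` is a flex of the Tate curve. -/
lemma tate_flex : (6 * tateX q ζ ^ 2 + tateX q ζ + 2 * (tateCurve q).a₄) ^ 2 =
    (12 * tateX q ζ + 1) * (2 * tateY q ζ + tateX q ζ) ^ 2 := by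
  have h0 := cubeRoot_ne_zero hζ
  have h1 := zpow_mul_cubeRoot_ne_one hq1 hζ
  rw [two_mul_tateY_add_tateX hq0 hq1 h0 h1, tateX_eq hq0 hq1, ← eisSum_phi3_sq_cubeRoot hq0 hq1 hζ,
    eisSum_phi3_eq hq0 hq1 h0 h1, (eisSum_one_eq_tateS hq0 hq1).2.1]
  simp only [tateCurve]
  ring

lemma tateX_inv : tateX q ζ⁻¹ = tateX q ζ := by
  rw [tateX_eq hq0 hq1, tateX_eq hq0 hq1, isKernel_phi1.eisSum_inv hq0 (cubeRoot_ne_zero hζ),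
    one_mul]

lemma tateY_inv : tateY q ζ⁻¹ = -tateY q ζ - tateX q ζ := by
  have h0 := cubeRoot_ne_zero hζ
  have h1 := zpow_mul_cubeRoot_ne_one hq1 hζ
  have h2 := zpow_mul_cubeRoot_sq_ne_one hq1 hζ
  rw [← cubeRoot_inv hζ] at h2
  have e1 := two_mul_tateY_add_tateX hq0 hq1 h0 h1
  have e2 := two_mul_tateY_add_tateX hq0 hq1 (inv_ne_zero h0) h2
  rw [isKernel_phi2.eisSum_inv hq0 h0, tateX_inv hq0 hq1 hζ] at e2
  have : (2 : L) * (tateY q ζ⁻¹ - (-tateY q ζ - tateX q ζ)) = 0 := by linear_combination e1 + e2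
  exact sub_eq_zero.mp (by simpa using this)

/-- The abscissa `X(ζ, q)` is close to its value `-1/3` at `q = 0`. -/
lemma norm_tateX_add_third_lt_one : ‖tateX q ζ + 1 / 3‖ < 1 := by
  have h0 := cubeRoot_ne_zero hζ
  have h1 := zpow_mul_cubeRoot_ne_one hq1 hζ
  have hn : ∀ u : L, ‖u‖ < 1 → ‖phi1 u‖ = ‖u‖ := by
    intro u hu
    rw [phi1, norm_div, norm_pow, norm_one_sub_of_norm_lt_one hu]; simp
  have hn' : ∀ w : L, ‖w‖ = 1 → ∀ j : ℤ, j ≠ 0 → ‖phi1 (q ^ j * w)‖ ≤ ‖q‖ := by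
    have hpos : ∀ w : L, ‖w‖ = 1 → ∀ j : ℤ, 0 < j → ‖phi1 (q ^ j * w)‖ ≤ ‖q‖ := by
      intro w hw j hj
      obtain ⟨n, rfl⟩ := Int.eq_ofNat_of_zero_le hj.le
      have h2 : ‖q ^ (n : ℤ) * w‖ = ‖q‖ ^ n := by
        rw [norm_mul, hw, mul_one, zpow_natCast, norm_pow]
      have h3 : ‖q‖ ^ n ≤ ‖q‖ := pow_le_of_le_one (norm_nonneg _) hq1.le (by simpa using hj.ne')
      rw [hn _ (by rw [h2]; exact h3.trans_lt hq1), h2]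
      exact h3
    intro w hw j hj
    rcases lt_or_gt_of_ne hj with h | h
    · have hw0 : w ≠ 0 := by rintro rfl; simp at hw
      rw [← phi1_inv (zpow_mul_ne_zero hq0 hw0 j), ← zpow_neg_mul_inv]
      exact hpos _ (by rw [norm_inv, hw, inv_one]) _ (by omega)
    · exact hpos w hw j h
  have hsum : ∀ w : L, ‖w‖ = 1 → ‖eisSum q phi1 w - phi1 w‖ ≤ ‖q‖ := by
    intro w hw
    have hw0 : w ≠ 0 := by rintro rfl; simp at hw
    have := (isKernel_phi1.summable hq0 hq1 hw0).tsum_eq_add_tsum_ite 0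
    rw [eisSum, this, zpow_zero, one_mul, add_sub_cancel_left]
    refine IsUltrametricDist.norm_tsum_le_of_forall_le_of_nonneg (norm_nonneg _) fun j => ?_
    split_ifs with hj
    · simp
    · exact hn' w hw j hj
  have hnζ : ‖ζ‖ = 1 := by
    have : ‖ζ‖ ^ 3 = 1 := by rw [← norm_pow, cube_eq_one hζ, norm_one]
    exact (pow_eq_one_iff_of_nonneg (norm_nonneg _) (by norm_num)).mp this
  have hp : phi1 ζ = -(1 / 3) := by
    have e : (1 - ζ) ^ 2 = -3 * ζ := by linear_combination hζ
    rw [phi1, e]; field_simp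
  have h2 := hsum ζ hnζ
  have h3 := hsum 1 norm_one
  rw [phi1_one, sub_zero] at h3
  rw [hp, sub_neg_eq_add] at h2
  have e : tateX q ζ + 1 / 3 = (eisSum q phi1 ζ + 1 / 3) - eisSum q phi1 1 := by
    rw [tateX_eq hq0 hq1]; ring
  rw [e]
  exact ((norm_sub_le_max_norm _ _).trans (max_le h2 h3)).trans_lt hq1

end CubeRoots

end TateSeries

end HessianCanonical

namespace HessianCanonical

open Filter Topology

/-! ### Inversion of the `j`-invariant of the Tate curve -/

section JInversion

variable {L : Type*} [NormedField L] [IsUltrametricDist L]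

lemma norm_add_le_of_le_of_le {x y : L} {r : ℝ} (hx : ‖x‖ ≤ r) (hy : ‖y‖ ≤ r) : ‖x + y‖ ≤ r :=
  (IsUltrametricDist.norm_add_le_max x y).trans (max_le hx hy)

lemma norm_sub_le_of_le_of_le {x y : L} {r : ℝ} (hx : ‖x‖ ≤ r) (hy : ‖y‖ ≤ r) : ‖x - y‖ ≤ r :=
  (norm_sub_le_max_norm x y).trans (max_le hx hy)

omit [IsUltrametricDist L] in
lemma norm_mul_le_of_le_one {x y : L} {r : ℝ} (hx : ‖x‖ ≤ 1) (hy : ‖y‖ ≤ r) : ‖x * y‖ ≤ r := by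
  rw [norm_mul]
  exact (mul_le_of_le_one_left (norm_nonneg _) hx).trans hy

lemma norm_ofNat_le_one (n : ℕ) [n.AtLeastTwo] : ‖(ofNat(n) : L)‖ ≤ 1 :=
  IsUltrametricDist.norm_natCast_le_one L n

/-- The Lambert series `∑ c(n) qⁿ / (1 - qⁿ)`. -/
noncomputable def lambert (c : ℕ → L) (q : L) : L :=
  ∑' n : ℕ+, c n * q ^ (n : ℕ) / (1 - q ^ (n : ℕ))

omit [IsUltrametricDist L] in
lemma lambert_zero (c : ℕ → L) : lambert c 0 = 0 := by
  simp [lambert]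

lemma norm_pow_sub_pow_le {q q' : L} {ρ : ℝ} (hq : ‖q‖ ≤ ρ) (hq' : ‖q'‖ ≤ ρ) (n : ℕ) :
    ‖q ^ (n + 1) - q' ^ (n + 1)‖ ≤ ρ ^ n * ‖q - q'‖ := by
  have hρ : 0 ≤ ρ := (norm_nonneg _).trans hq
  induction n with
  | zero => simp
  | succ n ih =>
    have e : q ^ (n + 1 + 1) - q' ^ (n + 1 + 1) =
        q * (q ^ (n + 1) - q' ^ (n + 1)) + (q - q') * q' ^ (n + 1) := by ring
    rw [e]
    refine norm_add_le_of_le_of_le ?_ ?_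
    · rw [norm_mul, pow_succ' ρ n, mul_assoc]
      gcongr
    · rw [norm_mul, norm_pow, mul_comm]
      gcongr

section Lambert

variable {c : ℕ → L} (hc : ∀ n, ‖c n‖ ≤ 1)
include hc

lemma norm_lambert_term_le {q : L} (hq : ‖q‖ < 1) (n : ℕ+) :
    ‖c n * q ^ (n : ℕ) / (1 - q ^ (n : ℕ))‖ ≤ ‖q‖ ^ (n : ℕ) := by
  have h : ‖q ^ (n : ℕ)‖ < 1 := by
    rw [norm_pow]; exact pow_lt_one₀ (norm_nonneg _) hq n.ne_zero
  rw [norm_div, norm_one_sub_of_norm_lt_one h, div_one, ← norm_pow]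
  exact norm_mul_le_of_le_one (hc _) le_rfl

lemma summable_lambert [CompleteSpace L] {q : L} (hq : ‖q‖ < 1) :
    Summable fun n : ℕ+ => c n * q ^ (n : ℕ) / (1 - q ^ (n : ℕ)) := by
  refine summable_of_tendsto_zero (squeeze_zero_norm (norm_lambert_term_le hc hq) ?_)
  have := (tendsto_pow_atTop_nhds_zero_of_lt_one (norm_nonneg q) hq)
  rw [← Nat.cofinite_eq_atTop] at this
  exact this.comp PNat.coe_injective.tendsto_cofinite

/-- A Lambert series with leading coefficient `1` is, up to a contraction, the identity. -/
lemma norm_lambert_sub_sub_le [CompleteSpace L] (hc1 : c 1 = 1) {q q' : L} {ρ : ℝ} (hρ : ρ < 1)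
    (hq : ‖q‖ ≤ ρ) (hq' : ‖q'‖ ≤ ρ) :
    ‖lambert c q - lambert c q' - (q - q')‖ ≤ ρ * ‖q - q'‖ := by
  have hρ0 : 0 ≤ ρ := (norm_nonneg _).trans hq
  have hn : ∀ {r : L}, ‖r‖ ≤ ρ → ∀ n : ℕ+, ‖r ^ (n : ℕ)‖ < 1 := fun {r} hr n => by
    rw [norm_pow]; exact pow_lt_one₀ (norm_nonneg _) (hr.trans_lt hρ) n.ne_zero
  have hs := hasSum_ite_eq (1 : ℕ+) (q - q')
  have s1 := summable_lambert hc (hq.trans_lt hρ)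
  have s2 := summable_lambert hc (hq'.trans_lt hρ)
  have e0 : lambert c q - lambert c q' - (q - q') =
      ∑' n : ℕ+, (c n * q ^ (n : ℕ) / (1 - q ^ (n : ℕ)) - c n * q' ^ (n : ℕ) / (1 - q' ^ (n : ℕ)) -
        if n = 1 then q - q' else 0) := by
    rw [(s1.sub s2).tsum_sub hs.summable, s1.tsum_sub s2, hs.tsum_eq]
    rfl
  rw [e0]
  refine IsUltrametricDist.norm_tsum_le_of_forall_le_of_nonneg (by positivity) fun n => ?_
  have h1 := one_sub_ne_zero_of_norm_lt_one (hn hq n)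
  have h2 := one_sub_ne_zero_of_norm_lt_one (hn hq' n)
  have e : c n * q ^ (n : ℕ) / (1 - q ^ (n : ℕ)) - c n * q' ^ (n : ℕ) / (1 - q' ^ (n : ℕ)) =
      c n * ((q ^ (n : ℕ) - q' ^ (n : ℕ)) / ((1 - q ^ (n : ℕ)) * (1 - q' ^ (n : ℕ)))) := by
    field_simp
    ring
  have hden : ‖(1 - q ^ (n : ℕ)) * (1 - q' ^ (n : ℕ))‖ = 1 := by
    rw [norm_mul, norm_one_sub_of_norm_lt_one (hn hq n), norm_one_sub_of_norm_lt_one (hn hq' n),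
      one_mul]
  split_ifs with h
  · subst h
    simp only [PNat.one_coe, pow_one] at h1 h2 hden ⊢
    have e' : c 1 * q / (1 - q) - c 1 * q' / (1 - q') - (q - q') =
        (q + q' - q * q') * (q - q') / ((1 - q) * (1 - q')) := by
      rw [hc1]; field_simp; ring
    rw [e', norm_div, hden, div_one, norm_mul]
    gcongr
    exact norm_sub_le_of_le_of_le (norm_add_le_of_le_of_le hq hq')
      (norm_mul_le_of_le_one (hq.trans hρ.le) hq')
  · rw [sub_zero, e]
    refine norm_mul_le_of_le_one (hc _) ?_
    rw [norm_div, hden, div_one]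
    obtain ⟨m, hm⟩ : ∃ m, (n : ℕ) = m + 1 + 1 := by
      have : (n : ℕ) ≠ 1 := fun h' => h (PNat.coe_injective h')
      exact ⟨n - 2, by have := n.pos; omega⟩
    rw [hm]
    refine (norm_pow_sub_pow_le hq hq' (m + 1)).trans ?_
    gcongr
    exact pow_le_of_le_one hρ0 hρ.le (by omega)

lemma norm_lambert_sub_le [CompleteSpace L] {q q' : L} {ρ : ℝ} (hρ : ρ < 1)
    (hq : ‖q‖ ≤ ρ) (hq' : ‖q'‖ ≤ ρ) : ‖lambert c q - lambert c q'‖ ≤ ‖q - q'‖ := by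
  have hn : ∀ {r : L}, ‖r‖ ≤ ρ → ∀ n : ℕ+, ‖r ^ (n : ℕ)‖ < 1 := fun {r} hr n => by
    rw [norm_pow]; exact pow_lt_one₀ (norm_nonneg _) (hr.trans_lt hρ) n.ne_zero
  rw [lambert, lambert, ← (summable_lambert hc (hq.trans_lt hρ)).tsum_sub
    (summable_lambert hc (hq'.trans_lt hρ))]
  refine IsUltrametricDist.norm_tsum_le_of_forall_le_of_nonneg (norm_nonneg _) fun n => ?_
  have h1 := one_sub_ne_zero_of_norm_lt_one (hn hq n)
  have h2 := one_sub_ne_zero_of_norm_lt_one (hn hq' n)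
  have e : c n * q ^ (n : ℕ) / (1 - q ^ (n : ℕ)) - c n * q' ^ (n : ℕ) / (1 - q' ^ (n : ℕ)) =
      c n * ((q ^ (n : ℕ) - q' ^ (n : ℕ)) / ((1 - q ^ (n : ℕ)) * (1 - q' ^ (n : ℕ)))) := by
    field_simp
    ring
  rw [e]
  refine norm_mul_le_of_le_one (hc _) ?_
  rw [norm_div, norm_mul, norm_one_sub_of_norm_lt_one (hn hq n),
    norm_one_sub_of_norm_lt_one (hn hq' n), one_mul, div_one]
  obtain ⟨m, hm⟩ : ∃ m, (n : ℕ) = m + 1 := ⟨n - 1, by have := n.pos; omega⟩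
  rw [hm]
  refine (norm_pow_sub_pow_le hq hq' m).trans (mul_le_of_le_one_left (norm_nonneg _) ?_)
  exact pow_le_one₀ ((norm_nonneg _).trans hq) hρ.le

end Lambert

/-- The integral coefficients `(5 n³ + 7 n⁵) / 12` of the Lambert series `-a₆(q)`. -/
def tateCoeff (n : ℕ) : ℕ := (5 * n ^ 3 + 7 * n ^ 5) / 12

lemma twelve_mul_tateCoeff (n : ℕ) : 12 * tateCoeff n = 5 * n ^ 3 + 7 * n ^ 5 := by
  refine Nat.mul_div_cancel' ?_
  have h : ∀ r : ZMod 12, 5 * r ^ 3 + 7 * r ^ 5 = 0 := by decide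
  rw [← ZMod.natCast_eq_zero_iff]
  push_cast
  exact h n

variable [CompleteSpace L]

omit [IsUltrametricDist L] [CompleteSpace L] in
lemma tateCurve_a₄_eq (q : L) : (tateCurve q).a₄ = -5 * lambert (fun n => (n : L) ^ 3) q := rfl

omit [CompleteSpace L] in
lemma norm_natCast_pow_le_one (k n : ℕ) : ‖(n : L) ^ k‖ ≤ 1 := by
  rw [norm_pow]
  exact pow_le_one₀ (norm_nonneg _) (IsUltrametricDist.norm_natCast_le_one L n)

omit [CompleteSpace L] in
lemma norm_tateCoeff_le_one (n : ℕ) : ‖(tateCoeff n : L)‖ ≤ 1 :=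
  IsUltrametricDist.norm_natCast_le_one L _

lemma tateCurve_a₆_eq [CharZero L] {q : L} (hq : ‖q‖ < 1) :
    (tateCurve q).a₆ = -lambert (fun n => (tateCoeff n : L)) q := by
  have h3 := summable_lambert (c := fun n => (n : L) ^ 3) (norm_natCast_pow_le_one 3) hq
  have h5 := summable_lambert (c := fun n => (n : L) ^ 5) (norm_natCast_pow_le_one 5) hq
  have h : (5 * tateS 3 q + 7 * tateS 5 q) / 12 = lambert (fun n => (tateCoeff n : L)) q := by
    rw [tateS, tateS, lambert, ← tsum_mul_left, ← tsum_mul_left,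
      ← (h3.mul_left 5).tsum_add (h5.mul_left 7), ← tsum_div_const]
    refine tsum_congr fun n => ?_
    have e : (12 : L) * (tateCoeff n : L) = 5 * ((n : ℕ) : L) ^ 3 + 7 * ((n : ℕ) : L) ^ 5 := by
      exact_mod_cast congrArg (Nat.cast (R := L)) (twelve_mul_tateCoeff n)
    have e' : (tateCoeff n : L) = (5 * ((n : ℕ) : L) ^ 3 + 7 * ((n : ℕ) : L) ^ 5) / 12 := by
      rw [← e]; field_simp
    rw [e']; ring
  rw [tateCurve, neg_div, h]

omit [IsUltrametricDist L] [CompleteSpace L] in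
lemma tateCurve_c₄ (q : L) : (tateCurve q).c₄ = 1 - 48 * (tateCurve q).a₄ := by
  simp [WeierstrassCurve.c₄, WeierstrassCurve.b₂, WeierstrassCurve.b₄, tateCurve]; ring

omit [IsUltrametricDist L] [CompleteSpace L] in
lemma tateCurve_Δ (q : L) : (tateCurve q).Δ = -(tateCurve q).a₆ + (tateCurve q).a₄ ^ 2
    - 64 * (tateCurve q).a₄ ^ 3 - 432 * (tateCurve q).a₆ ^ 2
    + 72 * (tateCurve q).a₄ * (tateCurve q).a₆ := by
  simp [WeierstrassCurve.Δ, WeierstrassCurve.b₂, WeierstrassCurve.b₄, WeierstrassCurve.b₆,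
    WeierstrassCurve.b₈, tateCurve]
  ring

variable [CharZero L] {q q' : L} {ρ : ℝ} (hρ : ρ < 1) (hq : ‖q‖ ≤ ρ) (hq' : ‖q'‖ ≤ ρ)

include hρ hq hq' in
omit [CharZero L] in
lemma norm_tateCurve_a₄_sub_le : ‖(tateCurve q).a₄ - (tateCurve q').a₄‖ ≤ ‖q - q'‖ := by
  rw [tateCurve_a₄_eq, tateCurve_a₄_eq, ← mul_sub]
  refine norm_mul_le_of_le_one ?_ (norm_lambert_sub_le (norm_natCast_pow_le_one 3) hρ hq hq')
  rw [norm_neg]; exact norm_ofNat_le_one 5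

include hρ hq hq' in
lemma norm_tateCurve_a₆_sub_le : ‖(tateCurve q).a₆ - (tateCurve q').a₆‖ ≤ ‖q - q'‖ := by
  rw [tateCurve_a₆_eq (hq.trans_lt hρ), tateCurve_a₆_eq (hq'.trans_lt hρ), neg_sub_neg,
    norm_sub_rev]
  exact norm_lambert_sub_le norm_tateCoeff_le_one hρ hq hq'

omit [CharZero L] in
lemma norm_tateCurve_a₄_le (hq1 : ‖q‖ < 1) : ‖(tateCurve q).a₄‖ ≤ ‖q‖ := by
  have h := norm_tateCurve_a₄_sub_le hq1 le_rfl (q' := 0) (by simp)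
  have e : (tateCurve (0 : L)).a₄ = 0 := by rw [tateCurve_a₄_eq, lambert_zero, mul_zero]
  rwa [e, sub_zero, sub_zero] at h

lemma norm_tateCurve_a₆_le (hq1 : ‖q‖ < 1) : ‖(tateCurve q).a₆‖ ≤ ‖q‖ := by
  have h := norm_tateCurve_a₆_sub_le hq1 le_rfl (q' := 0) (by simp)
  have e : (tateCurve (0 : L)).a₆ = 0 := by
    rw [tateCurve_a₆_eq (by simp), lambert_zero, neg_zero]
  rwa [e, sub_zero, sub_zero] at h

/-- The map whose fixed points are the `q` with `Δ(q) = J c₄(q)³`. -/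
noncomputable def tateStep (J q : L) : L := q - ((tateCurve q).Δ - J * (tateCurve q).c₄ ^ 3)

include hρ hq hq' in
/-- Since `Δ(q) = q + O(q²)` has integral coefficients, `tateStep` is a contraction. -/
lemma norm_tateStep_sub_le {J : L} (hJ : ‖J‖ ≤ ρ) :
    ‖tateStep J q - tateStep J q'‖ ≤ ρ * ‖q - q'‖ := by
  have hρ0 : 0 ≤ ρ := (norm_nonneg _).trans hq
  have hA := norm_tateCurve_a₄_sub_le hρ hq hq'
  have hB := norm_tateCurve_a₆_sub_le hρ hq hq'
  have hA1 := (norm_tateCurve_a₄_le (hq.trans_lt hρ)).trans hq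
  have hA2 := (norm_tateCurve_a₄_le (hq'.trans_lt hρ)).trans hq'
  have hB1 := (norm_tateCurve_a₆_le (hq.trans_lt hρ)).trans hq
  have hB2 := (norm_tateCurve_a₆_le (hq'.trans_lt hρ)).trans hq'
  have hmain : ‖(q - q') + ((tateCurve q).a₆ - (tateCurve q').a₆)‖ ≤ ρ * ‖q - q'‖ := by
    have := norm_lambert_sub_sub_le (c := fun n => (tateCoeff n : L)) norm_tateCoeff_le_one
      (by simp [tateCoeff]) hρ hq hq'
    rw [← norm_neg] at this
    rw [tateCurve_a₆_eq (hq.trans_lt hρ), tateCurve_a₆_eq (hq'.trans_lt hρ)]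
    convert! this using 2
    ring
  rw [tateStep, tateStep, tateCurve_Δ, tateCurve_Δ, tateCurve_c₄, tateCurve_c₄]
  generalize (tateCurve q).a₄ = A at *
  generalize (tateCurve q').a₄ = A' at *
  generalize (tateCurve q).a₆ = B at *
  generalize (tateCurve q').a₆ = B' at *
  have e : q - (-B + A ^ 2 - 64 * A ^ 3 - 432 * B ^ 2 + 72 * A * B - J * (1 - 48 * A) ^ 3)
      - (q' - (-B' + A' ^ 2 - 64 * A' ^ 3 - 432 * B' ^ 2 + 72 * A' * B' - J * (1 - 48 * A') ^ 3))
      = ((q - q') + (B - B'))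
        - ((A + A' - 64 * (A * A + A * A' + A' * A') + 72 * B
            + 48 * ((1 - 48 * A) * (1 - 48 * A) + (1 - 48 * A) * (1 - 48 * A')
              + (1 - 48 * A') * (1 - 48 * A')) * J) * (A - A')
          + (72 * A' - 432 * (B + B')) * (B - B')) := by ring
  rw [e]
  have n48 := norm_ofNat_le_one (L := L) 48
  have n64 := norm_ofNat_le_one (L := L) 64
  have n72 := norm_ofNat_le_one (L := L) 72
  have n432 := norm_ofNat_le_one (L := L) 432
  have hc : ∀ {a : L}, ‖a‖ ≤ ρ → ‖1 - 48 * a‖ ≤ 1 := fun {a} ha =>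
    norm_sub_le_of_le_of_le norm_one.le (norm_mul_le_of_le_one n48 (ha.trans hρ.le))
  have hAρ1 := hA1.trans hρ.le
  have hAρ2 := hA2.trans hρ.le
  refine norm_sub_le_of_le_of_le hmain (norm_add_le_of_le_of_le ?_ ?_)
  · rw [norm_mul]
    gcongr
    refine norm_add_le_of_le_of_le (norm_add_le_of_le_of_le (norm_sub_le_of_le_of_le
      (norm_add_le_of_le_of_le hA1 hA2) (norm_mul_le_of_le_one n64 ?_))
      (norm_mul_le_of_le_one n72 hB1)) (norm_mul_le_of_le_one (norm_mul_le_of_le_one n48 ?_) hJ)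
    · exact norm_add_le_of_le_of_le (norm_add_le_of_le_of_le (norm_mul_le_of_le_one hAρ1 hA1)
        (norm_mul_le_of_le_one hAρ1 hA2)) (norm_mul_le_of_le_one hAρ2 hA2)
    · exact norm_add_le_of_le_of_le (norm_add_le_of_le_of_le
        (norm_mul_le_of_le_one (hc hA1) (hc hA1)) (norm_mul_le_of_le_one (hc hA1) (hc hA2)))
        (norm_mul_le_of_le_one (hc hA2) (hc hA2))
  · rw [norm_mul]
    gcongr
    exact norm_sub_le_of_le_of_le (norm_mul_le_of_le_one n72 hA2)
      (norm_mul_le_of_le_one n432 (norm_add_le_of_le_of_le hB1 hB2))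

/-- Every `J` with `0 < ‖J‖ < 1` is the value of `Δ / c₄³ = 1 / j` at some Tate parameter. -/
lemma exists_tate_parameter {J : L} (hJ0 : J ≠ 0) (hJ : ‖J‖ < 1) :
    ∃ q : L, q ≠ 0 ∧ ‖q‖ < 1 ∧ (tateCurve q).Δ = J * (tateCurve q).c₄ ^ 3 := by
  have ha4 : (tateCurve (0 : L)).a₄ = 0 := by rw [tateCurve_a₄_eq, lambert_zero, mul_zero]
  have ha6 : (tateCurve (0 : L)).a₆ = 0 := by
    rw [tateCurve_a₆_eq (by simp), lambert_zero, neg_zero]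
  have hΔ0 : (tateCurve (0 : L)).Δ = 0 := by rw [tateCurve_Δ, ha4, ha6]; ring
  have hc0 : (tateCurve (0 : L)).c₄ = 1 := by rw [tateCurve_c₄, ha4]; ring
  have h0 : tateStep J 0 = J := by rw [tateStep, hΔ0, hc0]; ring
  have hmaps : Set.MapsTo (tateStep J) (Metric.closedBall 0 ‖J‖) (Metric.closedBall 0 ‖J‖) := by
    intro q hq
    rw [mem_closedBall_zero_iff] at hq ⊢
    have h := norm_tateStep_sub_le hJ hq (q' := 0) (by simp) le_rfl
    rw [h0, sub_zero] at h
    have e : tateStep J q = (tateStep J q - J) + J := by ring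
    rw [e]
    refine norm_add_le_of_le_of_le (h.trans ?_) le_rfl
    exact mul_le_of_le_one_right (norm_nonneg _) (hq.trans hJ.le)
  have hcontr : ContractingWith ‖J‖₊ (hmaps.restrict (tateStep J) _ _) := by
    refine ⟨by exact_mod_cast hJ, LipschitzWith.of_dist_le_mul fun x y => ?_⟩
    have hx := x.2
    have hy := y.2
    rw [mem_closedBall_zero_iff] at hx hy
    simpa [Subtype.dist_eq, dist_eq_norm] using norm_tateStep_sub_le hJ hx hy le_rfl
  obtain ⟨q, hq, hfix, -⟩ := hcontr.exists_fixedPoint' (x := 0)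
    Metric.isClosed_closedBall.isComplete hmaps (by simp) (edist_ne_top _ _)
  rw [mem_closedBall_zero_iff] at hq
  refine ⟨q, ?_, hq.trans_lt hJ, ?_⟩
  · rintro rfl
    exact hJ0 (h0.symm.trans hfix)
  · have : tateStep J q = q := hfix
    rw [tateStep] at this
    linear_combination -this

end JInversion

end HessianCanonical

namespace HessianCanonical

open Filter Topology

/-! ### The Tate parametrization over the algebraic closure -/

section Transport

variable {L F : Type*} [NormedField L] [IsUltrametricDist L] [CompleteSpace L]
  [Field F] [TopologicalSpace F] [T2Space F] {φ : L →+* F} (hφ : Continuous φ)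
include hφ

lemma map_tateS {q : L} (hq : ‖q‖ < 1) (k : ℕ) : tateS k (φ q) = φ (tateS k q) := by
  have h := summable_lambert (c := fun n => (n : L) ^ k) (norm_natCast_pow_le_one k) hq
  rw [tateS, tateS, h.map_tsum φ hφ]
  simp

variable {q : L} (hq0 : q ≠ 0) (hq1 : ‖q‖ < 1) {w : L} (hw : w ≠ 0)
include hq0 hq1 hw

lemma map_tateX : tateX (φ q) (φ w) = φ (tateX q w) := by
  have h := isKernel_phi1.summable hq0 hq1 hw
  rw [tateX, tateX, map_tateS hφ hq1, map_sub, map_mul]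
  have hmap : φ (∑' n : ℤ, q ^ n * w / (1 - q ^ n * w) ^ 2) =
      ∑' n : ℤ, φ (q ^ n * w / (1 - q ^ n * w) ^ 2) := h.map_tsum φ hφ
  rw [hmap]
  simp [map_ofNat]

lemma map_tateY [CharZero L] (hw1 : ∀ j : ℤ, q ^ j * w ≠ 1) :
    tateY (φ q) (φ w) = φ (tateY q w) := by
  have h : Summable fun n : ℤ => (q ^ n * w) ^ 2 / (1 - q ^ n * w) ^ 3 := by
    refine (((isKernel_phi2.summable hq0 hq1 hw).sub
      (isKernel_phi1.summable hq0 hq1 hw)).div_const 2).congr fun n => ?_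
    have := sub_ne_zero.mpr (hw1 n).symm
    simp only [phi2, phi1, phi0]
    field_simp
    ring
  rw [tateY, tateY, map_tateS hφ hq1, map_add, h.map_tsum φ hφ]
  simp

end Transport

/-- The values of the Tate series at a primitive cube root of unity which lies in a complete
extension `L` of `K`, mapped to a topological field `F` over `L`. -/
lemma tate_cubeRoot_map {K L F : Type*} [NormedField K] [IsUltrametricDist K] [CompleteSpace K]
    [NormedField L] [IsUltrametricDist L] [CompleteSpace L] [CharZero K] [CharZero L]
    [Field F] [TopologicalSpace F] [T2Space F] (i : K →+* L) (hi : ∀ x, ‖i x‖ = ‖x‖)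
    (φ : L →+* F) (hφ : Continuous φ) {q : K} (hq0 : q ≠ 0) (hq1 : ‖q‖ < 1) {z : L}
    (hz : z ^ 2 + z + 1 = 0) {a₄ a₆ Q ζ : F} (ha₄ : a₄ = φ (i (tateCurve q).a₄))
    (ha₆ : a₆ = φ (i (tateCurve q).a₆)) (hQ : Q = φ (i q)) (hzζ : φ z = ζ) :
    (2 * tateY Q ζ + tateX Q ζ) ^ 2 =
        4 * tateX Q ζ ^ 3 + tateX Q ζ ^ 2 + 4 * a₄ * tateX Q ζ + 4 * a₆ ∧
      (6 * tateX Q ζ ^ 2 + tateX Q ζ + 2 * a₄) ^ 2 =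
        (12 * tateX Q ζ + 1) * (2 * tateY Q ζ + tateX Q ζ) ^ 2 ∧
      tateX Q ζ⁻¹ = tateX Q ζ ∧ tateY Q ζ⁻¹ = -tateY Q ζ - tateX Q ζ ∧
      (∃ x : L, tateX Q ζ = φ x ∧ ‖x + 1 / 3‖ < 1) ∧ ∀ n : ℤ, ζ ≠ Q ^ n := by
  have hic : Continuous i := by
    refine AddMonoidHomClass.continuous_of_bound i 1 fun x => ?_
    rw [one_mul, hi]
  have hr0 : i q ≠ 0 := by simpa using hq0
  have hr1 : ‖i q‖ < 1 := (hi q).trans_lt hq1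
  have ha4 : a₄ = φ (tateCurve (i q)).a₄ := by
    simp only [ha₄, tateCurve, map_tateS hic hq1, map_mul, map_neg, map_ofNat]
  have ha6 : a₆ = φ (tateCurve (i q)).a₆ := by
    simp only [ha₆, tateCurve, map_tateS hic hq1, map_mul, map_neg, map_ofNat, map_add, map_div₀]
  have hz0 := cubeRoot_ne_zero hz
  have hz1 := zpow_mul_cubeRoot_ne_one hr1 hz
  have hz2 := zpow_mul_cubeRoot_sq_ne_one hr1 hz
  rw [← cubeRoot_inv hz] at hz2
  subst hzζ hQ
  have hX := map_tateX hφ hr0 hr1 hz0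
  have hY := map_tateY hφ hr0 hr1 hz0 hz1
  have hX' := map_tateX hφ hr0 hr1 (inv_ne_zero hz0)
  have hY' := map_tateY hφ hr0 hr1 (inv_ne_zero hz0) hz2
  rw [map_inv₀] at hX' hY'
  refine ⟨?_, ?_, ?_, ?_, ⟨_, hX, norm_tateX_add_third_lt_one hr0 hr1 hz⟩, ?_⟩
  · rw [hX, hY, ha4, ha6]
    simpa only [map_mul, map_add, map_pow, map_ofNat] using
      congrArg φ (tate_equation hr0 hr1 hz)
  · rw [hX, hY, ha4]
    simpa only [map_mul, map_add, map_pow, map_ofNat, map_one] using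
      congrArg φ (tate_flex hr0 hr1 hz)
  · rw [hX, hX', tateX_inv hr0 hr1 hz]
  · rw [hX, hY, hY', tateY_inv hr0 hr1 hz, map_sub, map_neg]
  · intro n hn
    refine hz1 (-n) (φ.injective ?_)
    rw [map_mul, map_zpow₀, hn, map_one, zpow_neg, inv_mul_cancel₀]
    exact zpow_ne_zero _ (by simpa using hq0)

section AlgebraicClosure

universe u

variable {K : Type u} [NontriviallyNormedField K] [IsUltrametricDist K] [CompleteSpace K]

lemma isUltrametricDist_spectralNorm (L : Type*) [Field L] [Algebra K L] [Algebra.IsAlgebraic K L] :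
    @IsUltrametricDist L (spectralNorm.normedField K L).toMetricSpace.toDist := by
  let := spectralNorm.normedField K L
  exact IsUltrametricDist.isUltrametricDist_of_isNonarchimedean_norm
    (isNonarchimedean_spectralNorm (K := K) (L := L))

/-- The values of the Tate series at a primitive cube root of unity in `K̄`, which are computed in
the complete field that it generates over `K`. -/
lemma tate_cubeRoot [CharZero K] {q : K} (hq0 : q ≠ 0) (hq1 : ‖q‖ < 1) {ζ : AlgebraicClosure K}
    (hζ : ζ ^ 2 + ζ + 1 = 0) :
    letI := algClosureTopology K
    let Q := algebraMap K (AlgebraicClosure K) q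
    let W := (tateCurve q).baseChange (AlgebraicClosure K)
    (2 * tateY Q ζ + tateX Q ζ) ^ 2 =
        4 * tateX Q ζ ^ 3 + tateX Q ζ ^ 2 + 4 * W.a₄ * tateX Q ζ + 4 * W.a₆ ∧
      (6 * tateX Q ζ ^ 2 + tateX Q ζ + 2 * W.a₄) ^ 2 =
        (12 * tateX Q ζ + 1) * (2 * tateY Q ζ + tateX Q ζ) ^ 2 ∧
      tateX Q ζ⁻¹ = tateX Q ζ ∧ tateY Q ζ⁻¹ = -tateY Q ζ - tateX Q ζ ∧
      spectralNorm K (AlgebraicClosure K) (tateX Q ζ + 1 / 3) < 1 ∧ ∀ n : ℤ, ζ ≠ Q ^ n := by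
  -- The field generated by `ζ` is made abstract, so that it carries no topology induced from `K̄`.
  obtain ⟨L, _, _, _, _, _, z, hz⟩ : ∃ (L : Type u) (_ : Field L) (_ : Algebra K L)
      (_ : FiniteDimensional K L) (_ : Algebra L (AlgebraicClosure K))
      (_ : IsScalarTower K L (AlgebraicClosure K)) (z : L),
      algebraMap L (AlgebraicClosure K) z = ζ :=
    ⟨IntermediateField.adjoin K {ζ}, inferInstance, inferInstance,
      IntermediateField.adjoin.finiteDimensional (Algebra.IsIntegral.isIntegral ζ),
      inferInstance, inferInstance, ⟨ζ, IntermediateField.mem_adjoin_simple_self K ζ⟩, rfl⟩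
  let := spectralNorm.normedField K (AlgebraicClosure K)
  let := spectralNorm.normedField K L
  have : CompleteSpace L := spectralNorm.completeSpace K L
  have : IsUltrametricDist L := isUltrametricDist_spectralNorm L
  have : CharZero L := charZero_of_injective_algebraMap (algebraMap K L).injective
  have hnorm : ∀ x : L, ‖(algebraMap L (AlgebraicClosure K)) x‖ = ‖x‖ := fun x =>
    (spectralNorm.eq_of_tower x).symm
  have hφ : Continuous (algebraMap L (AlgebraicClosure K)) := by
    refine AddMonoidHomClass.continuous_of_bound (algebraMap L (AlgebraicClosure K)) 1 fun x => ?_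
    rw [one_mul, hnorm]
  have hzz : z ^ 2 + z + 1 = 0 := by
    apply (algebraMap L (AlgebraicClosure K)).injective
    simpa [hz] using hζ
  have h := tate_cubeRoot_map (algebraMap K L) (fun x => spectralNorm_extends x)
    (algebraMap L (AlgebraicClosure K)) hφ hq0 hq1 hzz rfl rfl rfl hz
  simp only [← IsScalarTower.algebraMap_apply] at h
  obtain ⟨h1, h2, h3, h4, ⟨x, hx, hx1⟩, h6⟩ := h
  refine And.intro h1 ⟨h2, h3, h4, ?_, h6⟩
  rw [hx]
  rw [← hnorm, map_add, map_div₀, map_one, map_ofNat] at hx1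
  exact hx1

end AlgebraicClosure

end HessianCanonical

namespace HessianCanonical

open IsDedekindDomain.HeightOneSpectrum IsDiscreteValuationRing

/-! ### Potentially multiplicative reduction and the Tate parameter -/

variable {K : Type*} [NontriviallyNormedField K] [IsUltrametricDist K]

/-- Potentially multiplicative reduction forces `|j| > 1`: otherwise `j` would be integral in the
extension where the reduction is multiplicative, whereas there `c₄` is a unit and `Δ` is not. -/
lemma HasPotentiallyMultiplicativeReduction.norm_Δ_lt {E : WeierstrassCurve K} [E.IsElliptic]
    (hE : HasPotentiallyMultiplicativeReduction E) : ‖E.Δ‖ < ‖E.c₄‖ ^ 3 := by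
  obtain ⟨L, _, _, _, C, hC⟩ := hE
  have hbad := hC.badReduction
  have hmul := hC.multiplicativeReduction
  by_contra! hle
  have hΔ : E.Δ ≠ 0 := E.isUnit_Δ.ne_zero
  have hx : ‖E.c₄ ^ 3 / E.Δ‖ ≤ 1 := by
    rw [norm_div, norm_pow]
    exact div_le_one_of_le₀ hle (norm_nonneg _)
  let x : RingOfIntegers K := ⟨E.c₄ ^ 3 / E.Δ, hx⟩
  let r : integralClosure (RingOfIntegers K) L := algebraMap _ _ x
  have hr : algebraMap (integralClosure (RingOfIntegers K) L) L r =
      algebraMap K L (E.c₄ ^ 3 / E.Δ) := rfl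
  have hr1 := valuation_le_one (K := L)
    (maximalIdeal (integralClosure (RingOfIntegers K) L)) r
  have heq : (C • E.baseChange L).c₄ ^ 3 =
      algebraMap (integralClosure (RingOfIntegers K) L) L r * (C • E.baseChange L).Δ := by
    have hΔ' : algebraMap K L E.Δ ≠ 0 := by simpa using hΔ
    rw [hr, WeierstrassCurve.variableChange_c₄, WeierstrassCurve.variableChange_Δ,
      WeierstrassCurve.baseChange, WeierstrassCurve.map_c₄, WeierstrassCurve.map_Δ, map_div₀,
      map_pow]
    field_simp
  have h1 := congrArg
    (valuation L (maximalIdeal (integralClosure (RingOfIntegers K) L))) heq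
  rw [map_pow, map_mul, hmul, one_pow] at h1
  exact absurd h1 ((mul_le_of_le_one_left' hr1).trans_lt hbad).ne'

lemma c₆_sq_eq {F : Type*} [Field F] (W : WeierstrassCurve F) :
    W.c₆ ^ 2 = W.c₄ ^ 3 - 1728 * W.Δ := by
  linear_combination W.c_relation

variable [CompleteSpace K] [CharZero K]

omit [CharZero K] in
lemma norm_tateCurve_c₄ {q : K} (hq1 : ‖q‖ < 1) : ‖(tateCurve q).c₄‖ = 1 := by
  rw [tateCurve_c₄]
  refine norm_one_sub_of_norm_lt_one ?_
  exact (norm_mul_le_of_le_one (norm_ofNat_le_one 48) (norm_tateCurve_a₄_le hq1)).trans_lt hq1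

/-- A curve with `|j| > 1` becomes isomorphic over `K̄` to a Tate curve over `K`. -/
lemma nonempty_tateParametrization {E : WeierstrassCurve K} [E.IsElliptic]
    (hE : ‖E.Δ‖ < ‖E.c₄‖ ^ 3) : Nonempty (TateParametrization E) := by
  have hΔ : E.Δ ≠ 0 := E.isUnit_Δ.ne_zero
  have hc : E.c₄ ≠ 0 := by
    intro h; rw [h, norm_zero, zero_pow three_ne_zero] at hE
    exact absurd hE (norm_nonneg _).not_gt
  obtain ⟨q, hq0, hq1, hq⟩ := exists_tate_parameter (J := E.Δ / E.c₄ ^ 3)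
    (div_ne_zero hΔ (pow_ne_zero 3 hc)) (by
      rw [norm_div, norm_pow, div_lt_one (pow_pos (norm_pos_iff.mpr hc) 3)]; exact hE)
  have hc' : (tateCurve q).c₄ ≠ 0 := by
    rw [← norm_pos_iff, norm_tateCurve_c₄ hq1]; exact one_pos
  have hell : (tateCurve q).IsElliptic := by
    refine ⟨isUnit_iff_ne_zero.mpr ?_⟩
    rw [hq]
    exact mul_ne_zero (div_ne_zero hΔ (pow_ne_zero 3 hc)) (pow_ne_zero 3 hc')
  have hj : E.j = (tateCurve q).j := by
    have hΔ' : (tateCurve q).Δ ≠ 0 := (tateCurve q).isUnit_Δ.ne_zero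
    rw [WeierstrassCurve.j, WeierstrassCurve.j, Units.val_inv_eq_inv_val, Units.val_inv_eq_inv_val,
      WeierstrassCurve.coe_Δ', WeierstrassCurve.coe_Δ', hq]
    field_simp
  have : (E.baseChange (AlgebraicClosure K)).IsElliptic :=
    inferInstanceAs (E.map (algebraMap K (AlgebraicClosure K))).IsElliptic
  have : ((tateCurve q).baseChange (AlgebraicClosure K)).IsElliptic :=
    inferInstanceAs ((tateCurve q).map (algebraMap K (AlgebraicClosure K))).IsElliptic
  obtain ⟨C, hC⟩ := WeierstrassCurve.exists_variableChange_of_j_eq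
    (E.baseChange (AlgebraicClosure K)) ((tateCurve q).baseChange (AlgebraicClosure K)) (by
      simp only [WeierstrassCurve.baseChange, WeierstrassCurve.map_j, hj])
  exact ⟨⟨q, hq0, hq1, C, hC⟩⟩

end HessianCanonical

namespace HessianCanonical

open WeierstrassCurve

/-! ### Three-torsion and collinearity on Weierstrass curves -/

section Weierstrass

variable {F : Type*} [Field F] (W : WeierstrassCurve F)

/-- The polynomial `u⁴ - 6 c₄ u² - 8 c₆ u - 3 c₄²`. In the coordinate `u = 12 x + b₂` it is
`6912` times the third division polynomial `ψ₃`. -/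
def psi (u : F) : F := u ^ 4 - 6 * W.c₄ * u ^ 2 - 8 * W.c₆ * u - 3 * W.c₄ ^ 2

variable {W} {x y : F}

/-- The Weierstrass equation in the coordinates `u = 12 x + b₂`, `η = 2 y + a₁ x + a₃`. -/
lemma equation_iff_short [CharZero F] : W.toAffine.Equation x y ↔
    432 * (2 * y + W.a₁ * x + W.a₃) ^ 2 =
      (12 * x + W.b₂) ^ 3 - 3 * W.c₄ * (12 * x + W.b₂) - 2 * W.c₆ := by
  rw [Affine.equation_iff]
  simp only [c₄, c₆, b₂, b₄, b₆]
  constructor <;> intro h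
  · linear_combination 1728 * h
  · linear_combination (1 / 1728) * h

/-- With `n / η` the slope of the tangent line at `(x, y)`, the right-hand side is
`-6912 η² (x(2P) - x(P))`. -/
lemma psi_eq_of_equation (h : W.toAffine.Equation x y) :
    psi W (12 * x + W.b₂) =
      6912 * ((W.a₂ + 3 * x) * (2 * y + W.a₁ * x + W.a₃) ^ 2
        - (3 * x ^ 2 + 2 * W.a₂ * x + W.a₄ - W.a₁ * y) ^ 2
        - W.a₁ * (3 * x ^ 2 + 2 * W.a₂ * x + W.a₄ - W.a₁ * y)
          * (2 * y + W.a₁ * x + W.a₃)) := by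
  rw [Affine.equation_iff] at h
  simp only [psi, c₄, c₆, b₂, b₄, b₆]
  linear_combination (-6912) * (12 * x + W.a₁ ^ 2 + 4 * W.a₂) * h

variable [DecidableEq F]

lemma add_self_add_self_eq_zero_iff [CharZero F] (h : W.toAffine.Nonsingular x y) :
    (Affine.Point.some x y h + .some x y h + .some x y h = 0) ↔ psi W (12 * x + W.b₂) = 0 := by
  have hη : y - W.toAffine.negY x y = 2 * y + W.a₁ * x + W.a₃ := by rw [Affine.negY]; ring
  rw [psi_eq_of_equation h.1]
  by_cases hy : y = W.toAffine.negY x y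
  · have h0 : 2 * y + W.a₁ * x + W.a₃ = 0 := by rw [← hη, sub_eq_zero]; exact hy
    rw [Affine.Point.add_self_of_Y_eq hy, zero_add, h0]
    have hne := ((Affine.nonsingular_iff' ..).mp h).2.resolve_right (not_not.mpr h0)
    refine iff_of_false (Affine.Point.some_ne_zero h) fun h2 => hne ?_
    have h3 : (3 * x ^ 2 + 2 * W.a₂ * x + W.a₄ - W.a₁ * y) ^ 2 = 0 := by
      linear_combination (-1 / 6912) * h2
    linear_combination (-1) * (pow_eq_zero_iff two_ne_zero).mp h3
  · have h0 : 2 * y + W.a₁ * x + W.a₃ ≠ 0 := by rw [← hη, sub_ne_zero]; exact hy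
    have key : 6912 * ((W.a₂ + 3 * x) * (2 * y + W.a₁ * x + W.a₃) ^ 2
        - (3 * x ^ 2 + 2 * W.a₂ * x + W.a₄ - W.a₁ * y) ^ 2
        - W.a₁ * (3 * x ^ 2 + 2 * W.a₂ * x + W.a₄ - W.a₁ * y)
          * (2 * y + W.a₁ * x + W.a₃)) = 0 ↔
        W.toAffine.addX x x (W.toAffine.slope x x y y) = x := by
      rw [Affine.slope_of_Y_ne rfl hy, hη, Affine.addX]
      generalize 3 * x ^ 2 + 2 * W.a₂ * x + W.a₄ - W.a₁ * y = n
      generalize 2 * y + W.a₁ * x + W.a₃ = η at h0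
      constructor <;> intro h2
      · field_simp
        linear_combination (-1 / 6912) * h2
      · field_simp at h2
        linear_combination (-6912) * h2
    rw [key, add_eq_zero_iff_eq_neg, Affine.Point.add_self_of_Y_ne' hy, neg_inj]
    constructor
    · intro h2
      injection h2
    · intro h2
      refine ((Affine.Point.X_eq_iff ..).mp h2).resolve_right fun h3 => ?_
      have h4 := Affine.Point.add_self_of_Y_ne' hy (h₁ := h)
      rw [h3, neg_neg, add_eq_left] at h4
      exact Affine.Point.some_ne_zero h h4

/-- Three points with different `x`-coordinates sum to zero exactly when they are collinear. -/
lemma add_add_eq_zero_iff_det {x₁ y₁ x₂ y₂ x₃ y₃ : F} (h₁ : W.toAffine.Nonsingular x₁ y₁)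
    (h₂ : W.toAffine.Nonsingular x₂ y₂) (h₃ : W.toAffine.Nonsingular x₃ y₃)
    (h₁₂ : x₁ ≠ x₂) (h₁₃ : x₁ ≠ x₃) (h₂₃ : x₂ ≠ x₃) :
    (Affine.Point.some x₁ y₁ h₁ + .some x₂ y₂ h₂ + .some x₃ y₃ h₃ = 0) ↔
      Matrix.det !![x₁, y₁, 1; x₂, y₂, 1; x₃, y₃, 1] = 0 := by
  rw [add_eq_zero_iff_eq_neg, Affine.Point.add_of_X_ne' h₁₂, neg_inj]
  have hsub := sub_ne_zero.mpr h₁₂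
  have hline : Matrix.det !![x₁, y₁, 1; x₂, y₂, 1; x₃, y₃, 1] = 0 ↔
      y₃ = W.toAffine.slope x₁ x₂ y₁ y₂ * (x₃ - x₁) + y₁ := by
    rw [Affine.slope_of_X_ne h₁₂, Matrix.det_fin_three]
    simp
    constructor <;> intro h
    · field_simp
      linear_combination (-1) * h
    · field_simp at h
      linear_combination (-1) * h
  rw [hline]
  constructor
  · intro h
    injection h with hx hy
    rw [← hx, ← hy, Affine.negAddY]
  · intro h
    have hX : W.toAffine.addX x₁ x₂ (W.toAffine.slope x₁ x₂ y₁ y₂) = x₃ := by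
      have hp := congrArg (Polynomial.eval x₃)
        (Affine.addPolynomial_slope h₁.1 h₂.1 fun hxy => h₁₂ hxy.1)
      have he := h₃.1
      rw [Affine.equation_iff] at he
      rw [Affine.addPolynomial_eq] at hp
      simp [Cubic.toPoly] at hp
      have hz : (x₃ - x₁) * (x₃ - x₂) *
          (x₃ - W.toAffine.addX x₁ x₂ (W.toAffine.slope x₁ x₂ y₁ y₂)) = 0 := by
        subst h
        rw [Affine.addX]
        linear_combination hp - he
      rcases mul_eq_zero.mp hz with hz | hz
      · exact absurd hz (mul_ne_zero (sub_ne_zero.mpr h₁₃.symm) (sub_ne_zero.mpr h₂₃.symm))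
      · exact (sub_eq_zero.mp hz).symm
    have hY : W.toAffine.negAddY x₁ x₂ y₁ (W.toAffine.slope x₁ x₂ y₁ y₂) = y₃ := by
      rw [Affine.negAddY, hX, h]
    simp only [hX, hY]

end Weierstrass

end HessianCanonical

namespace HessianCanonical

open WeierstrassCurve

/-! ### The normalized coordinate of a three-torsion point -/

section NormalizedCoordinate

variable {F : Type*} [Field F]

/-- The coordinate `(1 + u c₄ / c₆) / 12`, where `u = 12 x + b₂`. It does not depend on the
Weierstrass model; on a Tate curve it is congruent to `-x`, up to the constant `c₄ / c₆`, which
is close to `-1`. -/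
def normCoord (W : WeierstrassCurve F) (x : F) : F := (1 + (12 * x + W.b₂) * W.c₄ / W.c₆) / 12

variable (W : WeierstrassCurve F)

lemma normCoord_variableChange (C : VariableChange F) (x : F) :
    normCoord (C • W) x = normCoord W ((C.u : F) ^ 2 * x + C.r) := by
  have hu := C.u.ne_zero
  rw [normCoord, normCoord, variableChange_b₂, variableChange_c₄, variableChange_c₆,
    Units.val_inv_eq_inv_val]
  have h : (12 * x + (C.u : F)⁻¹ ^ 2 * (W.b₂ + 12 * C.r)) * ((C.u : F)⁻¹ ^ 4 * W.c₄) =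
      (C.u : F)⁻¹ ^ 6 * ((12 * ((C.u : F) ^ 2 * x + C.r) + W.b₂) * W.c₄) := by
    field_simp
    ring
  rw [h, mul_div_mul_left _ _ (pow_ne_zero 6 (inv_ne_zero hu))]

variable {W}

/-- The third division polynomial in terms of the normalized coordinate. For `δ = 0` it has the
triple root `0` and the simple root `1 / 3`. -/
lemma normCoord_quartic [CharZero F] (h₆ : W.c₆ ≠ 0) {x : F}
    (hx : psi W (12 * x + W.b₂) = 0) :
    3 * normCoord W x ^ 4 - normCoord W x ^ 3 - W.Δ / W.c₆ ^ 2 *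
      (216 * normCoord W x ^ 2 - 12 * normCoord W x + 1 + 1296 * (W.Δ / W.c₆ ^ 2)) = 0 := by
  obtain ⟨δ, hδ⟩ : ∃ δ, δ = W.Δ / W.c₆ ^ 2 := ⟨_, rfl⟩
  obtain ⟨s, hs⟩ : ∃ s, s = normCoord W x := ⟨_, rfl⟩
  have hr : W.c₄ ^ 3 = W.c₆ ^ 2 * (1 + 1728 * δ) := by
    rw [hδ]; field_simp; linear_combination -c₆_sq_eq W
  have hu : (12 * x + W.b₂) * W.c₄ = (12 * s - 1) * W.c₆ := by
    rw [hs, normCoord]; field_simp; ring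
  rw [← hδ, ← hs]
  generalize 12 * x + W.b₂ = u at hx hu
  have h : W.c₆ ^ 4 * ((12 * s - 1) ^ 4 - 6 * (1 + 1728 * δ) * (12 * s - 1) ^ 2
      - 8 * (1 + 1728 * δ) * (12 * s - 1) - 3 * (1 + 1728 * δ) ^ 2) = 0 := by
    have h1 : (u * W.c₄) ^ 4 - 6 * W.c₄ ^ 3 * (u * W.c₄) ^ 2 - 8 * W.c₆ * W.c₄ ^ 3 * (u * W.c₄)
        - 3 * (W.c₄ ^ 3) ^ 2 = W.c₄ ^ 4 * psi W u := by rw [psi]; ring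
    rw [hx, hu, hr] at h1
    linear_combination h1
  have h2 := (mul_eq_zero.mp h).resolve_left (pow_ne_zero 4 h₆)
  linear_combination (1 / 6912) * h2

end NormalizedCoordinate

section Norm

variable {F : Type*} [NormedField F] [IsUltrametricDist F]

lemma norm_integer_le_one (a : (NormedField.valuation (K := F)).integer) : ‖(a : F)‖ ≤ 1 :=
  a.2

omit [IsUltrametricDist F] in
lemma norm_mul_lt_one {x y : F} (hx : ‖x‖ < 1) (hy : ‖y‖ ≤ 1) : ‖x * y‖ < 1 := by
  rw [norm_mul]
  exact mul_lt_one_of_nonneg_of_lt_one_left (norm_nonneg _) hx hy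

lemma norm_add_lt_one {x y : F} (hx : ‖x‖ < 1) (hy : ‖y‖ < 1) : ‖x + y‖ < 1 :=
  (IsUltrametricDist.norm_add_le_max x y).trans_lt (max_lt hx hy)

variable {s δ : F} (hδ : ‖δ‖ < 1) (hs : 1 ≤ ‖s‖)
  (h : 3 * s ^ 4 - s ^ 3 - δ * (216 * s ^ 2 - 12 * s + 1 + 1296 * δ) = 0)

include hδ hs h

/-- The roots of the quartic which are not in the open unit disc are close to `1 / 3`. -/
lemma norm_three_mul_sub_one_lt : ‖3 * s - 1‖ < 1 := by
  have hs0 : s ≠ 0 := norm_pos_iff.mp (one_pos.trans_le hs)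
  have hv : ‖s⁻¹‖ ≤ 1 := by rw [norm_inv]; exact inv_le_one_of_one_le₀ hs
  let v : (NormedField.valuation (K := F)).integer := ⟨s⁻¹, hv⟩
  let d : (NormedField.valuation (K := F)).integer := ⟨δ, hδ.le⟩
  have hi : ‖(((216 - 12 * v + v ^ 2 + 1296 * d * v ^ 2) * v :
      (NormedField.valuation (K := F)).integer) : F)‖ ≤ 1 := norm_integer_le_one _
  have e : 3 * s - 1 = δ * (((216 - 12 * v + v ^ 2 + 1296 * d * v ^ 2) * v :
      (NormedField.valuation (K := F)).integer) : F) := by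
    push_cast
    change 3 * s - 1 = δ * ((216 - 12 * s⁻¹ + s⁻¹ ^ 2 + 1296 * δ * s⁻¹ ^ 2) * s⁻¹)
    field_simp
    linear_combination h
  rw [e]
  exact norm_mul_lt_one hδ hi

/-- The quartic has at most one root outside the open unit disc: the divided difference of two of
them would be congruent to `1 / 9`. -/
lemma eq_of_quartic {s' : F} (hs' : 1 ≤ ‖s'‖)
    (h' : 3 * s' ^ 4 - s' ^ 3 - δ * (216 * s' ^ 2 - 12 * s' + 1 + 1296 * δ) = 0) : s = s' := by
  by_contra hne
  have he := norm_three_mul_sub_one_lt hδ hs h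
  have he' := norm_three_mul_sub_one_lt hδ hs' h'
  have hD : 3 * (s ^ 3 + s ^ 2 * s' + s * s' ^ 2 + s' ^ 3) - (s ^ 2 + s * s' + s' ^ 2)
      - 216 * δ * (s + s') + 12 * δ = 0 := by
    refine (mul_eq_zero.mp ?_).resolve_left (sub_ne_zero.mpr hne)
    linear_combination h - h'
  let a : (NormedField.valuation (K := F)).integer := ⟨3 * s - 1, he.le⟩
  let b : (NormedField.valuation (K := F)).integer := ⟨3 * s' - 1, he'.le⟩
  have h1 : ‖((3 + 3 * a + a ^ 2 : (NormedField.valuation (K := F)).integer) : F)‖ ≤ 1 :=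
    norm_integer_le_one _
  have h2 : ‖(((1 + a) ^ 2 + (1 + a) * (1 + b) + (1 + b) ^ 2 :
      (NormedField.valuation (K := F)).integer) : F)‖ ≤ 1 := norm_integer_le_one _
  have h3 : ‖((108 - 648 * (2 + a + b) : (NormedField.valuation (K := F)).integer) : F)‖ ≤ 1 :=
    norm_integer_le_one _
  have hsum := norm_add_lt_one (norm_add_lt_one (norm_mul_lt_one he h1) (norm_mul_lt_one he' h2))
    (norm_mul_lt_one hδ h3)
  have := norm_one_add_of_norm_lt_one hsum
  push_cast at this
  change ‖1 + ((3 * s - 1) * (3 + 3 * (3 * s - 1) + (3 * s - 1) ^ 2) +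
    (3 * s' - 1) * ((1 + (3 * s - 1)) ^ 2 + (1 + (3 * s - 1)) * (1 + (3 * s' - 1))
      + (1 + (3 * s' - 1)) ^ 2) +
    δ * (108 - 648 * (2 + (3 * s - 1) + (3 * s' - 1))))‖ = 1 at this
  have e : 1 + ((3 * s - 1) * (3 + 3 * (3 * s - 1) + (3 * s - 1) ^ 2) +
    (3 * s' - 1) * ((1 + (3 * s - 1)) ^ 2 + (1 + (3 * s - 1)) * (1 + (3 * s' - 1))
      + (1 + (3 * s' - 1)) ^ 2) +
    δ * (108 - 648 * (2 + (3 * s - 1) + (3 * s' - 1)))) = 0 := by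
    linear_combination 9 * hD
  rw [e, norm_zero] at this
  exact zero_ne_one this

/-- If `s` is the normalized coordinate of a three-torsion point of `E` outside the open unit disc,
then so is the normalized coordinate `s'` of the same point on the Hessian curve. -/
lemma one_le_norm_of_hessian {s' : F}
    (hs' : s' * ((12 * s - 1) * (1 + 15552 * δ)) =
      3 * s + 144 * δ * (3 * (12 * s - 1) - 6 - 15552 * δ)) : 1 ≤ ‖s'‖ := by
  have he := norm_three_mul_sub_one_lt hδ hs h
  let a : (NormedField.valuation (K := F)).integer := ⟨3 * s - 1, he.le⟩
  let d : (NormedField.valuation (K := F)).integer := ⟨δ, hδ.le⟩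
  have h1 :
      ‖(((4 * a + 3) * (1 + 15552 * d) : (NormedField.valuation (K := F)).integer) : F)‖ ≤ 1 :=
    norm_integer_le_one _
  have h2 : ‖((144 * (3 * (4 * a + 3) - 6 - 15552 * d) :
    (NormedField.valuation (K := F)).integer) : F)‖ ≤ 1 := norm_integer_le_one _
  have h3 := norm_one_add_of_norm_lt_one (norm_add_lt_one he (norm_mul_lt_one hδ h2))
  push_cast at h1 h3
  change ‖(4 * (3 * s - 1) + 3) * (1 + 15552 * δ)‖ ≤ 1 at h1
  change ‖1 + ((3 * s - 1) + δ * (144 * (3 * (4 * (3 * s - 1) + 3) - 6 - 15552 * δ)))‖ = 1 at h3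
  have e1 : (4 * (3 * s - 1) + 3) * (1 + 15552 * δ) = (12 * s - 1) * (1 + 15552 * δ) := by ring
  have e3 : 1 + ((3 * s - 1) + δ * (144 * (3 * (4 * (3 * s - 1) + 3) - 6 - 15552 * δ))) =
    3 * s + 144 * δ * (3 * (12 * s - 1) - 6 - 15552 * δ) := by ring
  rw [e1] at h1
  rw [e3, ← hs', norm_mul] at h3
  calc (1 : ℝ) = ‖s'‖ * ‖(12 * s - 1) * (1 + 15552 * δ)‖ := h3.symm
    _ ≤ ‖s'‖ * 1 := mul_le_mul_of_nonneg_left h1 (norm_nonneg _)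
    _ = ‖s'‖ := mul_one _

end Norm

section Curves

variable {F : Type*} [NormedField F] [IsUltrametricDist F] {W : WeierstrassCurve F}

lemma norm_c₆_sq (h : ‖W.Δ‖ < ‖W.c₄‖ ^ 3) : ‖W.c₆‖ ^ 2 = ‖W.c₄‖ ^ 3 := by
  have h' : ‖1728 * W.Δ‖ < ‖W.c₄ ^ 3‖ := by
    rw [norm_pow]
    exact (norm_mul_le_of_le_one (norm_ofNat_le_one 1728) le_rfl).trans_lt h
  rw [← norm_pow, ← norm_pow, c₆_sq_eq, sub_eq_add_neg]
  rw [← norm_neg (1728 * W.Δ)] at h'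
  rw [IsUltrametricDist.norm_add_eq_max_of_norm_ne_norm h'.ne', max_eq_left h'.le]

omit [IsUltrametricDist F] in
lemma c₄_ne_zero_of_norm_lt (h : ‖W.Δ‖ < ‖W.c₄‖ ^ 3) : W.c₄ ≠ 0 := by
  intro h0
  rw [h0, norm_zero, zero_pow three_ne_zero] at h
  exact h.not_ge (norm_nonneg _)

lemma c₆_ne_zero_of_norm_lt (h : ‖W.Δ‖ < ‖W.c₄‖ ^ 3) : W.c₆ ≠ 0 := by
  intro h0
  have := norm_c₆_sq h
  rw [h0, norm_zero, zero_pow two_ne_zero] at this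
  exact pow_ne_zero 3 (norm_ne_zero_iff.mpr (c₄_ne_zero_of_norm_lt h)) this.symm

lemma norm_Δ_div_lt (h : ‖W.Δ‖ < ‖W.c₄‖ ^ 3) : ‖W.Δ / W.c₆ ^ 2‖ < 1 := by
  rw [norm_div, norm_pow, norm_c₆_sq h, div_lt_one]
  · exact h
  · exact pow_pos (norm_pos_iff.mpr (c₄_ne_zero_of_norm_lt h)) 3

/-- At most one `x`-coordinate of a three-torsion point has normalized coordinate outside the open
unit disc. -/
lemma eq_of_one_le_norm_normCoord [CharZero F] (h : ‖W.Δ‖ < ‖W.c₄‖ ^ 3) {x x' : F}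
    (hx : psi W (12 * x + W.b₂) = 0) (hx' : psi W (12 * x' + W.b₂) = 0)
    (hs : 1 ≤ ‖normCoord W x‖) (hs' : 1 ≤ ‖normCoord W x'‖) : x = x' := by
  have h₄ := c₄_ne_zero_of_norm_lt h
  have h₆ := c₆_ne_zero_of_norm_lt h
  have := eq_of_quartic (norm_Δ_div_lt h) hs (normCoord_quartic h₆ hx) hs'
    (normCoord_quartic h₆ hx')
  rw [normCoord, normCoord] at this
  field_simp at this
  refine mul_right_cancel₀ h₄ ?_
  linear_combination (1 / 12) * this

/-- On a curve with the coefficients of a Tate curve, a point whose `x`-coordinate is close to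
`-1 / 3` has normalized coordinate outside the open unit disc. -/
lemma one_le_norm_normCoord [CharZero F] (h₁ : W.a₁ = 1) (h₂ : W.a₂ = 0) (h₃ : W.a₃ = 0)
    (h₄ : ‖W.a₄‖ < 1) (h₆ : ‖W.a₆‖ < 1) {x : F} (hx : ‖x + 1 / 3‖ < 1) :
    1 ≤ ‖normCoord W x‖ := by
  have ec₆ : W.c₆ = -(1 - (72 * W.a₄ - 864 * W.a₆)) := by
    simp [c₆, b₂, b₄, b₆, h₁, h₂, h₃]; ring
  have ec₄ : W.c₄ = 1 - 48 * W.a₄ := by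
    simp [c₄, b₂, b₄, h₁, h₂, h₃]; ring
  have eb₂ : W.b₂ = 1 := by simp [b₂, h₁, h₂]
  let a : (NormedField.valuation (K := F)).integer := ⟨W.a₄, h₄.le⟩
  let e : (NormedField.valuation (K := F)).integer := ⟨x + 1 / 3, hx.le⟩
  have hc₆ : ‖W.c₆‖ = 1 := by
    rw [ec₆, norm_neg]
    refine norm_one_sub_of_norm_lt_one ?_
    have := norm_add_lt_one (norm_mul_lt_one h₄ (norm_ofNat_le_one 72))
      (norm_mul_lt_one h₆ (by rw [norm_neg]; exact norm_ofNat_le_one 864 : ‖-(864 : F)‖ ≤ 1))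
    convert this using 2
    ring
  have hc₆0 : W.c₆ ≠ 0 := norm_pos_iff.mp (hc₆ ▸ one_pos)
  have hi : ‖((48 * (3 * e - 1) - 6 : (NormedField.valuation (K := F)).integer) : F)‖ ≤ 1 :=
    norm_integer_le_one _
  have h := norm_one_add_of_norm_lt_one (norm_add_lt_one (norm_add_lt_one
    (norm_mul_lt_one h₆ (norm_ofNat_le_one 216)) (norm_mul_lt_one h₄ hi))
    (norm_mul_lt_one hx (by rw [norm_neg]; exact norm_ofNat_le_one 3 : ‖-(3 : F)‖ ≤ 1)))
  push_cast at h
  change ‖1 + (W.a₆ * 216 + W.a₄ * (48 * (3 * (x + 1 / 3) - 1) - 6) + (x + 1 / 3) * -3)‖ = 1 at h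
  have key : 1 + (W.a₆ * 216 + W.a₄ * (48 * (3 * (x + 1 / 3) - 1) - 6) + (x + 1 / 3) * -3) =
      -(3 * (W.c₆ * normCoord W x)) := by
    have : W.c₆ * normCoord W x = (W.c₆ + (12 * x + W.b₂) * W.c₄) / 12 := by
      rw [normCoord]; field_simp
    rw [this, eb₂, ec₄, ec₆]
    ring
  rw [key, norm_neg, norm_mul, norm_mul, hc₆, one_mul] at h
  calc (1 : ℝ) = ‖(3 : F)‖ * ‖normCoord W x‖ := h.symm
    _ ≤ 1 * ‖normCoord W x‖ := mul_le_mul_of_nonneg_right (norm_ofNat_le_one 3) (norm_nonneg _)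
    _ = ‖normCoord W x‖ := one_mul _

end Curves

end HessianCanonical

namespace HessianCanonical

open WeierstrassCurve

/-! ### The canonical subgroup of the three-torsion -/

section Points

variable {F : Type*} [Field F] {W : WeierstrassCurve F}

lemma coords_some {x y : F} (h : W.toAffine.Nonsingular x y) :
    coords (Affine.Point.some x y h) = ![x, y, 1] := rfl

lemma coords_zero : coords (0 : W.toAffine.Point) = ![0, 1, 0] := rfl

lemma coords_injective : Function.Injective (coords (W := W.toAffine)) := by
  rintro (_ | ⟨x, y, h⟩) (_ | ⟨x', y', h'⟩) he
  · rfl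
  · simpa [coords] using congrFun he 2
  · simpa [coords] using congrFun he 2
  · have h0 : x = x' := by simpa [coords] using congrFun he 0
    have h1 : y = y' := by simpa [coords] using congrFun he 1
    subst h0 h1
    rfl

/-- The points at which the tangent meets the Tate curve triply, in terms of the coordinate `u`. -/
lemma psi_eq_zero_of_flex (h₁ : W.a₁ = 1) (h₂ : W.a₂ = 0) (h₃ : W.a₃ = 0) {x y : F}
    (hf : (6 * x ^ 2 + x + 2 * W.a₄) ^ 2 = (12 * x + 1) * (2 * y + x) ^ 2)
    (he : W.toAffine.Equation x y) : psi W (12 * x + W.b₂) = 0 := by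
  rw [psi_eq_of_equation he, h₁, h₂, h₃]
  linear_combination (-1728) * hf

variable (W) in
lemma psi_variableChange (C : VariableChange F) (u : F) :
    psi (C • W) u = (C.u : F)⁻¹ ^ 8 * psi W ((C.u : F) ^ 2 * u) := by
  have hu := C.u.ne_zero
  rw [psi, psi, variableChange_c₄, variableChange_c₆, Units.val_inv_eq_inv_val]
  field_simp

variable (W) in
lemma equation_variableChange [CharZero F] (C : VariableChange F) {x y : F}
    (h : (C • W).toAffine.Equation x y) :
    W.toAffine.Equation ((C.u : F) ^ 2 * x + C.r)
      ((C.u : F) ^ 3 * y + (C.u : F) ^ 2 * C.s * x + C.t) := by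
  have hu := C.u.ne_zero
  rw [equation_iff_short, variableChange_c₄, variableChange_c₆, variableChange_b₂,
    variableChange_a₁, variableChange_a₃, Units.val_inv_eq_inv_val] at h
  rw [equation_iff_short]
  field_simp at h
  linear_combination h

end Points

lemma exists_cubeRoot (F : Type*) [Field F] [IsAlgClosed F] [CharZero F] :
    ∃ ζ : Fˣ, (ζ : F) ^ 2 + ζ + 1 = 0 := by
  obtain ⟨z, hz⟩ := IsAlgClosed.exists_pow_nat_eq (-3 : F) two_pos
  have h : ((z - 1) / 2) ^ 2 + (z - 1) / 2 + 1 = 0 := by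
    field_simp
    linear_combination hz
  exact ⟨Units.mk0 _ (cubeRoot_ne_zero h), h⟩

section Canonical

variable {K : Type*} [NontriviallyNormedField K] [IsUltrametricDist K] [CompleteSpace K]
  [CharZero K]

instance (E : WeierstrassCurve K) [E.IsElliptic] :
    (E.baseChange (AlgebraicClosure K)).IsElliptic :=
  inferInstanceAs (E.map (algebraMap K (AlgebraicClosure K))).IsElliptic

variable {E : WeierstrassCurve K}

omit [CharZero K] [CompleteSpace K] [IsUltrametricDist K] in
lemma spectralNorm_Δ_lt (hE : ‖E.Δ‖ < ‖E.c₄‖ ^ 3) :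
    spectralNorm K (AlgebraicClosure K) (E.baseChange (AlgebraicClosure K)).Δ <
      spectralNorm K (AlgebraicClosure K) (E.baseChange (AlgebraicClosure K)).c₄ ^ 3 := by
  rw [WeierstrassCurve.baseChange, WeierstrassCurve.map_Δ, WeierstrassCurve.map_c₄,
    spectralNorm_extends, spectralNorm_extends]
  exact hE

/-- The images of a primitive cube root of unity and its inverse under the Tate parametrization. -/
lemma TateParametrization.tau_cubeRoot (T : TateParametrization E) {ζ : (AlgebraicClosure K)ˣ}
    (hζ : (ζ : AlgebraicClosure K) ^ 2 + ζ + 1 = 0) :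
    ∃ x y : AlgebraicClosure K, T.tau ζ = ![x, y, 1] ∧
      T.tau ζ⁻¹ = ![x, (E.baseChange (AlgebraicClosure K)).toAffine.negY x y, 1] ∧
      (E.baseChange (AlgebraicClosure K)).toAffine.Equation x y ∧
      psi (E.baseChange (AlgebraicClosure K))
        (12 * x + (E.baseChange (AlgebraicClosure K)).b₂) = 0 ∧
      1 ≤ spectralNorm K (AlgebraicClosure K)
        (normCoord (E.baseChange (AlgebraicClosure K)) x) := by
  obtain ⟨h1, h2, h3, h4, h5, h6⟩ := tate_cubeRoot T.q_ne_zero T.norm_q_lt_one hζ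
  have h6' : ∀ n : ℤ, ((ζ⁻¹ : (AlgebraicClosure K)ˣ) : AlgebraicClosure K) ≠
      algebraMap K (AlgebraicClosure K) T.q ^ n := by
    intro n hn
    refine h6 (-n) ?_
    rw [zpow_neg, ← hn, Units.val_inv_eq_inv_val, inv_inv]
  have hu := T.iso.u.ne_zero
  have hiso := T.iso_smul
  set W := E.baseChange (AlgebraicClosure K) with hW
  set V := (tateCurve T.q).baseChange (AlgebraicClosure K) with hV
  have hV1 : V.a₁ = 1 := by simp [hV, WeierstrassCurve.baseChange, tateCurve]
  have hV2 : V.a₂ = 0 := by simp [hV, WeierstrassCurve.baseChange, tateCurve]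
  have hV3 : V.a₃ = 0 := by simp [hV, WeierstrassCurve.baseChange, tateCurve]
  have ha1 : W.a₁ + 2 * T.iso.s = T.iso.u := by
    have h := hV1
    rw [← hiso, variableChange_a₁, Units.val_inv_eq_inv_val] at h
    field_simp at h
    exact h
  have ha3 : W.a₃ + T.iso.r * W.a₁ + 2 * T.iso.t = 0 := by
    have h := hV3
    rw [← hiso, variableChange_a₃, Units.val_inv_eq_inv_val] at h
    exact (mul_eq_zero.mp h).resolve_left (pow_ne_zero 3 (inv_ne_zero hu))
  have htau : T.tau ζ = _ := if_neg (not_exists.mpr h6)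
  have htau' : T.tau ζ⁻¹ = _ := if_neg (not_exists.mpr h6')
  rw [Units.val_inv_eq_inv_val, h3, h4] at htau'
  generalize @tateX _ _ (algClosureTopology K) (algebraMap K (AlgebraicClosure K) T.q) ζ = X at *
  generalize @tateY _ _ (algClosureTopology K) (algebraMap K (AlgebraicClosure K) T.q) ζ = Y at *
  have hVeq : V.toAffine.Equation X Y := by
    rw [Affine.equation_iff]
    simp only [hV1, hV2, hV3]
    linear_combination (1 / 4) * h1
  have hψ := psi_eq_zero_of_flex hV1 hV2 hV3 h2 hVeq
  refine ⟨_, _, htau, ?_, equation_variableChange W T.iso (hiso ▸ hVeq), ?_, ?_⟩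
  · rw [htau', Affine.negY]
    congr 2
    linear_combination (T.iso.u : AlgebraicClosure K) ^ 2 * X * ha1 + ha3
  · rw [← hiso, psi_variableChange, variableChange_b₂, Units.val_inv_eq_inv_val] at hψ
    have h := (mul_eq_zero.mp hψ).resolve_left (pow_ne_zero 8 (inv_ne_zero hu))
    convert h using 2
    field_simp
    ring
  · rw [← normCoord_variableChange, hiso]
    let := spectralNorm.normedField K (AlgebraicClosure K)
    have : IsUltrametricDist (AlgebraicClosure K) := isUltrametricDist_spectralNorm _
    have hn : ∀ x : K, ‖algebraMap K (AlgebraicClosure K) x‖ = ‖x‖ := fun x =>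
      spectralNorm_extends x
    refine one_le_norm_normCoord hV1 hV2 hV3 ?_ ?_ h5
    · rw [hV, WeierstrassCurve.baseChange, WeierstrassCurve.map_a₄, hn]
      exact (norm_tateCurve_a₄_le T.norm_q_lt_one).trans_lt T.norm_q_lt_one
    · rw [hV, WeierstrassCurve.baseChange, WeierstrassCurve.map_a₆, hn]
      exact (norm_tateCurve_a₆_le T.norm_q_lt_one).trans_lt T.norm_q_lt_one

omit [CharZero K] in
lemma TateParametrization.tau_one (T : TateParametrization E) : T.tau 1 = ![0, 1, 0] :=
  if_pos ⟨0, by simp⟩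

omit [IsUltrametricDist K] [CompleteSpace K] in
lemma mem_tors_three_iff {x y : AlgebraicClosure K}
    (h : (E.baseChange (AlgebraicClosure K)).toAffine.Nonsingular x y) :
    Affine.Point.some x y h ∈ Tors E 3 ↔ psi (E.baseChange (AlgebraicClosure K))
      (12 * x + (E.baseChange (AlgebraicClosure K)).b₂) = 0 := by
  classical
  rw [← add_self_add_self_eq_zero_iff h, ← two_nsmul, ← succ_nsmul, ← natCast_zsmul]
  exact Submodule.mem_torsionBy_iff _ _

lemma exists_mem_canonicalSubgroup [E.IsElliptic] (T : TateParametrization E) :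
    ∃ P : Tors E 3, P ∈ canonicalSubgroup E 3 ∧ P ≠ 0 := by
  obtain ⟨ζ, hζ⟩ := exists_cubeRoot (AlgebraicClosure K)
  obtain ⟨x, y, h1, -, h3, h4, -⟩ := T.tau_cubeRoot hζ
  refine ⟨⟨.some x y (Affine.equation_iff_nonsingular.mp h3),
    (mem_tors_three_iff _).mpr h4⟩, ⟨T, ζ, ?_, ?_⟩, ?_⟩
  · exact Units.ext (by rw [Units.val_pow_eq_pow_val, cube_eq_one hζ, Units.val_one])
  · rw [h1, coords_some]
  · intro h
    exact Affine.Point.some_ne_zero _ (congrArg Subtype.val h)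

/-- The canonical subgroup consists of zero and the points whose normalized coordinate lies outside
the open unit disc. -/
lemma mem_canonicalSubgroup_iff [E.IsElliptic] (hE : ‖E.Δ‖ < ‖E.c₄‖ ^ 3) (P : Tors E 3) :
    P ∈ canonicalSubgroup E 3 ↔ ∀ x y h, (P : GeomPoint E) = .some x y h →
      1 ≤ spectralNorm K (AlgebraicClosure K)
        (normCoord (E.baseChange (AlgebraicClosure K)) x) := by
  constructor
  · rintro ⟨T, ζ, hζ, hP⟩ x y h hxy
    rw [hxy, coords_some] at hP
    by_cases h1 : ζ = 1
    · rw [h1, T.tau_one] at hP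
      simpa using congrFun hP 2
    · have h2 : (ζ : AlgebraicClosure K) ^ 2 + ζ + 1 = 0 := by
        have h3 : ((ζ : AlgebraicClosure K) - 1) * ((ζ : AlgebraicClosure K) ^ 2 + ζ + 1) = 0 := by
          have : (ζ : AlgebraicClosure K) ^ 3 = 1 := by simpa using congrArg Units.val hζ
          linear_combination this
        refine (mul_eq_zero.mp h3).resolve_left fun h4 => h1 (Units.ext ?_)
        exact sub_eq_zero.mp h4
      obtain ⟨x', y', h3, -, -, -, h4⟩ := T.tau_cubeRoot h2
      rw [h3] at hP
      have : x = x' := by simpa using congrFun hP 0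
      rwa [this]
  · intro h
    obtain ⟨T⟩ := nonempty_tateParametrization hE
    rcases hP : (P : GeomPoint E) with _ | ⟨x, y, hxy⟩
    · refine ⟨T, 1, one_pow _, ?_⟩
      rw [hP, T.tau_one]
      rfl
    · obtain ⟨ζ, hζ⟩ := exists_cubeRoot (AlgebraicClosure K)
      obtain ⟨x', y', h1, h2, h3, h4, h5⟩ := T.tau_cubeRoot hζ
      have hx : x = x' := by
        let := spectralNorm.normedField K (AlgebraicClosure K)
        have : IsUltrametricDist (AlgebraicClosure K) := isUltrametricDist_spectralNorm _
        exact eq_of_one_le_norm_normCoord (spectralNorm_Δ_lt hE)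
          ((mem_tors_three_iff hxy).mp (hP ▸ P.2)) h4 (h x y hxy hP) h5
      have h3' : ζ ^ 3 = 1 :=
        Units.ext (by rw [Units.val_pow_eq_pow_val, cube_eq_one hζ, Units.val_one])
      rcases Affine.Y_eq_of_X_eq hxy.1 h3 hx with hy | hy
      · exact ⟨T, ζ, h3', by rw [hP, coords_some, h1, hx, hy]⟩
      · exact ⟨T, ζ⁻¹, by rw [inv_pow, h3', inv_one], by rw [hP, coords_some, h2, hx, hy]⟩

end Canonical

end HessianCanonical

namespace HessianCanonical

open WeierstrassCurve MvPolynomial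

/-! ### Weierstrass models of the Hessian curve -/

section HessianForm

variable {K : Type*} [Field K] (E : WeierstrassCurve K) (v : Fin 3 → K)

lemma eval_hess : 288 * eval v (hess E) =
    144 * (12 * v 0 + E.b₂ * v 2) * (2 * v 1 + E.a₁ * v 0 + E.a₃ * v 2) ^ 2
      - E.c₄ * (12 * v 0 + E.b₂ * v 2) ^ 2 * v 2 - 2 * E.c₆ * (12 * v 0 + E.b₂ * v 2) * v 2 ^ 2
      - E.c₄ ^ 2 * v 2 ^ 3 := by
  have hX : pderiv 0 (Projective.polynomial E) = Projective.polynomialX E := rfl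
  have hY : pderiv 1 (Projective.polynomial E) = Projective.polynomialY E := rfl
  have hZ : pderiv 2 (Projective.polynomial E) = Projective.polynomialZ E := rfl
  rw [hess, hessianForm, Matrix.det_fin_three]
  simp only [Matrix.of_apply, hX, hY, hZ, Projective.polynomialX_eq, Projective.polynomialY_eq,
    Projective.polynomialZ_eq]
  simp [pderiv_X]
  simp only [c₄, c₆, b₂, b₄, b₆]
  ring

/-- The Weierstrass form in the coordinates `U = 12 X + b₂ Z`, `η = 2 Y + a₁ X + a₃ Z`, `Z`. -/
lemma eval_projective_polynomial : 1728 * eval v (Projective.polynomial E) =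
    432 * (2 * v 1 + E.a₁ * v 0 + E.a₃ * v 2) ^ 2 * v 2 - (12 * v 0 + E.b₂ * v 2) ^ 3
      + 3 * E.c₄ * (12 * v 0 + E.b₂ * v 2) * v 2 ^ 2 + 2 * E.c₆ * v 2 ^ 3 := by
  rw [Projective.eval_polynomial]
  simp only [c₄, c₆, b₂, b₄, b₆]
  ring

end HessianForm

section CubicCoefficients

variable {K : Type*} [Field K] [CharZero K]

/-- Comparison of the coefficients when a linear change of coordinates, which fixes the point
`(0 : 1 : 0)`, carries the Hessian cubic into Weierstrass form. -/
lemma cubic_coefficients {c₄ c₆ c₄' c₆' k p₁₁ p₁₃ p₂₁ d p₂₃ p₃₁ p₃₃ : K}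
    (h : ∀ U η Z : K,
      144 * (p₁₁ * U + p₁₃ * Z) * (p₂₁ * U + d * η + p₂₃ * Z) ^ 2
        - c₄ * (p₁₁ * U + p₁₃ * Z) ^ 2 * (p₃₁ * U + p₃₃ * Z)
        - 2 * c₆ * (p₁₁ * U + p₁₃ * Z) * (p₃₁ * U + p₃₃ * Z) ^ 2
        - c₄ ^ 2 * (p₃₁ * U + p₃₃ * Z) ^ 3 =
      k * (432 * η ^ 2 * Z - U ^ 3 + 3 * c₄' * U * Z ^ 2 + 2 * c₆' * Z ^ 3))
    (hc : c₄ ≠ 0) (hd : d ≠ 0) (hdet : p₁₁ * p₃₃ - p₁₃ * p₃₁ ≠ 0) :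
    p₁₁ = 0 ∧ p₂₁ = 0 ∧ p₂₃ = 0 ∧ p₁₃ ≠ 0 ∧ p₃₁ ≠ 0 ∧
      p₁₃ * d ^ 2 = 3 * c₄ ^ 2 * p₃₁ ^ 3 ∧ 3 * c₄ ^ 2 * p₃₃ = -2 * c₆ * p₁₃ ∧
      9 * c₄ ^ 4 * p₃₁ ^ 2 * c₄' = p₁₃ ^ 2 * (4 * c₆ ^ 2 - 3 * c₄ ^ 3) ∧
      27 * c₄ ^ 6 * p₃₁ ^ 3 * c₆' = p₁₃ ^ 3 * c₆ * (9 * c₄ ^ 3 - 8 * c₆ ^ 2) := by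
  have h11 : p₁₁ = 0 := by
    have : p₁₁ * d ^ 2 = 0 := by
      linear_combination (1 / 288) * (h 1 1 0 + h 1 (-1) 0 - 2 * h 1 0 0)
    exact (mul_eq_zero.mp this).resolve_right (pow_ne_zero 2 hd)
  subst h11
  have h13 : p₁₃ ≠ 0 := by rintro rfl; simp at hdet
  have h31 : p₃₁ ≠ 0 := by rintro rfl; simp at hdet
  have h21 : p₂₁ = 0 := by
    have : p₁₃ * d * p₂₁ = 0 := by
      linear_combination (1 / 1152) * (h 1 1 1 - h 1 (-1) 1 - h (-1) 1 1 + h (-1) (-1) 1)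
    exact (mul_eq_zero.mp this).resolve_left (mul_ne_zero h13 hd)
  subst h21
  have h23 : p₂₃ = 0 := by
    have : p₁₃ * d * p₂₃ = 0 := by
      linear_combination (1 / 576) * (h 0 1 1 - h 0 (-1) 1)
    exact (mul_eq_zero.mp this).resolve_left (mul_ne_zero h13 hd)
  subst h23
  have hk : p₁₃ * d ^ 2 = 3 * k := by
    linear_combination (1 / 288) * (h 0 1 1 + h 0 (-1) 1 - 2 * h 0 0 1)
  have hU : k = c₄ ^ 2 * p₃₁ ^ 3 := by linear_combination h 1 0 0
  have hg : 3 * c₄ ^ 2 * p₃₃ = -2 * c₆ * p₁₃ := by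
    refine mul_left_cancel₀ (pow_ne_zero 2 h31) ?_
    linear_combination h 0 0 1 - (1 / 2) * (h 1 0 1 + h (-1) 0 1)
  have h4 : -c₄ * p₁₃ ^ 2 * p₃₁ - 4 * c₆ * p₁₃ * p₃₁ * p₃₃ - 3 * c₄ ^ 2 * p₃₁ * p₃₃ ^ 2 =
      3 * k * c₄' := by
    linear_combination (1 / 2) * (h 1 0 1 - h (-1) 0 1) - h 1 0 0
  have h6 : -c₄ * p₁₃ ^ 2 * p₃₃ - 2 * c₆ * p₁₃ * p₃₃ ^ 2 - c₄ ^ 2 * p₃₃ ^ 3 = 2 * k * c₆' := by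
    linear_combination h 0 0 1
  have hp : p₃₃ = -2 * c₆ * p₁₃ / (3 * c₄ ^ 2) := by
    field_simp
    linear_combination hg
  rw [hp, hU] at h4 h6
  refine ⟨rfl, rfl, rfl, h13, h31, by rw [hk, hU]; ring, hg, ?_, ?_⟩
  · field_simp at h4
    linear_combination -h4
  · field_simp at h6
    linear_combination -h6

end CubicCoefficients

section Model

variable {K : Type*} [Field K] [CharZero K] {E : WeierstrassCurve K}

omit [CharZero K] in
lemma WeierstrassModel.eval_subst {G : MvPolynomial (Fin 3) K} (H : WeierstrassModel G)
    (v : Fin 3 → K) : eval ((H.change : Matrix (Fin 3) (Fin 3) K) *ᵥ v) G =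
      H.scale * eval v (Projective.polynomial H.curve) := by
  have h := congrArg (eval v) H.subst_eq
  rw [map_mul, eval_C] at h
  have he : eval v (bind₁ (fun i => ∑ j, C ((H.change : Matrix (Fin 3) (Fin 3) K) i j) * X j) G) =
      eval (fun i => eval v (∑ j, C ((H.change : Matrix (Fin 3) (Fin 3) K) i j) * X j)) G :=
    eval₂Hom_bind₁ (RingHom.id K) v _ G
  rw [← h, he]
  congr 2
  funext i
  simp [Matrix.mulVec, dotProduct]

/-- The shape of a linear change of coordinates `A` carrying the Hessian of the Weierstrass curve
`W` to the Weierstrass curve `V`: with `U = 12 X + b₂ Z` and `η = 2 Y + a₁ X + a₃ Z`, it is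
`U = b Z'`, `η = d η'`, `Z = f U' + g Z'`. The last four fields compare the equations. -/
structure IsHessianChange {K : Type*} [Field K] (W V : WeierstrassCurve K)
    (A : Matrix (Fin 3) (Fin 3) K) (b d f g : K) : Prop where
  isUnit_det : IsUnit A.det
  b_ne_zero : b ≠ 0
  d_ne_zero : d ≠ 0
  f_ne_zero : f ≠ 0
  A01 : A 0 1 = 0
  A21 : A 2 1 = 0
  A11 : A 1 1 = d
  U_U : 12 * A 0 0 + W.b₂ * A 2 0 = 0
  U_Z : 12 * A 0 2 + W.b₂ * A 2 2 = b
  η_X : 2 * A 1 0 + W.a₁ * A 0 0 + W.a₃ * A 2 0 = d * V.a₁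
  η_Z : 2 * A 1 2 + W.a₁ * A 0 2 + W.a₃ * A 2 2 = d * V.a₃
  Z_U : A 2 0 = 12 * f
  Z_Z : A 2 2 = f * V.b₂ + g
  b_mul_d : b * d ^ 2 = 3 * W.c₄ ^ 2 * f ^ 3
  mul_g : 3 * W.c₄ ^ 2 * g = -2 * W.c₆ * b
  mul_c₄ : 9 * W.c₄ ^ 4 * f ^ 2 * V.c₄ = b ^ 2 * (4 * W.c₆ ^ 2 - 3 * W.c₄ ^ 3)
  mul_c₆ : 27 * W.c₄ ^ 6 * f ^ 3 * V.c₆ = b ^ 3 * W.c₆ * (9 * W.c₄ ^ 3 - 8 * W.c₆ ^ 2)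

lemma IsHessianChange.map {K F : Type*} [Field K] [Field F] (φ : K →+* F) {W V : WeierstrassCurve K}
    {A : Matrix (Fin 3) (Fin 3) K} {b d f g : K} (h : IsHessianChange W V A b d f g) :
    IsHessianChange (W.map φ) (V.map φ) (A.map φ) (φ b) (φ d) (φ f) (φ g) where
  isUnit_det := by
    have : (A.map φ).det = φ A.det := (RingHom.map_det φ A).symm
    rw [this]
    exact h.isUnit_det.map φ
  b_ne_zero := (map_ne_zero φ).mpr h.b_ne_zero
  d_ne_zero := (map_ne_zero φ).mpr h.d_ne_zero
  f_ne_zero := (map_ne_zero φ).mpr h.f_ne_zero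
  A01 := by simpa using congrArg φ h.A01
  A21 := by simpa using congrArg φ h.A21
  A11 := by simpa using congrArg φ h.A11
  U_U := by simpa [map_ofNat] using congrArg φ h.U_U
  U_Z := by simpa [map_ofNat] using congrArg φ h.U_Z
  η_X := by simpa [map_ofNat] using congrArg φ h.η_X
  η_Z := by simpa [map_ofNat] using congrArg φ h.η_Z
  Z_U := by simpa [map_ofNat] using congrArg φ h.Z_U
  Z_Z := by simpa [map_ofNat] using congrArg φ h.Z_Z
  b_mul_d := by simpa [map_ofNat] using congrArg φ h.b_mul_d
  mul_g := by simpa [map_ofNat] using congrArg φ h.mul_g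
  mul_c₄ := by simpa [map_ofNat] using congrArg φ h.mul_c₄
  mul_c₆ := by simpa [map_ofNat] using congrArg φ h.mul_c₆

lemma WeierstrassModel.exists_isHessianChange (H : WeierstrassModel (hess E)) (hc : E.c₄ ≠ 0) :
    ∃ b d f g : K, IsHessianChange E H.curve H.change b d f g := by
  have hev := H.eval_subst
  obtain ⟨c, hc0⟩ := H.base
  obtain ⟨A, hA⟩ : ∃ A : Matrix (Fin 3) (Fin 3) K, A = H.change := ⟨_, rfl⟩
  have hdetA : A.det ≠ 0 := by
    rw [hA]
    exact ((Matrix.isUnit_iff_isUnit_det _).mp H.change.isUnit).ne_zero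
  rw [← hA] at hev hc0 ⊢
  have h01 : A 0 1 = 0 := by
    simpa [Matrix.mulVec, dotProduct, Fin.sum_univ_three] using congrFun hc0 0
  have h21 : A 2 1 = 0 := by
    simpa [Matrix.mulVec, dotProduct, Fin.sum_univ_three] using congrFun hc0 2
  have hdetA' := hdetA
  rw [Matrix.det_fin_three, h01, h21] at hdetA
  have key := cubic_coefficients (c₄ := E.c₄) (c₆ := E.c₆) (c₄' := H.curve.c₄) (c₆' := H.curve.c₆)
    (k := H.scale / 6) (p₁₁ := (12 * A 0 0 + E.b₂ * A 2 0) / 12)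
    (p₁₃ := 12 * A 0 2 + E.b₂ * A 2 2 - (12 * A 0 0 + E.b₂ * A 2 0) / 12 * H.curve.b₂)
    (p₂₁ := (2 * A 1 0 + E.a₁ * A 0 0 + E.a₃ * A 2 0 - A 1 1 * H.curve.a₁) / 12)
    (d := A 1 1)
    (p₂₃ := 2 * A 1 2 + E.a₁ * A 0 2 + E.a₃ * A 2 2 - A 1 1 * H.curve.a₃
      - (2 * A 1 0 + E.a₁ * A 0 0 + E.a₃ * A 2 0 - A 1 1 * H.curve.a₁) / 12 * H.curve.b₂)
    (p₃₁ := A 2 0 / 12) (p₃₃ := A 2 2 - A 2 0 / 12 * H.curve.b₂) ?_ hc ?_ ?_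
  · obtain ⟨k1, k2, k3, k4, k5, k6, k7, k8, k9⟩ := key
    have k1' : 12 * A 0 0 + E.b₂ * A 2 0 = 0 := by linear_combination 12 * k1
    rw [k1', zero_div, zero_mul, sub_zero] at k4 k6 k7 k8 k9
    rw [k2, zero_mul, sub_zero] at k3
    refine ⟨_, A 1 1, A 2 0 / 12, A 2 2 - A 2 0 / 12 * H.curve.b₂, hdetA'.isUnit, k4, ?_, k5,
      h01, h21, rfl, k1', rfl, ?_, ?_, ?_, ?_, k6, k7, k8, k9⟩
    · intro h0; rw [h0] at hdetA; apply hdetA; ring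
    · linear_combination 12 * k2
    · linear_combination k3
    · ring
    · ring
  · intro U η Z
    have h := hev ![(U - H.curve.b₂ * Z) / 12,
      (η - H.curve.a₁ * ((U - H.curve.b₂ * Z) / 12) - H.curve.a₃ * Z) / 2, Z]
    have h1 := eval_hess E (A *ᵥ ![(U - H.curve.b₂ * Z) / 12,
      (η - H.curve.a₁ * ((U - H.curve.b₂ * Z) / 12) - H.curve.a₃ * Z) / 2, Z])
    have h2 := eval_projective_polynomial H.curve ![(U - H.curve.b₂ * Z) / 12,
      (η - H.curve.a₁ * ((U - H.curve.b₂ * Z) / 12) - H.curve.a₃ * Z) / 2, Z]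
    rw [h] at h1
    generalize eval _ (Projective.polynomial H.curve) = P at h1 h2
    simp [Matrix.mulVec, dotProduct, Fin.sum_univ_three, h01, h21] at h1 h2
    generalize H.curve.b₂ = b₂' at *
    generalize E.b₂ = b₂ at *
    generalize E.c₄ = c₄ at *
    generalize E.c₆ = c₆ at *
    linear_combination (H.scale / 6 : K) * h2 - h1
  · intro h0; rw [h0] at hdetA; apply hdetA; ring
  · intro h0
    apply hdetA
    linear_combination (A 1 1) * h0

end Model

end HessianCanonical

namespace HessianCanonical

open WeierstrassCurve

/-! ### The correspondence of three-torsion points -/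

namespace IsHessianChange

variable {F : Type*} [Field F] [CharZero F] {W V : WeierstrassCurve F}
  {A : Matrix (Fin 3) (Fin 3) F} {b d f g : F} (h : IsHessianChange W V A b d f g)
include h

/-- The Hessian cubic in the coordinates of `V`, evaluated at the points of `W`. -/
lemma equation_eq (hc₄ : W.c₄ ≠ 0) {u η u' η' c : F} (hc : f * u' + g = c) (hu : c * u = b)
    (hη : d * η' = c * η) :
    3 * W.c₄ ^ 2 * f ^ 3 * (432 * η' ^ 2 - (u' ^ 3 - 3 * V.c₄ * u' - 2 * V.c₆)) =
      c ^ 3 * (u * (432 * η ^ 2 - (u ^ 3 - 3 * W.c₄ * u - 2 * W.c₆)) + psi W u) := by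
  have hf := h.f_ne_zero
  have h1 : 3 * W.c₄ ^ 2 * f ^ 3 * η' ^ 2 = c ^ 3 * u * η ^ 2 := by
    rw [← h.b_mul_d, ← hu]
    linear_combination (c * u) * (d * η' + c * η) * hη
  have hg : g = -2 * W.c₆ * b / (3 * W.c₄ ^ 2) := by
    field_simp; linear_combination h.mul_g
  have h4 : V.c₄ = b ^ 2 * (4 * W.c₆ ^ 2 - 3 * W.c₄ ^ 3) / (9 * W.c₄ ^ 4 * f ^ 2) := by
    field_simp; linear_combination h.mul_c₄
  have h6 : V.c₆ = b ^ 3 * W.c₆ * (9 * W.c₄ ^ 3 - 8 * W.c₆ ^ 2) / (27 * W.c₄ ^ 6 * f ^ 3) := by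
    field_simp; linear_combination h.mul_c₆
  have hu' : u' = (c - g) / f := by field_simp; linear_combination hc
  have h2 : 3 * W.c₄ ^ 2 * f ^ 3 * (u' ^ 3 - 3 * V.c₄ * u' - 2 * V.c₆) =
      3 * W.c₄ * b ^ 2 * c + 6 * W.c₆ * b * c ^ 2 + 3 * W.c₄ ^ 2 * c ^ 3 := by
    rw [hu', h4, h6, hg]
    field_simp
    ring
  rw [mul_sub, h2, ← hu, psi]
  linear_combination 432 * h1

lemma psi_eq (hc₄ : W.c₄ ≠ 0) {u' c : F} (hc : f * u' + g = c) :
    3 * W.c₄ ^ 2 * f ^ 4 * psi V u' =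
      -(b ^ 4 - 6 * W.c₄ * b ^ 2 * c ^ 2 - 8 * W.c₆ * b * c ^ 3 - 3 * W.c₄ ^ 2 * c ^ 4) := by
  have hf := h.f_ne_zero
  have hg : g = -2 * W.c₆ * b / (3 * W.c₄ ^ 2) := by
    field_simp; linear_combination h.mul_g
  have h4 : V.c₄ = b ^ 2 * (4 * W.c₆ ^ 2 - 3 * W.c₄ ^ 3) / (9 * W.c₄ ^ 4 * f ^ 2) := by
    field_simp; linear_combination h.mul_c₄
  have h6 : V.c₆ = b ^ 3 * W.c₆ * (9 * W.c₄ ^ 3 - 8 * W.c₆ ^ 2) / (27 * W.c₄ ^ 6 * f ^ 3) := by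
    field_simp; linear_combination h.mul_c₆
  have hu' : u' = (c - g) / f := by field_simp; linear_combination hc
  rw [psi, hu', h4, h6, hg]
  field_simp
  ring

lemma psi_eq_zero_iff (hc₄ : W.c₄ ≠ 0) {u u' c : F} (hc : f * u' + g = c) (hu : c * u = b) :
    psi V u' = 0 ↔ psi W u = 0 := by
  have hc0 : c ≠ 0 := by rintro rfl; exact h.b_ne_zero (by rw [← hu, zero_mul])
  have hk : 3 * W.c₄ ^ 2 * f ^ 4 ≠ 0 :=
    mul_ne_zero (mul_ne_zero three_ne_zero (pow_ne_zero 2 hc₄)) (pow_ne_zero 4 h.f_ne_zero)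
  have h1 : 3 * W.c₄ ^ 2 * f ^ 4 * psi V u' = -c ^ 4 * psi W u := by
    rw [h.psi_eq hc₄ hc, psi, ← hu]; ring
  rw [← mul_eq_zero_iff_left (a := 3 * W.c₄ ^ 2 * f ^ 4) hk, h1,
    mul_eq_zero_iff_left (neg_ne_zero.mpr (pow_ne_zero 4 hc0))]

/-- The affine points of `V` whose images under `A` are the affine points of `W`. -/
lemma mulVec_eq_smul_iff {x y x' y' c : F} : A *ᵥ ![x', y', 1] = c • ![x, y, 1] ↔
    f * (12 * x' + V.b₂) + g = c ∧ c * (12 * x + W.b₂) = b ∧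
      d * (2 * y' + V.a₁ * x' + V.a₃) = c * (2 * y + W.a₁ * x + W.a₃) := by
  have e : A *ᵥ ![x', y', 1] = c • ![x, y, 1] ↔ A 0 0 * x' + A 0 2 = c * x ∧
      A 1 0 * x' + d * y' + A 1 2 = c * y ∧ 12 * f * x' + (f * V.b₂ + g) = c := by
    rw [← List.ofFn_inj]
    simp [Matrix.mulVec, dotProduct, Fin.sum_univ_three, h.A01, h.A21, h.A11, h.Z_U, h.Z_Z]
  rw [e]
  have h1 := h.U_U
  have h2 := h.U_Z
  have h3 := h.η_X
  have h4 := h.η_Z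
  rw [h.Z_U] at h1 h3
  rw [h.Z_Z] at h2 h4
  constructor
  · rintro ⟨e0, e1, e2⟩
    refine ⟨by linear_combination e2, ?_, ?_⟩
    · linear_combination (-12) * e0 - W.b₂ * e2 + x' * h1 + h2
    · linear_combination 2 * e1 + W.a₁ * e0 + W.a₃ * e2 - x' * h3 - h4
  · rintro ⟨e0, e1, e2⟩
    have e3 : A 0 0 * x' + A 0 2 = c * x := by
      linear_combination (1 / 12) * (x' * h1 + h2 - W.b₂ * e0 - e1)
    refine ⟨e3, ?_, by linear_combination e0⟩
    linear_combination (1 / 2) * (e2 + x' * h3 + h4 - W.a₁ * e3 - W.a₃ * e0)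

/-- The normalized coordinates of corresponding points. -/
lemma normCoord_eq (hc₄ : W.c₄ ≠ 0) (hc₆ : W.c₆ ≠ 0) (hc₆' : V.c₆ ≠ 0) {x x' c : F}
    (hc : f * (12 * x' + V.b₂) + g = c) (hu : c * (12 * x + W.b₂) = b) :
    normCoord V x' * ((12 * normCoord W x - 1) * (1 + 15552 * (W.Δ / W.c₆ ^ 2))) =
      3 * normCoord W x + 144 * (W.Δ / W.c₆ ^ 2) *
        (3 * (12 * normCoord W x - 1) - 6 - 15552 * (W.Δ / W.c₆ ^ 2)) := by
  have hf := h.f_ne_zero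
  have hb := h.b_ne_zero
  have hδ : W.Δ = (W.c₄ ^ 3 - W.c₆ ^ 2) / 1728 := by
    field_simp; linear_combination W.c_relation
  have hg : g = -2 * W.c₆ * b / (3 * W.c₄ ^ 2) := by
    field_simp; linear_combination h.mul_g
  have h4 : V.c₄ = b ^ 2 * (4 * W.c₆ ^ 2 - 3 * W.c₄ ^ 3) / (9 * W.c₄ ^ 4 * f ^ 2) := by
    field_simp; linear_combination h.mul_c₄
  have h6 : V.c₆ = b ^ 3 * W.c₆ * (9 * W.c₄ ^ 3 - 8 * W.c₆ ^ 2) / (27 * W.c₄ ^ 6 * f ^ 3) := by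
    field_simp; linear_combination h.mul_c₆
  obtain ⟨D, hD⟩ : ∃ D, D = 9 * W.c₄ ^ 3 - 8 * W.c₆ ^ 2 := ⟨_, rfl⟩
  have hD0 : D ≠ 0 := by
    rintro rfl; apply hc₆'; rw [h6, ← hD, mul_zero, zero_div]
  rw [← hD] at h6
  rw [normCoord, normCoord, hδ]
  generalize 12 * x + W.b₂ = u at *
  generalize 12 * x' + V.b₂ = u' at *
  have hu0 : u ≠ 0 := by rintro rfl; exact hb (by rw [← hu, mul_zero])
  have hu' : u' = (b / u - g) / f := by
    rw [← hu, ← hc]; field_simp; ring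
  rw [hu', h4, h6, hg]
  field_simp
  rw [hD]
  ring

end IsHessianChange

end HessianCanonical

namespace HessianCanonical

open WeierstrassCurve

/-! ### Additivity of the correspondence -/

section Correspondence

variable {F : Type*} [Field F] {W V : WeierstrassCurve F} {A : Matrix (Fin 3) (Fin 3) F}

/-- The point `Q` of `V` and the point `P` of `W` are the same point of the projective plane, in
coordinates which are related by the matrix `A`. -/
def Corresponds (A : Matrix (Fin 3) (Fin 3) F) (P : W.toAffine.Point) (Q : V.toAffine.Point) :
    Prop :=
  ∃ c : Fˣ, A *ᵥ coords Q = (c : F) • coords P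

lemma eq_of_coords_eq_smul {P P' : W.toAffine.Point} {c : F} (h : coords P = c • coords P') :
    P = P' := by
  apply coords_injective
  rcases P with _ | ⟨x, y, hxy⟩ <;> rcases P' with _ | ⟨x', y', hxy'⟩
  · rfl
  · have h2 := congrFun h 2
    have h1 := congrFun h 1
    simp only [coords, Matrix.cons_val, Pi.smul_apply, smul_eq_mul, mul_one] at h1 h2
    rw [← h2, zero_mul] at h1
    exact absurd h1 one_ne_zero
  · have h2 := congrFun h 2
    simp [coords] at h2
  · have h2 := congrFun h 2
    simp only [coords, Matrix.cons_val, Pi.smul_apply, smul_eq_mul, mul_one] at h2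
    rw [h, ← h2, one_smul]

lemma Corresponds.left_unique {P P' : W.toAffine.Point} {Q : V.toAffine.Point}
    (h : Corresponds A P Q) (h' : Corresponds A P' Q) : P = P' := by
  obtain ⟨c, hc⟩ := h
  obtain ⟨c', hc'⟩ := h'
  refine eq_of_coords_eq_smul (c := (c : F)⁻¹ * c') ?_
  rw [mul_smul, ← hc', hc, inv_smul_smul₀ c.ne_zero]

lemma Corresponds.right_unique (hA : IsUnit A.det) {P : W.toAffine.Point}
    {Q Q' : V.toAffine.Point} (h : Corresponds A P Q) (h' : Corresponds A P Q') : Q = Q' := by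
  obtain ⟨c, hc⟩ := h
  obtain ⟨c', hc'⟩ := h'
  refine eq_of_coords_eq_smul (c := (c : F) * (c' : F)⁻¹) ?_
  refine Matrix.mulVec_injective_of_isUnit ((Matrix.isUnit_iff_isUnit_det _).mpr hA) ?_
  rw [Matrix.mulVec_smul, hc, hc', mul_smul, inv_smul_smul₀ c'.ne_zero]

variable [CharZero F] {b d f g : F}

namespace IsHessianChange

variable (h : IsHessianChange W V A b d f g)
include h

lemma corresponds_some_iff {x y x' y' : F} (hP : W.toAffine.Nonsingular x y)
    (hQ : V.toAffine.Nonsingular x' y') :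
    Corresponds A (Affine.Point.some x y hP) (Affine.Point.some x' y' hQ) ↔
      ∃ c, f * (12 * x' + V.b₂) + g = c ∧ c * (12 * x + W.b₂) = b ∧
        d * (2 * y' + V.a₁ * x' + V.a₃) = c * (2 * y + W.a₁ * x + W.a₃) := by
  constructor
  · rintro ⟨c, hc⟩
    exact ⟨c, h.mulVec_eq_smul_iff.mp hc⟩
  · rintro ⟨c, hc⟩
    have hc0 : c ≠ 0 := by
      rintro rfl
      exact h.b_ne_zero (by rw [← hc.2.1, zero_mul])
    exact ⟨Units.mk0 c hc0, h.mulVec_eq_smul_iff.mpr hc⟩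

omit [CharZero F] in
lemma corresponds_zero : Corresponds A (0 : W.toAffine.Point) (0 : V.toAffine.Point) := by
  refine ⟨Units.mk0 d h.d_ne_zero, ?_⟩
  rw [coords_zero, coords_zero, ← List.ofFn_inj]
  simp [Matrix.mulVec, dotProduct, Fin.sum_univ_three, h.A01, h.A21, h.A11]

omit [CharZero F] in
lemma eq_zero_of_corresponds {P : W.toAffine.Point} (hP : Corresponds A P (0 : V.toAffine.Point)) :
    P = 0 :=
  hP.left_unique h.corresponds_zero

omit [CharZero F] in
lemma eq_zero_of_corresponds' {Q : V.toAffine.Point} (hQ : Corresponds A (0 : W.toAffine.Point) Q) :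
    Q = 0 :=
  hQ.right_unique h.isUnit_det h.corresponds_zero

lemma corresponds_neg {P : W.toAffine.Point} {Q : V.toAffine.Point} (hPQ : Corresponds A P Q) :
    Corresponds A (-P) (-Q) := by
  rcases P with _ | ⟨x, y, hP⟩
  · change Corresponds A 0 Q at hPQ
    rw [h.eq_zero_of_corresponds' hPQ]
    exact h.corresponds_zero
  rcases Q with _ | ⟨x', y', hQ⟩
  · exact absurd (h.eq_zero_of_corresponds hPQ) (Affine.Point.some_ne_zero hP)
  rw [Affine.Point.neg_some, Affine.Point.neg_some, h.corresponds_some_iff]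
  obtain ⟨c, h1, h2, h3⟩ := (h.corresponds_some_iff _ _).mp hPQ
  refine ⟨c, h1, h2, ?_⟩
  rw [Affine.negY, Affine.negY]
  linear_combination (-1) * h3

variable [DecidableEq F]

/-- The Hessian curve contains the three-torsion points of `W`, as three-torsion points. -/
lemma exists_corresponds_right [V.IsElliptic] (hc₄ : W.c₄ ≠ 0) {P : W.toAffine.Point}
    (hP3 : P + P + P = 0) : ∃ Q : V.toAffine.Point, Q + Q + Q = 0 ∧ Corresponds A P Q := by
  rcases P with _ | ⟨x, y, hP⟩
  · exact ⟨0, by simp, h.corresponds_zero⟩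
  rw [add_self_add_self_eq_zero_iff] at hP3
  have hE := equation_iff_short.mp hP.1
  have hu0 : 12 * x + W.b₂ ≠ 0 := by
    intro h0
    rw [h0, psi] at hP3
    refine mul_ne_zero three_ne_zero (pow_ne_zero 2 hc₄) ?_
    linear_combination (-1) * hP3
  have hf := h.f_ne_zero
  have hd := h.d_ne_zero
  obtain ⟨c, hc⟩ : ∃ c, c = b / (12 * x + W.b₂) := ⟨_, rfl⟩
  obtain ⟨x', hx'⟩ : ∃ x', x' = ((c - g) / f - V.b₂) / 12 := ⟨_, rfl⟩
  obtain ⟨y', hy'⟩ : ∃ y', y' = (c * (2 * y + W.a₁ * x + W.a₃) / d - V.a₁ * x' - V.a₃) / 2 :=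
    ⟨_, rfl⟩
  have h1 : f * (12 * x' + V.b₂) + g = c := by rw [hx']; field_simp; ring
  have h2 : c * (12 * x + W.b₂) = b := by rw [hc]; field_simp
  have h3 : d * (2 * y' + V.a₁ * x' + V.a₃) = c * (2 * y + W.a₁ * x + W.a₃) := by
    rw [hy']; field_simp; ring
  have hV : V.toAffine.Equation x' y' := by
    rw [equation_iff_short, ← sub_eq_zero]
    refine (mul_eq_zero.mp ?_).resolve_left (mul_ne_zero
      (mul_ne_zero three_ne_zero (pow_ne_zero 2 hc₄)) (pow_ne_zero 3 hf))
    have := h.equation_eq hc₄ h1 h2 h3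
    rw [hP3, hE] at this
    linear_combination this
  have hQ := Affine.equation_iff_nonsingular.mp hV
  exact ⟨.some x' y' hQ,
    (add_self_add_self_eq_zero_iff hQ).mpr ((h.psi_eq_zero_iff hc₄ h1 h2).mpr hP3),
    (h.corresponds_some_iff hP hQ).mpr ⟨c, h1, h2, h3⟩⟩

lemma exists_corresponds_left [W.IsElliptic] (hc₄ : W.c₄ ≠ 0) {Q : V.toAffine.Point}
    (hQ3 : Q + Q + Q = 0) : ∃ P : W.toAffine.Point, P + P + P = 0 ∧ Corresponds A P Q := by
  rcases Q with _ | ⟨x', y', hQ⟩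
  · exact ⟨0, by simp, h.corresponds_zero⟩
  rw [add_self_add_self_eq_zero_iff] at hQ3
  have hE := equation_iff_short.mp hQ.1
  obtain ⟨c, h1⟩ : ∃ c, f * (12 * x' + V.b₂) + g = c := ⟨_, rfl⟩
  have hc : c ≠ 0 := by
    intro h0
    have := h.psi_eq hc₄ h1
    rw [hQ3, h0] at this
    refine pow_ne_zero 4 h.b_ne_zero ?_
    linear_combination this
  obtain ⟨x, hx⟩ : ∃ x, x = (b / c - W.b₂) / 12 := ⟨_, rfl⟩
  obtain ⟨y, hy⟩ : ∃ y, y = (d * (2 * y' + V.a₁ * x' + V.a₃) / c - W.a₁ * x - W.a₃) / 2 :=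
    ⟨_, rfl⟩
  have h2 : c * (12 * x + W.b₂) = b := by rw [hx]; field_simp; ring
  have h3 : d * (2 * y' + V.a₁ * x' + V.a₃) = c * (2 * y + W.a₁ * x + W.a₃) := by
    rw [hy]; field_simp; ring
  have hψ := (h.psi_eq_zero_iff hc₄ h1 h2).mp hQ3
  have hu0 : 12 * x + W.b₂ ≠ 0 := by
    intro h0; exact h.b_ne_zero (by rw [← h2, h0, mul_zero])
  have hW : W.toAffine.Equation x y := by
    rw [equation_iff_short, ← sub_eq_zero]
    refine (mul_eq_zero.mp ?_).resolve_left (mul_ne_zero (pow_ne_zero 3 hc) hu0)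
    have := h.equation_eq hc₄ h1 h2 h3
    rw [hψ, hE] at this
    linear_combination (-1) * this
  have hP := Affine.equation_iff_nonsingular.mp hW
  exact ⟨.some x y hP, (add_self_add_self_eq_zero_iff hP).mpr hψ,
    (h.corresponds_some_iff hP hQ).mpr ⟨c, h1, h2, h3⟩⟩

/-- Three points which sum to zero correspond to three points which sum to zero. If the points are
different, this holds because collinearity is preserved by linear maps; if two of them coincide,
then all three do, because they are three-torsion points. -/
lemma add_add_eq_zero {P₁ P₂ P₃ : W.toAffine.Point} {Q₁ Q₂ Q₃ : V.toAffine.Point}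
    (h₁ : Corresponds A P₁ Q₁) (h₂ : Corresponds A P₂ Q₂) (h₃ : Corresponds A P₃ Q₃)
    (hP₁ : P₁ + P₁ + P₁ = 0) (hP₂ : P₂ + P₂ + P₂ = 0)
    (hQ₁ : Q₁ + Q₁ + Q₁ = 0) (hQ₂ : Q₂ + Q₂ + Q₂ = 0) (hP : P₁ + P₂ + P₃ = 0) :
    Q₁ + Q₂ + Q₃ = 0 := by
  have hneg : ∀ {P P' : W.toAffine.Point} {Q Q' : V.toAffine.Point}, Corresponds A P Q →
      Corresponds A P' Q' → P + P' = 0 → Q + Q' = 0 := by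
    intro P P' Q Q' hPQ hPQ' h0
    rw [add_eq_zero_iff_eq_neg] at h0 ⊢
    rw [h0] at hPQ
    exact hPQ.right_unique h.isUnit_det (h.corresponds_neg hPQ')
  by_cases e₁ : P₁ = 0
  · rw [e₁] at h₁ hP
    rw [h.eq_zero_of_corresponds' h₁, zero_add]
    exact hneg h₂ h₃ (by rwa [zero_add] at hP)
  by_cases e₂ : P₂ = 0
  · rw [e₂] at h₂ hP
    rw [h.eq_zero_of_corresponds' h₂, add_zero]
    exact hneg h₁ h₃ (by rwa [add_zero] at hP)
  by_cases e₃ : P₃ = 0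
  · rw [e₃] at h₃ hP
    rw [h.eq_zero_of_corresponds' h₃, add_zero]
    exact hneg h₁ h₂ (by rwa [add_zero] at hP)
  by_cases e₁₂ : P₁ = P₂
  · have e : P₁ = P₃ := by
      rw [← e₁₂, ← hP₁] at hP
      exact (add_left_cancel hP).symm
    rw [← e₁₂] at h₂
    rw [← e] at h₃
    rwa [h₂.right_unique h.isUnit_det h₁, h₃.right_unique h.isUnit_det h₁]
  have e₁₃ : P₁ ≠ P₃ := by
    intro e
    rw [← e, ← hP₁, add_right_cancel_iff, add_left_cancel_iff] at hP
    exact e₁₂ hP.symm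
  have e₂₃ : P₂ ≠ P₃ := by
    intro e
    rw [← e, ← hP₂, add_right_cancel_iff, add_right_cancel_iff] at hP
    exact e₁₂ hP
  have n₁₂ : P₁ ≠ -P₂ := by
    intro e; rw [e, neg_add_cancel, zero_add] at hP; exact e₃ hP
  have n₁₃ : P₁ ≠ -P₃ := by
    intro e; rw [e, add_right_comm, neg_add_cancel, zero_add] at hP; exact e₂ hP
  have n₂₃ : P₂ ≠ -P₃ := by
    intro e; rw [e, neg_add_cancel_right] at hP; exact e₁ hP
  rcases P₁ with _ | ⟨x₁, y₁, k₁⟩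
  · exact absurd rfl e₁
  rcases P₂ with _ | ⟨x₂, y₂, k₂⟩
  · exact absurd rfl e₂
  rcases P₃ with _ | ⟨x₃, y₃, k₃⟩
  · exact absurd rfl e₃
  rcases Q₁ with _ | ⟨x₁', y₁', k₁'⟩
  · exact absurd (h.eq_zero_of_corresponds h₁) e₁
  rcases Q₂ with _ | ⟨x₂', y₂', k₂'⟩
  · exact absurd (h.eq_zero_of_corresponds h₂) e₂
  rcases Q₃ with _ | ⟨x₃', y₃', k₃'⟩
  · exact absurd (h.eq_zero_of_corresponds h₃) e₃
  have hx : ∀ {x y z w x' y' z' w' : F} {k : W.toAffine.Nonsingular x y}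
      {l : W.toAffine.Nonsingular z w} {k' : V.toAffine.Nonsingular x' y'}
      {l' : V.toAffine.Nonsingular z' w'},
      Corresponds A (Affine.Point.some x y k) (Affine.Point.some x' y' k') →
      Corresponds A (Affine.Point.some z w l) (Affine.Point.some z' w' l') →
      Affine.Point.some x y k ≠ .some z w l → Affine.Point.some x y k ≠ -.some z w l →
      x ≠ z ∧ x' ≠ z' := by
    intro x y z w x' y' z' w' k l k' l' ha hb hne hne'
    refine ⟨fun e => ?_, fun e => ?_⟩
    · exact (Affine.Point.X_eq_iff.mp e).elim hne hne'
    · rcases Affine.Point.X_eq_iff (h₁ := k') (h₂ := l').mp e with e | e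
      · rw [e] at ha
        exact hne (ha.left_unique hb)
      · rw [e] at ha
        exact hne' (ha.left_unique (h.corresponds_neg hb))
  obtain ⟨d₁₂, d₁₂'⟩ := hx h₁ h₂ e₁₂ n₁₂
  obtain ⟨d₁₃, d₁₃'⟩ := hx h₁ h₃ e₁₃ n₁₃
  obtain ⟨d₂₃, d₂₃'⟩ := hx h₂ h₃ e₂₃ n₂₃
  rw [add_add_eq_zero_iff_det k₁ k₂ k₃ d₁₂ d₁₃ d₂₃] at hP
  rw [add_add_eq_zero_iff_det k₁' k₂' k₃' d₁₂' d₁₃' d₂₃']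
  obtain ⟨c₁, hc₁⟩ := h₁
  obtain ⟨c₂, hc₂⟩ := h₂
  obtain ⟨c₃, hc₃⟩ := h₃
  rw [coords_some, coords_some] at hc₁ hc₂ hc₃
  have hmul : !![x₁', y₁', 1; x₂', y₂', 1; x₃', y₃', 1] * Aᵀ =
      Matrix.diagonal ![(c₁ : F), c₂, c₃] * !![x₁, y₁, 1; x₂, y₂, 1; x₃, y₃, 1] := by
    ext i j
    rw [Matrix.diagonal_mul]
    fin_cases i
    · have := congrFun hc₁ j
      fin_cases j <;>
      simp [Matrix.mul_apply, Matrix.mulVec, dotProduct, Fin.sum_univ_three] at this ⊢ <;>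
      linear_combination this
    · have := congrFun hc₂ j
      fin_cases j <;>
      simp [Matrix.mul_apply, Matrix.mulVec, dotProduct, Fin.sum_univ_three] at this ⊢ <;>
      linear_combination this
    · have := congrFun hc₃ j
      fin_cases j <;>
      simp [Matrix.mul_apply, Matrix.mulVec, dotProduct, Fin.sum_univ_three] at this ⊢ <;>
      linear_combination this
  have hdet := congrArg Matrix.det hmul
  rw [Matrix.det_mul, Matrix.det_mul, hP, mul_zero, Matrix.det_transpose] at hdet
  exact (mul_eq_zero.mp hdet).resolve_right h.isUnit_det.ne_zero

end IsHessianChange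

end Correspondence

end HessianCanonical

namespace HessianCanonical

open WeierstrassCurve

/-! ### The isomorphism of the three-torsion -/

section Isomorphism

variable {K : Type*} [Field K] [CharZero K]

open scoped Classical in
omit [CharZero K] in
lemma mem_tors_three_iff_add {E : WeierstrassCurve K} {P : GeomPoint E} :
    P ∈ Tors E 3 ↔ P + P + P = 0 := by
  rw [← two_nsmul, ← succ_nsmul, ← natCast_zsmul]
  exact Submodule.mem_torsionBy_iff _ _

variable {E V : WeierstrassCurve K} [E.IsElliptic] [V.IsElliptic]
  {A : Matrix (Fin 3) (Fin 3) (AlgebraicClosure K)} {b d f g : AlgebraicClosure K}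

/-- The identity of the projective plane restricts to an isomorphism of the three-torsion groups. -/
lemma IsHessianChange.exists_addEquiv
    (h : IsHessianChange (E.baseChange (AlgebraicClosure K)) (V.baseChange (AlgebraicClosure K))
      A b d f g) (hc₄ : (E.baseChange (AlgebraicClosure K)).c₄ ≠ 0) :
    ∃ α : Tors E 3 ≃+ Tors V 3,
      ∀ P : Tors E 3, Corresponds A (P : GeomPoint E) (α P : GeomPoint V) := by
  classical
  have : (E.baseChange (AlgebraicClosure K)).IsElliptic :=
    inferInstanceAs (E.map (algebraMap K (AlgebraicClosure K))).IsElliptic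
  have : (V.baseChange (AlgebraicClosure K)).IsElliptic :=
    inferInstanceAs (V.map (algebraMap K (AlgebraicClosure K))).IsElliptic
  have hr : ∀ P : Tors E 3, ∃ Q : Tors V 3, Corresponds A (P : GeomPoint E) (Q : GeomPoint V) := by
    intro P
    obtain ⟨Q, hQ, hPQ⟩ := h.exists_corresponds_right hc₄ (mem_tors_three_iff_add.mp P.2)
    exact ⟨⟨Q, mem_tors_three_iff_add.mpr hQ⟩, hPQ⟩
  have hl : ∀ Q : Tors V 3, ∃ P : Tors E 3, Corresponds A (P : GeomPoint E) (Q : GeomPoint V) := by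
    intro Q
    obtain ⟨P, hP, hPQ⟩ := h.exists_corresponds_left hc₄ (mem_tors_three_iff_add.mp Q.2)
    exact ⟨⟨P, mem_tors_three_iff_add.mpr hP⟩, hPQ⟩
  choose φ hφ using hr
  choose ψ hψ using hl
  refine ⟨⟨⟨φ, ψ, fun P => ?_, fun Q => ?_⟩, fun P P' => ?_⟩, hφ⟩
  · exact Subtype.ext ((hψ (φ P)).left_unique (hφ P))
  · exact Subtype.ext ((hφ (ψ Q)).right_unique h.isUnit_det (hψ Q))
  · have h3 : Corresponds A (-((P + P' : Tors E 3) : GeomPoint E))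
        (-(φ (P + P') : GeomPoint V)) := h.corresponds_neg (hφ (P + P'))
    have h0 := h.add_add_eq_zero (hφ P) (hφ P') h3 (mem_tors_three_iff_add.mp P.2)
      (mem_tors_three_iff_add.mp P'.2) (mem_tors_three_iff_add.mp (φ P).2)
      (mem_tors_three_iff_add.mp (φ P').2) (by
        rw [AddSubgroup.coe_add, add_neg_cancel])
    refine Subtype.ext ?_
    rw [add_neg_eq_zero] at h0
    exact h0.symm

end Isomorphism

section Canonical

variable {K : Type*} [NontriviallyNormedField K] [IsUltrametricDist K] [CompleteSpace K]
  [CharZero K] {E V : WeierstrassCurve K} [E.IsElliptic] [V.IsElliptic]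

/-- A correspondence of three-torsion points carries the canonical subgroup into the canonical
subgroup. -/
lemma IsHessianChange.mem_canonicalSubgroup {A : Matrix (Fin 3) (Fin 3) (AlgebraicClosure K)}
    {b d f g : AlgebraicClosure K}
    (h : IsHessianChange (E.baseChange (AlgebraicClosure K)) (V.baseChange (AlgebraicClosure K))
      A b d f g) (hE : ‖E.Δ‖ < ‖E.c₄‖ ^ 3) (hV : ‖V.Δ‖ < ‖V.c₄‖ ^ 3) {P : Tors E 3} {Q : Tors V 3}
    (hPQ : Corresponds A (P : GeomPoint E) (Q : GeomPoint V)) (hP : P ∈ canonicalSubgroup E 3) :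
    Q ∈ canonicalSubgroup V 3 := by
  rw [mem_canonicalSubgroup_iff hE] at hP
  rw [mem_canonicalSubgroup_iff hV]
  intro x' y' hQ' hQ
  rw [hQ] at hPQ
  rcases hP' : (P : GeomPoint E) with _ | ⟨x, y, hxy⟩
  · rw [hP'] at hPQ
    exact absurd (h.eq_zero_of_corresponds' hPQ) (Affine.Point.some_ne_zero hQ')
  rw [hP'] at hPQ
  obtain ⟨c, h1, h2, -⟩ := (h.corresponds_some_iff _ _).mp hPQ
  have hs := hP x y hxy hP'
  have hψ := (mem_tors_three_iff hxy).mp (hP' ▸ P.2)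
  let := spectralNorm.normedField K (AlgebraicClosure K)
  have : IsUltrametricDist (AlgebraicClosure K) := isUltrametricDist_spectralNorm _
  have hE' : ‖(E.baseChange (AlgebraicClosure K)).Δ‖ <
      ‖(E.baseChange (AlgebraicClosure K)).c₄‖ ^ 3 := spectralNorm_Δ_lt hE
  have hV' : ‖(V.baseChange (AlgebraicClosure K)).Δ‖ <
      ‖(V.baseChange (AlgebraicClosure K)).c₄‖ ^ 3 := spectralNorm_Δ_lt hV
  have hc₆ := c₆_ne_zero_of_norm_lt hE'
  exact one_le_norm_of_hessian (norm_Δ_div_lt hE') hs (normCoord_quartic hc₆ hψ)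
    (h.normCoord_eq (c₄_ne_zero_of_norm_lt hE') hc₆ (c₆_ne_zero_of_norm_lt hV') h1 h2)

open scoped Classical in
/-- A canonical subgroup is generated by any of its nonzero elements. -/
lemma eq_or_eq_neg_of_mem_canonicalSubgroup (hE : ‖E.Δ‖ < ‖E.c₄‖ ^ 3) {P P' : Tors E 3}
    (hP : P ∈ canonicalSubgroup E 3) (hP' : P' ∈ canonicalSubgroup E 3) (h0 : P ≠ 0)
    (h0' : P' ≠ 0) : P = P' ∨ P = -P' := by
  rw [mem_canonicalSubgroup_iff hE] at hP hP'
  rcases e : (P : GeomPoint E) with _ | ⟨x, y, hxy⟩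
  · exact absurd (Subtype.ext e) h0
  rcases e' : (P' : GeomPoint E) with _ | ⟨x', y', hxy'⟩
  · exact absurd (Subtype.ext e') h0'
  have hx : x = x' := by
    let := spectralNorm.normedField K (AlgebraicClosure K)
    have : IsUltrametricDist (AlgebraicClosure K) := isUltrametricDist_spectralNorm _
    exact eq_of_one_le_norm_normCoord (spectralNorm_Δ_lt hE)
      ((mem_tors_three_iff hxy).mp (e ▸ P.2)) ((mem_tors_three_iff hxy').mp (e' ▸ P'.2))
      (hP x y hxy e) (hP' x' y' hxy' e')
  rcases (Affine.Point.X_eq_iff (h₁ := hxy) (h₂ := hxy')).mp hx with h | h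
  · left
    exact Subtype.ext (by rw [e, e', h])
  · right
    exact Subtype.ext (by rw [AddSubgroup.coe_neg, e, e', h])

open scoped Classical in
lemma neg_mem_canonicalSubgroup (hE : ‖E.Δ‖ < ‖E.c₄‖ ^ 3) {P : Tors E 3}
    (hP : P ∈ canonicalSubgroup E 3) : -P ∈ canonicalSubgroup E 3 := by
  rw [mem_canonicalSubgroup_iff hE] at hP ⊢
  intro x y hxy h
  rw [AddSubgroup.coe_neg, neg_eq_iff_eq_neg, Affine.Point.neg_some] at h
  exact hP _ _ _ h

lemma zero_mem_canonicalSubgroup (hE : ‖E.Δ‖ < ‖E.c₄‖ ^ 3) : (0 : Tors E 3) ∈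
    canonicalSubgroup E 3 := by
  rw [mem_canonicalSubgroup_iff hE]
  intro x y hxy h
  exact absurd h.symm (Affine.Point.some_ne_zero hxy)

end Canonical

end HessianCanonical

open HessianCanonical in
theorem mainTheorem5 {K : Type*} [NontriviallyNormedField K] [IsUltrametricDist K] [ProperSpace K]
    [CharZero K] (E : WeierstrassCurve K) [E.IsElliptic]
    (H : WeierstrassModel (hess E)) [H.curve.IsElliptic]
    (hE : HasPotentiallyMultiplicativeReduction E)
    (hH : HasPotentiallyMultiplicativeReduction H.curve) :
    ∃ α : Tors E 3 ≃+ Tors H.curve 3,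
      (∀ P : Tors E 3, ∃ c : (AlgebraicClosure K)ˣ,
        H.toPlane (α P) = (c : AlgebraicClosure K) • coords (P : GeomPoint E)) ∧
      α '' canonicalSubgroup E 3 = canonicalSubgroup H.curve 3 := by
  have hE' := hE.norm_Δ_lt
  have hH' := hH.norm_Δ_lt
  have hc₄ := c₄_ne_zero_of_norm_lt hE'
  obtain ⟨b, d, f, g, h₀⟩ := H.exists_isHessianChange hc₄
  have h := h₀.map (algebraMap K (AlgebraicClosure K))
  obtain ⟨α, hα⟩ := IsHessianChange.exists_addEquiv (E := E) (V := H.curve) h (by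
    rw [WeierstrassCurve.baseChange, WeierstrassCurve.map_c₄]
    exact (map_ne_zero _).mpr hc₄)
  refine ⟨α, hα, Set.Subset.antisymm ?_ fun Q hQ => ?_⟩
  · rintro _ ⟨P, hP, rfl⟩
    exact IsHessianChange.mem_canonicalSubgroup h hE' hH' (hα P) hP
  by_cases hQ0 : Q = 0
  · exact ⟨0, zero_mem_canonicalSubgroup hE', by rw [hQ0, map_zero]⟩
  -- A nonzero canonical point of `E` goes to a canonical point of `H`, which must be `Q` or `-Q`.
  obtain ⟨T⟩ := nonempty_tateParametrization hE'
  obtain ⟨P, hP, hP0⟩ := exists_mem_canonicalSubgroup T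
  have hαP := IsHessianChange.mem_canonicalSubgroup h hE' hH' (hα P) hP
  have hαP0 : α P ≠ 0 := (map_ne_zero_iff α α.injective).mpr hP0
  rcases eq_or_eq_neg_of_mem_canonicalSubgroup hH' hQ hαP hQ0 hαP0 with hQP | hQP
  · exact ⟨P, hP, hQP.symm⟩
  · exact ⟨-P, neg_mem_canonicalSubgroup hE' hP, by rw [map_neg, hQP]⟩
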